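/- Let $\Omega\subseteq\mathbb{R}^d$ ($d\ge 1$) be open with piecewise smooth boundary, and let $\pi>0$ be a probability density on $\Omega$ of class $C^1$; put $\bm u=\nabla\log\pi$ and $\mu(g)=\int_\Omega g\,\pi\,\mathrm{d}\bm x$. Let $\mathcal H$ be a reproducing kernel Hilbert space of real functions on $\Omega$ whose kernel $k$ is of class $C^2$ on $\Omega\times\Omega$, and suppose that for $\pi$-almost all $\bm x\in\Omega$ the functions $k(\bm x,\cdot)\pi$ and $\nabla_{\bm x}k(\bm x,\cdot)\,\pi$ extend continuously to $\overline\Omega$ and $$\oint_{\partial\Omega}k(\bm x,\bm x')\pi(\bm x')\bm n(\bm x')\,S(\mathrm d\bm x')=\bm 0,\qquad \oint_{\partial\Omega}\nabla_{\bm x}k(\bm x,\bm x')\pi(\bm x')\cdot\bm n(\bm x')\,S(\mathrm d\bm x')=0,$$ where $\bm n$ is the outward unit normal and, if $\Omega$ is unbounded, $\oint_{\partial\Omega}$ means the limit as $r\to\infty$ of the integrals over the boundary of $\Omega\cap\{\|\bm x\|<r\}$. Let $\mathcal H_0$ be the space of the functions $\psi=\nabla\cdot\bm\phi+\bm\phi\cdot\bm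 u$, $\bm\phi\in\mathcal H^d$, with norm $\|\psi\|_{\mathcal H_0}=\inf\|\bm\phi\|_{\mathcal H^d}$ over all $\bm\phi$ that represent $\psi$ (this is the reproducing kernel Hilbert space with kernel $k_0(\bm x,\bm x')=\nabla_{\bm x}\cdot\nabla_{\bm x'}k(\bm x,\bm x')+\bm u(\bm x)\cdot\nabla_{\bm x'}k(\bm x,\bm x')+\bm u(\bm x')\cdot\nabla_{\bm x}k(\bm x,\bm x')+\bm u(\bm x)\cdot\bm u(\bm x')k(\bm x,\bm x')$), and assume that every $\psi\in\mathcal H_0$ is integrable with respect to $\pi$ (for instance $\mathcal H_0\subset\mathcal L^2(\pi)$). Let $\mathcal H_+=\{c+\psi: c\in\mathbb R,\ \psi\in\mathcal H_0\}$ with $\|c+\psi\|_{\mathcal H_+}^2=c^2+\|\psi\|_{\mathcal H_0}^2$, and let $f\in\mathcal H_+$. Let $\mathcal D_0=(\bm x_1,\dots,\bm x_m)$ and $\mathcal D_1=(\bm x_{m+1},\dots,\bm x_n)$ be points of $\Omega$, $1\le m<n$. Put $(\bm K_0)_{i,j}=k_0(\bm x_i,\bm x_j)$, $(\bm K_{1,0})_{i,j}=k_0(\bm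 x_{m+i},\bm x_j)$, $(\bm K_1)_{i,j}=k_0(\bm x_{m+i},\bm x_{m+j})$, $\bm K_{0,1}=\bm K_{1,0}^T$, and assume that $\bm K_0$ is invertible. For each $\lambda>0$ there is a unique minimiser $s_\lambda$ over $g\in\mathcal H_+$ of $\frac1m\sum_{j=1}^m(f(\bm x_j)-g(\bm x_j))^2+\lambda\|g\|_{\mathcal H_+}^2$; put $$\hat\mu_\lambda=\frac1{n-m}\sum_{i=m+1}^n\bigl(f(\bm x_i)-s_\lambda(\bm x_i)+\mu(s_\lambda)\bigr).$$ Then $\hat\mu_\lambda$ converges as $\lambda\searrow0$, and its limit $\hat\mu$ satisfies $$|\hat\mu-\mu(f)|\le D^{1/2}\,\|f\|_{\mathcal H_+},\qquad D=\frac1{(n-m)^2}\left[\frac{(\bm 1^T\bm K_{1,0}\bm K_0^{-1}\bm 1)^2}{1+\bm 1^T\bm K_0^{-1}\bm 1}-\bm 1^T\bm K_{1,0}\bm K_0^{-1}\bm K_{0,1}\bm 1+\bm 1^T\bm K_1\bm 1\right]\ge0.$$ Moreover $\hat\mu=\sum_{i=1}^n w_if(\bm x_i)$ and $D=\bm w^T\bm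 K\bm w+(1-\bm 1^T\bm w)^2$, where $$\bm K=\begin{bmatrix}\bm K_0&\bm K_{0,1}\\ \bm K_{1,0}&\bm K_1\end{bmatrix},\qquad \bm w=\frac1{n-m}\begin{bmatrix}-\bm K_0^{-1}\bm K_{0,1}\bm 1+\dfrac{\bm 1^T\bm K_0^{-1}\bm K_{0,1}\bm 1}{1+\bm 1^T\bm K_0^{-1}\bm 1}\,\bm K_0^{-1}\bm 1\\ \bm 1\end{bmatrix}.$$ -/

import Mathlib

open Set Filter Topology MeasureTheory Matrix
open scoped ContDiff

noncomputable section

namespace ControlFunctional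

/-! ### Surface integrals over boundaries -/

section Boundary

variable {d : ℕ}

/-- `ρ` is a smooth local defining function of `Ω` at the boundary point `x`: near `x` the set `Ω`
is `{ρ < 0}`, where `ρ` is infinitely differentiable, `ρ x = 0` and `∇ρ x ≠ 0`. -/
def IsDefiningFunction (Ω : Set (EuclideanSpace ℝ (Fin d))) (x : EuclideanSpace ℝ (Fin d))
    (ρ : EuclideanSpace ℝ (Fin d) → ℝ) : Prop :=
  ρ x = 0 ∧ gradient ρ x ≠ 0 ∧
    ∃ U : Set (EuclideanSpace ℝ (Fin d)), IsOpen U ∧ x ∈ U ∧ ContDiffOn ℝ ∞ ρ U ∧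
      ∀ y ∈ U, (y ∈ Ω ↔ ρ y < 0)

/-- `x` is a smooth boundary point of `Ω`. -/
def IsSmoothBoundaryPoint (Ω : Set (EuclideanSpace ℝ (Fin d))) (x : EuclideanSpace ℝ (Fin d)) :
    Prop :=
  ∃ ρ, IsDefiningFunction Ω x ρ

open Classical in
/-- The outward unit normal `∇ρ x / ‖∇ρ x‖` at a smooth boundary point (it does not depend on the
defining function `ρ`), and `0` elsewhere. -/
def outwardNormal (Ω : Set (EuclideanSpace ℝ (Fin d))) (x : EuclideanSpace ℝ (Fin d)) :
    EuclideanSpace ℝ (Fin d) :=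
  if h : IsSmoothBoundaryPoint Ω x then
    ‖gradient h.choose x‖⁻¹ • gradient h.choose x
  else 0

/-- The boundary of `Ω` is piecewise smooth: it has locally finite surface measure, and all of its
points are smooth boundary points, apart from a set of zero surface measure (edges, corners).
Surface measure is the `(d-1)`-dimensional Hausdorff measure, with the Euclidean normalisation. -/
def HasPiecewiseSmoothBoundary (Ω : Set (EuclideanSpace ℝ (Fin d))) : Prop :=
  (∀ r : ℝ, μHE[d - 1] (frontier Ω ∩ Metric.closedBall 0 r) < ⊤) ∧
    μHE[d - 1] {x ∈ frontier Ω | ¬ IsSmoothBoundaryPoint Ω x} = 0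

/-- The part of `Ω` in the open ball of radius `r` about the origin. -/
def truncated (Ω : Set (EuclideanSpace ℝ (Fin d))) (r : ℝ) : Set (EuclideanSpace ℝ (Fin d)) :=
  Ω ∩ Metric.ball 0 r

/-- `∮_{∂Ω} g n dS = 0` (a vector) for a function `g` on `Ω`. The values of `g` on `∂Ω` are those
of its continuous extension `G` to the closure of `Ω`. The integral is the limit, as `r → ∞`, of the
integrals over the boundary of `Ω ∩ {‖x‖ < r}`; these are eventually equal to `∮_{∂Ω}` if `Ω` is
bounded, and they are integrals over spheres if `Ω` is the whole space. -/
def ScalarFluxVanishes (Ω : Set (EuclideanSpace ℝ (Fin d)))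
    (g : EuclideanSpace ℝ (Fin d) → ℝ) : Prop :=
  ∃ G : EuclideanSpace ℝ (Fin d) → ℝ, ContinuousOn G (closure Ω) ∧ EqOn G g Ω ∧
    Tendsto (fun r : ℝ => ∫ y in frontier (truncated Ω r),
      G y • outwardNormal (truncated Ω r) y ∂μHE[d - 1]) atTop (𝓝 0)

/-- `∮_{∂Ω} F · n dS = 0` for a vector field `F` on `Ω`, with the same conventions as in
`ScalarFluxVanishes`. -/
def VectorFluxVanishes (Ω : Set (EuclideanSpace ℝ (Fin d)))
    (F : EuclideanSpace ℝ (Fin d) → EuclideanSpace ℝ (Fin d)) : Prop :=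
  ∃ G : EuclideanSpace ℝ (Fin d) → EuclideanSpace ℝ (Fin d),
    ContinuousOn G (closure Ω) ∧ EqOn G F Ω ∧
    Tendsto (fun r : ℝ => ∫ y in frontier (truncated Ω r),
      inner ℝ (G y) (outwardNormal (truncated Ω r) y) ∂μHE[d - 1]) atTop (𝓝 0)

end Boundary

/-! ### The density and the kernels -/

section Kernel

variable {d : ℕ}

/-- The probability measure on `Ω` with density `π`. -/
def targetMeasure (Ω : Set (EuclideanSpace ℝ (Fin d))) (π : EuclideanSpace ℝ (Fin d) → ℝ) :
    Measure (EuclideanSpace ℝ (Fin d)) :=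
  (volume.restrict Ω).withDensity fun x => ENNReal.ofReal (π x)

/-- `u = ∇ log π`. -/
def score (π : EuclideanSpace ℝ (Fin d) → ℝ) (x : EuclideanSpace ℝ (Fin d)) :
    EuclideanSpace ℝ (Fin d) :=
  gradient (fun y => Real.log (π y)) x

/-- `∇ₓ k(x, x')`. -/
def gradFst (k : EuclideanSpace ℝ (Fin d) → EuclideanSpace ℝ (Fin d) → ℝ)
    (x x' : EuclideanSpace ℝ (Fin d)) : EuclideanSpace ℝ (Fin d) :=
  gradient (fun y => k y x') x

/-- `∇ₓ' k(x, x')`. -/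
def gradSnd (k : EuclideanSpace ℝ (Fin d) → EuclideanSpace ℝ (Fin d) → ℝ)
    (x x' : EuclideanSpace ℝ (Fin d)) : EuclideanSpace ℝ (Fin d) :=
  gradient (fun y' => k x y') x'

/-- `∇ₓ · ∇ₓ' k(x, x')`, the sum of the mixed derivatives `∂²k / ∂xᵢ ∂x'ᵢ`. -/
def divGrad (k : EuclideanSpace ℝ (Fin d) → EuclideanSpace ℝ (Fin d) → ℝ)
    (x x' : EuclideanSpace ℝ (Fin d)) : ℝ :=
  ∑ i, fderiv ℝ (fun y => gradSnd k y x' i) x (EuclideanSpace.single i 1)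

/-- The gradient-based kernel `k₀`. -/
def steinKernel (π : EuclideanSpace ℝ (Fin d) → ℝ)
    (k : EuclideanSpace ℝ (Fin d) → EuclideanSpace ℝ (Fin d) → ℝ)
    (x x' : EuclideanSpace ℝ (Fin d)) : ℝ :=
  divGrad k x x' + inner ℝ (score π x) (gradSnd k x x') + inner ℝ (score π x') (gradFst k x x')
    + inner ℝ (score π x) (score π x') * k x x'

end Kernel

/-! ### The Hilbert spaces of functions

`H` is a reproducing kernel Hilbert space of real functions on `Ω`. -/

section Spaces

variable {d : ℕ} {Ω : Set (EuclideanSpace ℝ (Fin d))}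
  (H : Type*) [NormedAddCommGroup H] [InnerProductSpace ℝ H] [RKHS ℝ H Ω ℝ]

open Classical in
/-- The reproducing kernel of `H` as a real function of two points; only its values on `Ω × Ω`
matter, it is set to `0` elsewhere. -/
def kernelFun [CompleteSpace H] (x x' : EuclideanSpace ℝ (Fin d)) : ℝ :=
  if h : x ∈ Ω ∧ x' ∈ Ω then RKHS.kernel H (⟨x, h.1⟩ : Ω) (⟨x', h.2⟩ : Ω) (1 : ℝ) else 0

variable {H}

/-- The function `ψ = ∇ · φ + φ · u` on `Ω` for `φ ∈ H^d`. (To differentiate a function on the open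
set `Ω`, it is extended by zero.) -/
def controlFunctional (π : EuclideanSpace ℝ (Fin d) → ℝ) (φ : PiLp 2 fun _ : Fin d => H) :
    Ω → ℝ := fun x =>
  ∑ i, (fderiv ℝ (Function.extend Subtype.val (φ i : Ω → ℝ) 0) (x : EuclideanSpace ℝ (Fin d))
      (EuclideanSpace.single i 1)
    + (φ i : Ω → ℝ) x * score π x i)

variable (H)

/-- The space `H₀` of control functionals. -/
def spaceZero (π : EuclideanSpace ℝ (Fin d) → ℝ) : Set (Ω → ℝ) :=
  range (controlFunctional (H := H) π)

/-- The norm of `H₀`: the least norm in `H^d` of a `φ` that represents `ψ`. -/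
def normZero (π : EuclideanSpace ℝ (Fin d) → ℝ) (ψ : Ω → ℝ) : ℝ :=
  sInf {r | ∃ φ : PiLp 2 fun _ : Fin d => H, controlFunctional π φ = ψ ∧ r = ‖φ‖}

/-- The space `H₊` of the functions `c + ψ` with a constant `c` and `ψ ∈ H₀`. -/
def spacePlus (π : EuclideanSpace ℝ (Fin d) → ℝ) : Set (Ω → ℝ) :=
  {f | ∃ c : ℝ, ∃ ψ ∈ spaceZero H π, f = fun x => c + ψ x}

/-- The norm of `H₊`: `‖c + ψ‖² = c² + ‖ψ‖²`. (If constants other than `0` do not belong to `H₀`,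
then the representation of `f` is unique, and the infimum is over one number. In general it is the
norm of the sum of the two reproducing kernel Hilbert spaces.) -/
def normPlus (π : EuclideanSpace ℝ (Fin d) → ℝ) (f : Ω → ℝ) : ℝ :=
  sInf {r | ∃ c : ℝ, ∃ ψ ∈ spaceZero H π, (f = fun x => c + ψ x) ∧
    r = √(c ^ 2 + normZero H π ψ ^ 2)}

end Spaces

/-! ### The estimator -/

section Estimator

variable {d : ℕ} {Ω : Set (EuclideanSpace ℝ (Fin d))}

/-- `μ(g)`, the integral of `g` against the density `π` over `Ω` with Lebesgue measure. -/
def mean (π : EuclideanSpace ℝ (Fin d) → ℝ) (g : Ω → ℝ) : ℝ :=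
  ∫ x, g x * π x ∂(volume.comap (Subtype.val : Ω → EuclideanSpace ℝ (Fin d)))

/-- The integral defining `μ(g)` exists. -/
def HasMean (π : EuclideanSpace ℝ (Fin d) → ℝ) (g : Ω → ℝ) : Prop :=
  Integrable (fun x => g x * π x) (volume.comap (Subtype.val : Ω → EuclideanSpace ℝ (Fin d)))

/-- The regularised least-squares objective. -/
def rlsObjective (H : Type*) [NormedAddCommGroup H] [InnerProductSpace ℝ H] [RKHS ℝ H Ω ℝ]
    (π : EuclideanSpace ℝ (Fin d) → ℝ) {m : ℕ} (x₀ : Fin m → Ω) (f : Ω → ℝ) (l : ℝ)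
    (g : Ω → ℝ) : ℝ :=
  (1 / m : ℝ) * ∑ j, (f (x₀ j) - g (x₀ j)) ^ 2 + l * normPlus H π g ^ 2

/-- `s` is a regularised least-squares approximation of `f`: it minimises the objective over
`H₊`. -/
def IsRLS (H : Type*) [NormedAddCommGroup H] [InnerProductSpace ℝ H] [RKHS ℝ H Ω ℝ]
    (π : EuclideanSpace ℝ (Fin d) → ℝ) {m : ℕ} (x₀ : Fin m → Ω) (f : Ω → ℝ) (l : ℝ)
    (s : Ω → ℝ) : Prop :=
  s ∈ spacePlus H π ∧ IsMinOn (rlsObjective H π x₀ f l) (spacePlus H π) s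

/-- The control functional estimator built on the approximation `s` of `f`: the average over the
second sample of `f - s + μ(s)`. -/
def estimator (π : EuclideanSpace ℝ (Fin d) → ℝ) {p : ℕ} (x₁ : Fin p → Ω) (f s : Ω → ℝ) : ℝ :=
  (1 / p : ℝ) * ∑ i, (f (x₁ i) - s (x₁ i) + mean π s)

/-- The matrix of the values of a kernel at two families of points. -/
def kernelMatrix (k : EuclideanSpace ℝ (Fin d) → EuclideanSpace ℝ (Fin d) → ℝ) {m p : ℕ}
    (x : Fin m → Ω) (y : Fin p → Ω) : Matrix (Fin m) (Fin p) ℝ :=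
  Matrix.of fun i j => k (x i) (y j)

end Estimator

/-! ### Matrix formulas -/

section Formulas

variable {m p : ℕ}

/-- The discrepancy `D` in terms of `K₀`, `K₁₀` and `K₁`, with `K₀₁` the transpose of `K₁₀`. -/
def discrepancy (K₀ : Matrix (Fin m) (Fin m) ℝ) (K₁₀ : Matrix (Fin p) (Fin m) ℝ)
    (K₁ : Matrix (Fin p) (Fin p) ℝ) : ℝ :=
  (1 / (p : ℝ) ^ 2) *
    ((1 ⬝ᵥ ((K₁₀ * K₀⁻¹) *ᵥ 1)) ^ 2 / (1 + 1 ⬝ᵥ (K₀⁻¹ *ᵥ 1))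
      - 1 ⬝ᵥ ((K₁₀ * K₀⁻¹ * K₁₀ᵀ) *ᵥ 1) + 1 ⬝ᵥ (K₁ *ᵥ 1))

/-- The weights of the estimator on the two samples (for regularisation parameter zero). -/
def weights (K₀ : Matrix (Fin m) (Fin m) ℝ) (K₁₀ : Matrix (Fin p) (Fin m) ℝ) :
    Fin m ⊕ Fin p → ℝ :=
  Sum.elim
    (-(1 / p : ℝ) • ((K₀⁻¹ * K₁₀ᵀ) *ᵥ 1)
      + ((1 / p : ℝ) * (1 ⬝ᵥ ((K₀⁻¹ * K₁₀ᵀ) *ᵥ 1)) / (1 + 1 ⬝ᵥ (K₀⁻¹ *ᵥ 1))) • (K₀⁻¹ *ᵥ 1))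
    (fun _ => 1 / p)

/-- The kernel matrix of the whole sample. -/
def fullMatrix (K₀ : Matrix (Fin m) (Fin m) ℝ) (K₁₀ : Matrix (Fin p) (Fin m) ℝ)
    (K₁ : Matrix (Fin p) (Fin p) ℝ) : Matrix (Fin m ⊕ Fin p) (Fin m ⊕ Fin p) ℝ :=
  Matrix.fromBlocks K₀ K₁₀ᵀ K₁₀ K₁

end Formulas

end ControlFunctional

end

/-!
The argument rests on two facts: control functionals have mean zero, and the estimator is linear
algebra in a Hilbert space.

**Mean zero.** For fixed `x` the function `k₀(x, ·) π` is the divergence of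
`∇ₓ k(x, ·) π + k(x, ·) π u(x)` (`divergence_eq_steinKernel_mul`), so that its integral over `Ω` is
a boundary integral, which vanishes by assumption (`integral_divergence_eq_zero`). This needs the
Gauss–Green formula on a bounded open set whose boundary is smooth up to a set of zero surface
measure, for fields that are continuous up to the boundary and have an integrable divergence
(`integral_divergence_eq`). Near a smooth boundary point the set lies below a graph that is nearly
flat, so that the formula for compactly supported smooth fields holds with small relative error by
Fubini's theorem and the fundamental theorem of calculus; a translation inwards extends it to fields
that are merely continuous up to the boundary, and a compactness argument makes the error global and
hence zero. The singular part of the boundary is cut off by functions with small gradients in `L¹`.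
For unbounded `Ω` the formula is applied to truncations by almost all balls.

Since the kernel is of class `C²`, the feature map `κ(x) = k(x, ·)` is Fréchet differentiable
(`differentiableAt_of_contDiffAt_inner`). With `ξ(x)ᵢ = ∂ᵢκ(x) + uᵢ(x) κ(x)`, an element of `H^d`,
the control functional of `φ` is `x ↦ ⟪ξ(x), φ⟫`, and `k₀(x, x') = ⟪ξ(x), ξ(x')⟫`. By the closed graph
theorem `φ ↦ μ(⟪ξ, φ⟫)` is bounded, hence of the form `⟪Λ, ·⟫`; by the first part `⟪Λ, ξ(x)⟫ = 0`
for almost all `x`, whence `‖Λ‖² = μ(⟪ξ, Λ⟫) = 0` (`integral_inner_eq_zero`). So `μ` vanishes on `H₀`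
(`mean_controlFunctional`), and `μ(c + ψ) = c`.

**Linear algebra.** The elements of `H₊` are the functions `⟪ζ(x), e⟫` with `ζ(x) = (1, ξ(x))` and
`e` in `ℝ × H^d`, and their norm is the least norm of such an `e`. Completing the square shows that the
regularised least-squares problem has the solution `∑ j, aⱼ ζ(xⱼ)`, where
`(K₀ + 1 1ᵀ + λ m) a = f(xⱼ)ⱼ` (`isRLS_iff`). As `K₀` is invertible, the matrix stays invertible at
`λ = 0`, and the coefficients converge. The Sherman–Morrison formula gives the weights of the limit.
The error is `⟪∑ i, wᵢ ζ(xᵢ) - (1, 0), e⟫`, and the bound is the Cauchy–Schwarz inequality, for the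
squared norm of the left factor is `wᵀ K w + (1 - 1ᵀ w)²`, which equals `D`.
-/

set_option linter.unusedSectionVars false

namespace ControlFunctional

/-! ### Boundaries as nearly flat graphs -/

section Slant

variable {E : Type*} [NormedAddCommGroup E] [InnerProductSpace ℝ E] [FiniteDimensional ℝ E]
  [MeasurableSpace E] [BorelSpace E]

/-- The affine parametrisation of the space by the hyperplane orthogonal to `n` and a direction `v`
transversal to it. -/
def slantMap (x₀ n v : E) (p : (ℝ ∙ n)ᗮ × ℝ) : E := x₀ + p.1 + p.2 • v

lemma continuous_slantMap (x₀ n v : E) : Continuous (slantMap x₀ n v) := by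
  unfold slantMap; fun_prop

lemma inner_coe_orthogonal (n : E) (y : (ℝ ∙ n)ᗮ) : inner ℝ n (y : E) = 0 :=
  Submodule.mem_orthogonal_singleton_iff_inner_right.1 y.2

lemma inner_slantMap_sub {n v : E} (hv : inner ℝ n v = 1) (x₀ : E) (p q : (ℝ ∙ n)ᗮ × ℝ) :
    inner ℝ n (slantMap x₀ n v p - slantMap x₀ n v q) = p.2 - q.2 := by
  simp [slantMap, inner_sub_right, inner_add_right, inner_smul_right, inner_coe_orthogonal, hv]

/-- Shears and rotations preserve volume. -/
lemma measurePreserving_slantMap {n v : E} (hn : ‖n‖ = 1) (hv : inner ℝ n v = 1) (x₀ : E) :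
    MeasurePreserving (slantMap x₀ n v) := by
  have hτ : v - n ∈ (ℝ ∙ n)ᗮ := by
    rw [Submodule.mem_orthogonal_singleton_iff_inner_right, inner_sub_right, hv,
      real_inner_self_eq_norm_sq, hn]; norm_num
  have h1 : MeasurePreserving (Prod.swap : (ℝ ∙ n)ᗮ × ℝ → ℝ × (ℝ ∙ n)ᗮ) :=
    Measure.measurePreserving_swap
  have h2 : MeasurePreserving (fun p : ℝ × (ℝ ∙ n)ᗮ => (p.1, p.1 • (⟨v - n, hτ⟩ : (ℝ ∙ n)ᗮ) + p.2))
      (volume : Measure (ℝ × (ℝ ∙ n)ᗮ)) (volume : Measure (ℝ × (ℝ ∙ n)ᗮ)) := by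
    refine MeasurePreserving.skew_product (f := id)
      (g := fun t y => t • (⟨v - n, hτ⟩ : (ℝ ∙ n)ᗮ) + y) (MeasurePreserving.id _) ?_ ?_
    · fun_prop
    · exact Eventually.of_forall fun t => (measurePreserving_add_left volume _).map_eq
  have h3 : MeasurePreserving (Prod.map (LinearIsometryEquiv.toSpanUnitSingleton (𝕜 := ℝ) n hn)
      (id : (ℝ ∙ n)ᗮ → (ℝ ∙ n)ᗮ)) (volume : Measure (ℝ × (ℝ ∙ n)ᗮ)) volume :=
    (LinearIsometryEquiv.toSpanUnitSingleton (𝕜 := ℝ) n hn).measurePreserving.prod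
      (MeasurePreserving.id volume)
  have h4 := ((ℝ ∙ n).measurePreserving_measurableEquivProd x₀).symm
  rw [InnerProductSpace.euclideanHausdorffMeasure_eq_volume] at h4
  have h := h4.comp (h3.comp (h2.comp h1))
  convert h using 1
  ext p
  simp [slantMap, smul_sub]
  abel

lemma measurableEmbedding_slantMap {n v : E} (hv : inner ℝ n v = 1) (x₀ : E) :
    MeasurableEmbedding (slantMap x₀ n v) := by
  refine (continuous_slantMap x₀ n v).measurableEmbedding ?_
  intro p q h
  have h2 : p.2 = q.2 := by
    have := inner_slantMap_sub hv x₀ p q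
    rw [h, sub_self, inner_zero_right] at this; linarith
  have h1 : p.1 = q.1 := by
    have h' := h
    simp only [slantMap, h2] at h'
    exact Subtype.ext (by simpa using h')
  exact Prod.ext h1 h2

lemma slantMap_surjective {n v : E} (hv : inner ℝ n v = 1) (x₀ : E) :
    Function.Surjective (slantMap x₀ n v) := by
  intro z
  refine ⟨(⟨z - x₀ - (inner ℝ n (z - x₀)) • v, ?_⟩, inner ℝ n (z - x₀)), ?_⟩
  · rw [Submodule.mem_orthogonal_singleton_iff_inner_right, inner_sub_right, inner_smul_right, hv]
    ring
  · simp only [slantMap]; abel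

/-- The open cylinder about `x₀` with base of radius `a` in the hyperplane orthogonal to `n` and
axis `v`; its points have height between `-b` and `b`, measured by the pairing with `n`. -/
def cylinder (x₀ n v : E) (a b : ℝ) : Set E :=
  slantMap x₀ n v '' (Metric.ball 0 a ×ˢ Ioo (-b) b)

lemma slantMap_eq_iff {n v : E} (hv : inner ℝ n v = 1) {x₀ : E} {p : (ℝ ∙ n)ᗮ × ℝ} {z : E}
    (h : slantMap x₀ n v p = z) :
    p.2 = inner ℝ n (z - x₀) ∧ (p.1 : E) = z - x₀ - (inner ℝ n (z - x₀)) • v := by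
  have : p.2 = inner ℝ n (z - x₀) := by
    rw [← h, slantMap, add_assoc, add_sub_cancel_left, inner_add_right, inner_smul_right,
      inner_coe_orthogonal, hv]; ring
  refine ⟨this, ?_⟩
  rw [← this, ← h, slantMap]; abel

lemma cylinder_eq {n v : E} (hv : inner ℝ n v = 1) (x₀ : E) (a b : ℝ) :
    cylinder x₀ n v a b = {z | ‖z - x₀ - (inner ℝ n (z - x₀)) • v‖ < a ∧
      inner ℝ n (z - x₀) ∈ Ioo (-b) b} := by
  ext z
  obtain ⟨p, hp⟩ := slantMap_surjective hv x₀ z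
  obtain ⟨h2, h1⟩ := slantMap_eq_iff hv hp
  have : z ∈ cylinder x₀ n v a b ↔ p ∈ (Metric.ball 0 a ×ˢ Ioo (-b) b) := by
    rw [cylinder, ← hp, (measurableEmbedding_slantMap hv x₀).injective.mem_set_image]
  rw [this, mem_ofPred_eq, ← h1, ← h2]
  simp

lemma isOpen_cylinder {n v : E} (hv : inner ℝ n v = 1) (x₀ : E) (a b : ℝ) :
    IsOpen (cylinder x₀ n v a b) := by
  rw [cylinder_eq hv]
  refine IsOpen.and ?_ ?_
  · exact isOpen_lt (by fun_prop) continuous_const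
  · exact isOpen_Ioo.preimage (show Continuous fun z => inner ℝ n (z - x₀) by fun_prop)

/-- A tolerance `η` for which an error `η * r` changes lengths by at most a factor `K`. -/
lemma exists_graph_constants {r K : ℝ} (hr : 0 ≤ r) (hK : 1 < K) :
    ∃ η, 0 < η ∧ η ≤ 1 ∧ K⁻¹ ≤ 1 - η * r ∧ 1 + η * r ≤ K := by
  have hK0 : 0 < K := by linarith
  have hKi : K⁻¹ < 1 := inv_lt_one_of_one_lt₀ hK
  have hKi0 : 0 < K⁻¹ := by positivity
  have hKK : K * K⁻¹ = 1 := mul_inv_cancel₀ hK0.ne'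
  have h1 : (1 - K⁻¹) / (1 + r) * r ≤ 1 - K⁻¹ := by
    rw [div_mul_eq_mul_div, div_le_iff₀ (by linarith)]
    nlinarith
  refine ⟨(1 - K⁻¹) / (1 + r), div_pos (by linarith) (by linarith), ?_, by linarith, ?_⟩
  · rw [div_le_one (by linarith)]; linarith
  · nlinarith

/-- Strict differentiability controls the increments between any two points near `x₀`, not only
those from `x₀` itself. -/
lemma exists_ball_strict_estimate {n x₀ : E} {ρ : E → ℝ} {c η : ℝ} (hc : 0 < c) (hη : 0 < η)
    (hρ : HasStrictFDerivAt ρ (c • innerSL ℝ n) x₀) :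
    ∃ δ > 0, ∀ p ∈ Metric.ball x₀ δ, ∀ q ∈ Metric.ball x₀ δ,
      |ρ p - ρ q - c * inner ℝ n (p - q)| ≤ c * η * ‖p - q‖ := by
  have h := (hasStrictFDerivAt_iff_isLittleO.1 hρ).def (mul_pos hc hη)
  rw [nhds_prod_eq] at h
  obtain ⟨δ, hδ, hb⟩ := (Metric.nhds_basis_ball.prod_self.eventually_iff).1 h
  refine ⟨δ, hδ, fun p hp q hq => ?_⟩
  simpa using hb (show (p, q) ∈ _ from ⟨hp, hq⟩)

/-- Near a boundary point with outward normal `n`, the set lies below a graph over the hyperplane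
orthogonal to `n`, in any direction `v` transversal to it. Since the defining function is strictly
differentiable, the graph is nearly flat: its parametrisation by the hyperplane distorts distances
by at most a factor `K`, as close to `1` as desired. -/
theorem exists_local_graph {n v x₀ : E} (hv : inner ℝ n v = 1)
    {ρ : E → ℝ} {c : ℝ} (hc : 0 < c) (hρ : HasStrictFDerivAt ρ (c • innerSL ℝ n) x₀)
    (h₀ : ρ x₀ = 0) {W O : Set E} (hW : IsOpen W) (hWO : ∀ y ∈ O, y ∈ W ↔ ρ y < 0)
    (hO : O ∈ 𝓝 x₀) {K : ℝ} (hK : 1 < K) :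
    ∃ a b : ℝ, 0 < a ∧ 0 < b ∧ cylinder x₀ n v a b ⊆ O ∧ ∃ γ : (ℝ ∙ n)ᗮ → ℝ,
      ContinuousOn γ (Metric.ball 0 a) ∧ (∀ y ∈ Metric.ball 0 a, γ y ∈ Ioo (-b) b) ∧
      (∀ y ∈ Metric.ball 0 a, ∀ t ∈ Ioo (-b) b,
        (slantMap x₀ n v (y, t) ∈ W ↔ t < γ y) ∧
        (slantMap x₀ n v (y, t) ∈ frontier W ↔ t = γ y)) ∧
      (∀ y ∈ Metric.ball 0 a, ∀ y' ∈ Metric.ball 0 a,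
        dist (slantMap x₀ n v (y, γ y)) (slantMap x₀ n v (y', γ y')) ≤ K * dist y y' ∧
        dist y y' ≤ K * dist (slantMap x₀ n v (y, γ y)) (slantMap x₀ n v (y', γ y'))) := by
  have hK0 : 0 < K := by linarith
  obtain ⟨η, hη, hη1, hK1, hK2⟩ := exists_graph_constants (norm_nonneg v) hK
  have hKi0 : 0 < K⁻¹ := by positivity
  have hKi1 : K⁻¹ < 1 := inv_lt_one_of_one_lt₀ hK
  obtain ⟨δ₁, hδ₁, hest⟩ := exists_ball_strict_estimate hc hη hρ
  obtain ⟨δ₂, hδ₂, hO₂⟩ := Metric.mem_nhds_iff.1 hO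
  set δ := min δ₁ δ₂
  have hδ : 0 < δ := lt_min hδ₁ hδ₂
  have hv0 := norm_nonneg v
  set b := δ / (2 * (1 + ‖v‖)) with hb_def
  have hb : 0 < b := by positivity
  have hbδ : b * (1 + ‖v‖) < δ := by
    rw [hb_def]; field_simp; norm_num
  set a := b / 2 * K⁻¹ with ha_def
  have ha : 0 < a := by positivity
  have hab : a ≤ b := by nlinarith
  set Λ := slantMap x₀ n v with hΛ
  -- the cylinder is contained in the ball where all estimates hold
  have hcyl : ∀ y ∈ Metric.ball (0 : (ℝ ∙ n)ᗮ) a, ∀ t ∈ Ioo (-b) b, Λ (y, t) ∈ Metric.ball x₀ δ := by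
    intro y hy t ht
    rw [mem_ball_zero_iff] at hy
    rw [Metric.mem_ball, dist_eq_norm, hΛ, slantMap, add_assoc, add_sub_cancel_left]
    calc ‖(y : E) + t • v‖ ≤ ‖(y : E)‖ + |t| * ‖v‖ := by
          refine (norm_add_le _ _).trans ?_; rw [norm_smul, Real.norm_eq_abs]
      _ ≤ b + b * ‖v‖ := by
          have : |t| ≤ b := (abs_lt.2 ht).le
          have h' : ‖(y : E)‖ ≤ b := by change ‖y‖ ≤ b; linarith
          gcongr
      _ < δ := by linarith
  have hdiff : ∀ y t y' t', Λ (y, t) - Λ (y', t') = ((y - y' : (ℝ ∙ n)ᗮ) : E) + (t - t') • v := by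
    intro y t y' t'
    simp only [hΛ, slantMap, sub_smul, Submodule.coe_sub]; abel
  -- the defining function increases along the lines parallel to `v`
  have hmono : ∀ y ∈ Metric.ball (0 : (ℝ ∙ n)ᗮ) a, ∀ t ∈ Ioo (-b) b, ∀ t' ∈ Ioo (-b) b, t < t' →
      ρ (Λ (y, t)) < ρ (Λ (y, t')) := by
    intro y hy t ht t' ht' htt
    have h := hest _ (Metric.ball_subset_ball (min_le_left _ _) (hcyl y hy t' ht')) _
      (Metric.ball_subset_ball (min_le_left _ _) (hcyl y hy t ht))
    rw [hΛ, inner_slantMap_sub hv, ← hΛ, hdiff, sub_self, Submodule.coe_zero, zero_add, norm_smul,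
      Real.norm_eq_abs, abs_of_pos (sub_pos.2 htt)] at h
    have h1 := (abs_le.1 h).1
    simp only at h1
    have : 0 < c * (t' - t) * (1 - η * ‖v‖) :=
      mul_pos (mul_pos hc (sub_pos.2 htt)) (by linarith)
    nlinarith
  -- the sign of the defining function at the bottom and at the top of the cylinder
  have hends : ∀ y ∈ Metric.ball (0 : (ℝ ∙ n)ᗮ) a,
      ρ (Λ (y, -(b / 2))) < 0 ∧ 0 < ρ (Λ (y, b / 2)) := by
    intro y hy
    have hy' : ‖y‖ < a := by simpa using hy
    have hx₀ : Λ ((0 : (ℝ ∙ n)ᗮ), (0 : ℝ)) = x₀ := by simp [hΛ, slantMap]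
    have key : ∀ t ∈ Ioo (-b) b, |t| = b / 2 → |ρ (Λ (y, t)) - c * t| < c * (b / 2) := by
      intro t ht habs
      have h := hest _ (Metric.ball_subset_ball (min_le_left _ _) (hcyl y hy t ht)) _
        (Metric.mem_ball_self hδ₁)
      have hi := inner_slantMap_sub hv x₀ (y, t) (0, 0)
      rw [← hΛ, hx₀] at hi
      rw [hi, h₀, ← hx₀, hdiff] at h
      simp only [sub_zero] at h
      refine h.trans_lt ?_
      rw [mul_assoc]
      gcongr
      have : ‖(y : E) + t • v‖ ≤ ‖y‖ + b / 2 * ‖v‖ := by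
        refine (norm_add_le _ _).trans ?_
        rw [norm_smul, Real.norm_eq_abs, habs]; rfl
      have h2 : η * ‖y‖ ≤ ‖y‖ := by nlinarith [norm_nonneg y]
      have h3 : b / 2 * K⁻¹ ≤ b / 2 * (1 - η * ‖v‖) := by gcongr
      calc η * ‖(y : E) + t • v‖ ≤ η * (‖y‖ + b / 2 * ‖v‖) := by gcongr
        _ = η * ‖y‖ + b / 2 * (η * ‖v‖) := by ring
        _ < b / 2 := by nlinarith
    have hm : (-(b / 2)) ∈ Ioo (-b) b := ⟨by linarith, by linarith⟩
    have hp : b / 2 ∈ Ioo (-b) b := ⟨by linarith, by linarith⟩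
    have k1 := abs_lt.1 (key _ hm (by rw [abs_neg, abs_of_pos (by positivity)]))
    have k2 := abs_lt.1 (key _ hp (by rw [abs_of_pos (by positivity)]))
    constructor <;> nlinarith [k1.1, k1.2, k2.1, k2.2]
  have hcont : ContinuousOn ρ (Metric.ball x₀ δ) := by
    intro p hp
    have hp₁ := Metric.ball_subset_ball (min_le_left δ₁ δ₂) hp
    refine ContinuousAt.continuousWithinAt ?_
    rw [ContinuousAt, tendsto_iff_dist_tendsto_zero]
    have hlim : Tendsto (fun q => c * η * ‖q - p‖ + |c * inner ℝ n (q - p)|) (𝓝 p) (𝓝 0) := by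
      have : Continuous fun q => c * η * ‖q - p‖ + |c * inner ℝ n (q - p)| := by fun_prop
      simpa using this.tendsto p
    refine squeeze_zero' (Eventually.of_forall fun _ => dist_nonneg) ?_ hlim
    filter_upwards [Metric.isOpen_ball.mem_nhds hp₁] with q hq
    have := hest q hq p hp₁
    rw [Real.dist_eq]
    calc |ρ q - ρ p| = |(ρ q - ρ p - c * inner ℝ n (q - p)) + c * inner ℝ n (q - p)| := by ring_nf
      _ ≤ _ := (abs_add_le _ _).trans (by gcongr)
  have hzero : ∀ y ∈ Metric.ball (0 : (ℝ ∙ n)ᗮ) a, ∃ t ∈ Ioo (-b) b, ρ (Λ (y, t)) = 0 := by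
    intro y hy
    have hsub : Icc (-(b / 2)) (b / 2) ⊆ Ioo (-b) b := fun t ht =>
      ⟨by linarith [ht.1], by linarith [ht.2]⟩
    have hcy : ContinuousOn (fun t => ρ (Λ (y, t))) (Icc (-(b / 2)) (b / 2)) := by
      refine hcont.comp (Continuous.continuousOn ?_) fun t ht => hcyl y hy t (hsub ht)
      exact (continuous_slantMap x₀ n v).comp (by fun_prop)
    obtain ⟨t, ht, h⟩ := intermediate_value_Icc (by linarith) hcy
      ⟨(hends y hy).1.le, (hends y hy).2.le⟩
    exact ⟨t, hsub ht, h⟩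
  choose! γ hγ hγ0 using hzero
  -- differences of points of the graph are almost orthogonal to `n`
  have hbi : ∀ y ∈ Metric.ball (0 : (ℝ ∙ n)ᗮ) a, ∀ y' ∈ Metric.ball (0 : (ℝ ∙ n)ᗮ) a,
      dist (Λ (y, γ y)) (Λ (y', γ y')) ≤ K * dist y y' ∧
        dist y y' ≤ K * dist (Λ (y, γ y)) (Λ (y', γ y')) := by
    intro y hy y' hy'
    have h := hest _ (Metric.ball_subset_ball (min_le_left _ _) (hcyl y hy _ (hγ y hy))) _
      (Metric.ball_subset_ball (min_le_left _ _) (hcyl y' hy' _ (hγ y' hy')))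
    rw [hγ0 y hy, hγ0 y' hy', sub_self, zero_sub, abs_neg, abs_mul, abs_of_pos hc, mul_assoc,
      mul_le_mul_iff_right₀ hc, hΛ, inner_slantMap_sub hv, ← hΛ] at h
    simp only at h
    rw [dist_eq_norm, dist_eq_norm, Submodule.coe_norm]
    set P := Λ (y, γ y) - Λ (y', γ y') with hP
    have e := hdiff y (γ y) y' (γ y')
    have hs : ‖(γ y - γ y') • v‖ ≤ η * ‖v‖ * ‖P‖ := by
      rw [norm_smul, Real.norm_eq_abs]; nlinarith
    have h1 : ‖P‖ ≤ ‖((y - y' : (ℝ ∙ n)ᗮ) : E)‖ + ‖(γ y - γ y') • v‖ := by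
      rw [hP, e]; exact norm_add_le _ _
    have h2 : ‖((y - y' : (ℝ ∙ n)ᗮ) : E)‖ ≤ ‖P‖ + ‖(γ y - γ y') • v‖ := by
      have : ((y - y' : (ℝ ∙ n)ᗮ) : E) = P - (γ y - γ y') • v := by rw [hP, e]; abel
      rw [this]; exact norm_sub_le _ _
    have hPn := norm_nonneg P
    constructor
    · have : K⁻¹ * ‖P‖ ≤ ‖((y - y' : (ℝ ∙ n)ᗮ) : E)‖ := by nlinarith
      rwa [inv_mul_le_iff₀ hK0] at this
    · nlinarith
  have hγc : ContinuousOn γ (Metric.ball 0 a) := by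
    have hq : ContinuousOn (fun y => Λ (y, γ y)) (Metric.ball 0 a) :=
      LipschitzOnWith.continuousOn (K := ⟨K, hK0.le⟩)
        (LipschitzOnWith.of_dist_le_mul fun y hy y' hy' => (hbi y hy y' hy').1)
    have : ∀ y, γ y = inner ℝ n (Λ (y, γ y) - x₀) := fun y =>
      (slantMap_eq_iff (p := (y, γ y)) hv rfl).1
    rw [funext this]
    exact (by fun_prop : Continuous fun z => inner ℝ n (z - x₀)).comp_continuousOn hq
  have hsign : ∀ y ∈ Metric.ball (0 : (ℝ ∙ n)ᗮ) a, ∀ t ∈ Ioo (-b) b, (Λ (y, t) ∈ W ↔ t < γ y) := by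
    intro y hy t ht
    rw [hWO _ (hO₂ (Metric.ball_subset_ball (min_le_right _ _) (hcyl y hy t ht)))]
    rcases lt_trichotomy t (γ y) with h | h | h
    · simpa [h, hγ0 y hy] using hmono y hy t ht _ (hγ y hy) h
    · simp [h, hγ0 y hy]
    · have := hmono y hy _ (hγ y hy) t ht h
      rw [hγ0 y hy] at this
      simp [not_lt.2 h.le, not_lt.2 this.le]
  refine ⟨a, b, ha, hb, ?_, γ, hγc, hγ, fun y hy t ht => ⟨hsign y hy t ht, ?_⟩, hbi⟩
  · rintro _ ⟨⟨y, t⟩, ⟨hy, ht⟩, rfl⟩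
    exact hO₂ (Metric.ball_subset_ball (min_le_right _ _) (hcyl y hy t ht))
  · have hLc : Continuous Λ := continuous_slantMap x₀ n v
    rw [hW.frontier_eq, Set.mem_sdiff, hsign y hy t ht]
    constructor
    · rintro ⟨hcl, hnot⟩
      by_contra hne
      have hlt : γ y < t := lt_of_le_of_ne (not_lt.1 hnot) (Ne.symm hne)
      have hpos : 0 < ρ (Λ (y, t)) := by
        have := hmono y hy _ (hγ y hy) t ht hlt
        rwa [hγ0 y hy] at this
      have hball := Metric.isOpen_ball.mem_nhds (hcyl y hy t ht)
      have hev : ∀ᶠ z in 𝓝 (Λ (y, t)), z ∉ W := by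
        filter_upwards [(hcont.continuousAt hball).eventually (lt_mem_nhds hpos), hball]
          with z hz hz'
        rw [hWO z (hO₂ (Metric.ball_subset_ball (min_le_right _ _) hz'))]
        exact not_lt.2 hz.le
      exact mem_closure_iff_frequently.1 hcl hev
    · rintro rfl
      refine ⟨?_, lt_irrefl _⟩
      have ht1 : Tendsto (fun s => Λ (y, s)) (𝓝[<] (γ y)) (𝓝 (Λ (y, γ y))) :=
        ((hLc.comp (by fun_prop : Continuous fun s : ℝ => (y, s))).tendsto _).mono_left
          nhdsWithin_le_nhds
      refine mem_closure_of_tendsto ht1 ?_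
      filter_upwards [Ioo_mem_nhdsLT (hγ y hy).1] with s hs
      exact (hsign y hy s ⟨hs.1, hs.2.trans (hγ y hy).2⟩).2 hs.2

end Slant

/-! ### Comparison of measures -/

section MeasureComparison

lemma abs_integral_sub_integral_le_of_nonneg {α : Type*} [MeasurableSpace α] {m₁ m₂ : Measure α}
    {κ : ℝ} (hκ : 1 ≤ κ) (h₁₂ : m₁ ≤ ENNReal.ofReal κ • m₂) (h₂₁ : m₂ ≤ ENNReal.ofReal κ • m₁)
    {f : α → ℝ} (hf : Integrable f m₂) (h0 : 0 ≤ f) :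
    |∫ x, f x ∂m₁ - ∫ x, f x ∂m₂| ≤ (κ - 1) * ∫ x, f x ∂m₂ := by
  have hκ0 : (0 : ℝ) ≤ κ := by linarith
  have hf₂ : Integrable f (ENNReal.ofReal κ • m₂) := hf.smul_measure ENNReal.ofReal_ne_top
  have hf₁ : Integrable f m₁ := hf₂.mono_measure h₁₂
  have hf₁' : Integrable f (ENNReal.ofReal κ • m₁) := hf₁.smul_measure ENNReal.ofReal_ne_top
  have i1 := integral_mono_measure h₁₂ (ae_of_all _ h0) hf₂
  have i2 := integral_mono_measure h₂₁ (ae_of_all _ h0) hf₁'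
  rw [integral_smul_measure, ENNReal.toReal_ofReal hκ0, smul_eq_mul] at i1 i2
  have p1 : 0 ≤ ∫ x, f x ∂m₁ := integral_nonneg h0
  have p2 : 0 ≤ ∫ x, f x ∂m₂ := integral_nonneg h0
  rw [abs_le]
  constructor <;> nlinarith

/-- Two measures that agree up to a factor `κ` have nearly the same integrals. -/
lemma abs_integral_sub_integral_le {α : Type*} [MeasurableSpace α] {m₁ m₂ : Measure α}
    {κ : ℝ} (hκ : 1 ≤ κ) (h₁₂ : m₁ ≤ ENNReal.ofReal κ • m₂) (h₂₁ : m₂ ≤ ENNReal.ofReal κ • m₁)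
    {f : α → ℝ} (hf : Integrable f m₂) :
    |∫ x, f x ∂m₁ - ∫ x, f x ∂m₂| ≤ (κ - 1) * ∫ x, |f x| ∂m₂ := by
  have hf₁ : Integrable f m₁ :=
    (hf.smul_measure (ENNReal.ofReal_ne_top (r := κ))).mono_measure h₁₂
  have e₁ := integral_eq_integral_pos_part_sub_integral_neg_part hf₁
  have e₂ := integral_eq_integral_pos_part_sub_integral_neg_part hf
  have hp := abs_integral_sub_integral_le_of_nonneg hκ h₁₂ h₂₁ hf.pos_part
    (fun x => le_max_right (f x) 0)
  have hm := abs_integral_sub_integral_le_of_nonneg hκ h₁₂ h₂₁ hf.neg_part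
    (fun x => le_max_right (-f x) 0)
  have e₃ : ∫ x, |f x| ∂m₂ = ∫ x, max (f x) 0 ∂m₂ + ∫ x, max (-f x) 0 ∂m₂ := by
    rw [← integral_add hf.pos_part hf.neg_part]
    congr 1 with x
    rcases le_total 0 (f x) with h | h
    · simp [abs_of_nonneg h, h]
    · simp [abs_of_nonpos h, h]
  simp only [Real.coe_toNNReal'] at e₁ e₂
  rw [e₁, e₂, e₃]
  rw [abs_le] at hp hm ⊢
  constructor <;> nlinarith [hp.1, hp.2, hm.1, hm.2]

lemma euclideanHausdorffMeasure_image_le {X Y : Type*} [MetricSpace X] [MeasurableSpace X]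
    [BorelSpace X] [MetricSpace Y] [MeasurableSpace Y] [BorelSpace Y] {K : ℝ} (hK : 0 ≤ K)
    {f : X → Y} {s : Set X} (h : ∀ x ∈ s, ∀ y ∈ s, dist (f x) (f y) ≤ K * dist x y) (k : ℕ) :
    μHE[k] (f '' s) ≤ ENNReal.ofReal (K ^ k) * μHE[k] s := by
  have hL : LipschitzOnWith ⟨K, hK⟩ f s := LipschitzOnWith.of_dist_le_mul fun x hx y hy => h x hx y hy
  have := hL.hausdorffMeasure_image_le (d := k) (by positivity)
  rw [Measure.euclideanHausdorffMeasure_def, Measure.euclideanHausdorffMeasure_def,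
    Measure.smul_apply, Measure.smul_apply, mul_smul_comm]
  refine smul_le_smul_of_nonneg_left (this.trans_eq ?_) zero_le
  rw [ENNReal.rpow_natCast, ENNReal.ofReal_pow hK, ENNReal.ofReal_eq_coe_nnreal hK]
  rfl

lemma exists_one_lt_pow_le (k : ℕ) {ε : ℝ} (hε : 0 < ε) : ∃ K : ℝ, 1 < K ∧ K ^ k ≤ 1 + ε := by
  have h : Tendsto (fun K : ℝ => K ^ k) (𝓝[>] 1) (𝓝 1) := by
    have : Continuous fun K : ℝ => K ^ k := by fun_prop
    simpa using (this.tendsto 1).mono_left nhdsWithin_le_nhds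
  obtain ⟨K, hK, hK'⟩ := ((h.eventually (ge_mem_nhds (by linarith : (1 : ℝ) < 1 + ε))).and
    self_mem_nhdsWithin).exists
  exact ⟨K, hK', hK⟩

end MeasureComparison

/-! ### Local Gauss–Green formula in a transversal direction -/

section LocalFormula

variable {E : Type*} [NormedAddCommGroup E] [InnerProductSpace ℝ E] [FiniteDimensional ℝ E]
  [MeasurableSpace E] [BorelSpace E]

/-- The fundamental theorem of calculus on the lines parallel to `v` turns the integral of a
directional derivative over a region below a graph into an integral over the base of the graph. -/
lemma setIntegral_fderiv_eq_of_graph {n v x₀ : E} (hn : ‖n‖ = 1) (hv : inner ℝ n v = 1)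
    {W : Set E} (hW : MeasurableSet W) {a b : ℝ} {γ : (ℝ ∙ n)ᗮ → ℝ}
    (hWγ : ∀ y ∈ Metric.ball 0 a, ∀ t ∈ Ioo (-b) b, (slantMap x₀ n v (y, t) ∈ W ↔ t < γ y))
    {g : E → ℝ} (hg : ContDiff ℝ 1 g) (hgc : HasCompactSupport g)
    (hgs : tsupport g ⊆ cylinder x₀ n v a b) :
    ∫ x in W, fderiv ℝ g x v = ∫ y in Metric.ball 0 a, g (slantMap x₀ n v (y, γ y)) := by
  set Λ := slantMap x₀ n v with hΛ
  have hΛe := measurableEmbedding_slantMap hv x₀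
  have hΛp := measurePreserving_slantMap hn hv x₀
  have hmem : ∀ y t, Λ (y, t) ∈ cylinder x₀ n v a b ↔ y ∈ Metric.ball 0 a ∧ t ∈ Ioo (-b) b := by
    intro y t
    rw [cylinder, hΛ, hΛe.injective.mem_set_image, mem_prod]
  have hgc' : Continuous fun x => fderiv ℝ g x v := by
    have := hg.continuous_fderiv one_ne_zero
    fun_prop
  have hsupp : ∀ x, x ∉ cylinder x₀ n v a b → fderiv ℝ g x v = 0 := by
    intro x hx
    have : x ∉ tsupport (fderiv ℝ g) := fun h => hx (hgs (tsupport_fderiv_subset ℝ h))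
    rw [image_eq_zero_of_notMem_tsupport this]; simp
  have hgint : Integrable fun x => fderiv ℝ g x v :=
    hgc'.integrable_of_hasCompactSupport
      ((hgc.fderiv ℝ).comp_left (g := fun L : E →L[ℝ] ℝ => L v) (by simp))
  have hind : Integrable (W.indicator fun x => fderiv ℝ g x v) := hgint.indicator hW
  rw [← integral_indicator hW, ← hΛp.integral_comp hΛe, Measure.volume_eq_prod,
    integral_prod _ (by simpa [Measure.volume_eq_prod, Function.comp_def] using
      (hΛp.integrable_comp_emb hΛe).2 hind),
    ← integral_indicator Metric.isOpen_ball.measurableSet]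
  congr 1 with y
  by_cases hy : y ∈ Metric.ball 0 a
  · rw [indicator_of_mem hy]
    have hline : ∀ t, HasDerivAt (fun t => Λ (y, t)) v t := by
      intro t
      simpa [hΛ, slantMap] using ((hasDerivAt_id t).smul_const v).const_add (x₀ + (y : E))
    have hφ : ContDiff ℝ 1 fun t => g (Λ (y, t)) := by
      refine hg.comp ?_
      simp only [hΛ, slantMap]
      fun_prop
    have hd : ∀ t, deriv (fun t => g (Λ (y, t))) t = fderiv ℝ g (Λ (y, t)) v := by
      intro t
      exact ((hg.differentiable one_ne_zero _).hasFDerivAt.comp_hasDerivAt t (hline t)).deriv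
    have hφc : HasCompactSupport fun t => g (Λ (y, t)) := by
      refine HasCompactSupport.of_support_subset_isCompact (isCompact_Icc (a := -b) (b := b)) ?_
      intro t ht
      have := (hmem y t).1 (hgs (subset_tsupport g ht))
      exact Ioo_subset_Icc_self this.2
    rw [← hφc.integral_Iic_deriv_eq hφ (γ y), ← integral_indicator measurableSet_Iic]
    refine integral_congr_ae ?_
    filter_upwards [compl_mem_ae_iff.2 (measure_singleton (γ y))] with t ht
    by_cases htb : t ∈ Ioo (-b) b
    · by_cases hlt : t < γ y
      · rw [indicator_of_mem ((hWγ y hy t htb).2 hlt), indicator_of_mem (mem_Iic.2 hlt.le), hd]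
      · rw [indicator_of_notMem (fun h => hlt ((hWγ y hy t htb).1 h)), indicator_of_notMem]
        intro h
        exact hlt (lt_of_le_of_ne h ht)
    · have : fderiv ℝ g (Λ (y, t)) v = 0 := hsupp _ fun h => htb ((hmem y t).1 h).2
      simp [indicator, hd, this, ← hΛ]
  · rw [indicator_of_notMem hy]
    have : ∀ t, W.indicator (fun x => fderiv ℝ g x v) (Λ (y, t)) = 0 := by
      intro t
      simp [indicator, hsupp _ fun h => hy ((hmem y t).1 h).1]
    simp only [hΛ] at this
    simp [this]

/-- Surface measure on a nearly flat graph is close to the measure of the projection to the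
hyperplane. -/
lemma graph_measure_comparison {n v x₀ : E} {S : Set E} {a b K : ℝ}
    (hK : 0 < K) {γ : (ℝ ∙ n)ᗮ → ℝ} (hγ : ∀ y ∈ Metric.ball 0 a, γ y ∈ Ioo (-b) b)
    (hS : ∀ y ∈ Metric.ball 0 a, ∀ t ∈ Ioo (-b) b, (slantMap x₀ n v (y, t) ∈ S ↔ t = γ y))
    (hlip : ∀ y ∈ Metric.ball 0 a, ∀ y' ∈ Metric.ball 0 a,
        dist (slantMap x₀ n v (y, γ y)) (slantMap x₀ n v (y', γ y')) ≤ K * dist y y' ∧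
        dist y y' ≤ K * dist (slantMap x₀ n v (y, γ y)) (slantMap x₀ n v (y', γ y')))
    (hq : AEMeasurable (fun y => slantMap x₀ n v (y, γ y))
      (volume.restrict (Metric.ball (0 : (ℝ ∙ n)ᗮ) a))) (k : ℕ)
    (hk : Module.finrank ℝ (ℝ ∙ n)ᗮ = k) :
    ((volume.restrict (Metric.ball 0 a)).map fun y => slantMap x₀ n v (y, γ y)) ≤
        ENNReal.ofReal (K ^ k) • (μHE[k] : Measure E).restrict (S ∩ cylinder x₀ n v a b) ∧
      (μHE[k] : Measure E).restrict (S ∩ cylinder x₀ n v a b) ≤ ENNReal.ofReal (K ^ k) •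
        ((volume.restrict (Metric.ball 0 a)).map fun y => slantMap x₀ n v (y, γ y)) := by
  set q : (ℝ ∙ n)ᗮ → E := fun y => slantMap x₀ n v (y, γ y) with hq_def
  have hvol : (volume : Measure (ℝ ∙ n)ᗮ) = μHE[k] := by
    rw [← hk, InnerProductSpace.euclideanHausdorffMeasure_eq_volume]
  have hset : ∀ B : Set E, B ∩ (S ∩ cylinder x₀ n v a b) = q '' (q ⁻¹' B ∩ Metric.ball 0 a) := by
    intro B
    ext z
    constructor
    · rintro ⟨hzB, hzS, ⟨⟨y, t⟩, ⟨hy, ht⟩, rfl⟩⟩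
      obtain rfl := (hS y hy t ht).1 hzS
      exact ⟨y, ⟨hzB, hy⟩, rfl⟩
    · rintro ⟨y, ⟨hyB, hy⟩, rfl⟩
      exact ⟨hyB, (hS y hy _ (hγ y hy)).2 rfl, ⟨(y, γ y), ⟨hy, hγ y hy⟩, rfl⟩⟩
  have hinj : InjOn q (Metric.ball 0 a) := by
    intro y hy y' hy' h
    have := (hlip y hy y' hy').2
    simp only [hq_def] at h
    rw [h, dist_self, mul_zero] at this
    exact dist_le_zero.1 this
  constructor
  · refine Measure.le_iff.2 fun B hB => ?_
    rw [Measure.map_apply_of_aemeasurable hq hB, Measure.restrict_apply' measurableSet_ball,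
      Measure.smul_apply, Measure.restrict_apply hB, hset, hvol, smul_eq_mul]
    set A := q ⁻¹' B ∩ Metric.ball 0 a
    have hA : A ⊆ Metric.ball 0 a := inter_subset_right
    have hinv : Function.invFunOn q (Metric.ball 0 a) '' (q '' A) = A :=
      (hinj.invFunOn_image hA)
    have hleft := hinj.leftInvOn_invFunOn
    conv_lhs => rw [← hinv]
    refine euclideanHausdorffMeasure_image_le hK.le ?_ k
    rintro _ ⟨y, hy, rfl⟩ _ ⟨y', hy', rfl⟩
    rw [hleft (hA hy), hleft (hA hy')]
    exact (hlip y (hA hy) y' (hA hy')).2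
  · refine Measure.le_iff.2 fun B hB => ?_
    rw [Measure.smul_apply, Measure.map_apply_of_aemeasurable hq hB,
      Measure.restrict_apply' measurableSet_ball, Measure.restrict_apply hB, hset, hvol,
      smul_eq_mul]
    exact euclideanHausdorffMeasure_image_le hK.le
      (fun y hy y' hy' => (hlip y hy.2 y' hy'.2).1) k

/-- Local Gauss–Green formula with a small relative error, for a direction `v` transversal to the
boundary, normalised by `⟪n, v⟫ = 1`. -/
theorem exists_nhds_abs_setIntegral_fderiv_sub_le {n v x₀ : E} (hn : ‖n‖ = 1)
    (hv : inner ℝ n v = 1) {ρ : E → ℝ} {c : ℝ} (hc : 0 < c)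
    (hρ : HasStrictFDerivAt ρ (c • innerSL ℝ n) x₀)
    (h₀ : ρ x₀ = 0) {W O : Set E} (hW : IsOpen W) (hWO : ∀ y ∈ O, y ∈ W ↔ ρ y < 0)
    (hO : O ∈ 𝓝 x₀) {ε : ℝ} (hε : 0 < ε) (k : ℕ) (hk : Module.finrank ℝ (ℝ ∙ n)ᗮ = k) :
    ∃ V : Set E, IsOpen V ∧ x₀ ∈ V ∧ (μHE[k] : Measure E) (frontier W ∩ V) < ⊤ ∧
      ∀ g : E → ℝ, ContDiff ℝ 1 g → HasCompactSupport g → tsupport g ⊆ V →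
        |(∫ x in W, fderiv ℝ g x v) - ∫ x in frontier W, g x ∂μHE[k]|
          ≤ ε * ∫ x in frontier W, |g x| ∂μHE[k] := by
  obtain ⟨K, hK, hKε⟩ := exists_one_lt_pow_le k hε
  have hK0 : 0 < K := by linarith
  obtain ⟨a, b, ha, hb, -, γ, hγc, hγ, hWγ, hlip⟩ :=
    exists_local_graph hv hc hρ h₀ hW hWO hO hK
  have hq : ContinuousOn (fun y => slantMap x₀ n v (y, γ y)) (Metric.ball 0 a) :=
    (continuous_slantMap x₀ n v).comp_continuousOn (by fun_prop)
  have hqm := hq.aemeasurable (μ := volume) measurableSet_ball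
  obtain ⟨h₁₂, h₂₁⟩ := graph_measure_comparison (S := frontier W) hK0 hγ
    (fun y hy t ht => (hWγ y hy t ht).2) hlip hqm k hk
  have hfin : (μHE[k] : Measure E) (frontier W ∩ cylinder x₀ n v a b) < ⊤ := by
    have := h₂₁ univ
    rw [Measure.restrict_apply_univ, Measure.smul_apply,
      Measure.map_apply_of_aemeasurable hqm MeasurableSet.univ, preimage_univ,
      Measure.restrict_apply_univ, smul_eq_mul] at this
    exact this.trans_lt (ENNReal.mul_lt_top ENNReal.ofReal_lt_top measure_ball_lt_top)
  refine ⟨cylinder x₀ n v a b, isOpen_cylinder hv x₀ a b, ?_, hfin, fun g hg hgc hgs => ?_⟩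
  · exact ⟨(0, 0), ⟨Metric.mem_ball_self ha, by constructor <;> linarith⟩, by simp [slantMap]⟩
  have hzero : ∀ x ∈ frontier W \ (frontier W ∩ cylinder x₀ n v a b), g x = 0 := by
    rintro x ⟨hx, hx'⟩
    exact image_eq_zero_of_notMem_tsupport fun h => hx' ⟨hx, hgs h⟩
  have hfm : MeasurableSet (frontier W) := isClosed_frontier.measurableSet
  have e₁ : ∫ x in frontier W, g x ∂μHE[k]
      = ∫ x in frontier W ∩ cylinder x₀ n v a b, g x ∂μHE[k] :=
    setIntegral_eq_of_subset_of_forall_sdiff_eq_zero hfm inter_subset_left hzero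
  have e₂ : ∫ x in frontier W, |g x| ∂μHE[k]
      = ∫ x in frontier W ∩ cylinder x₀ n v a b, |g x| ∂μHE[k] :=
    setIntegral_eq_of_subset_of_forall_sdiff_eq_zero hfm inter_subset_left
      fun x hx => by rw [hzero x hx, abs_zero]
  have hgi : Integrable g ((μHE[k] : Measure E).restrict (frontier W ∩ cylinder x₀ n v a b)) := by
    have : IsFiniteMeasure ((μHE[k] : Measure E).restrict (frontier W ∩ cylinder x₀ n v a b)) :=
      ⟨by rwa [Measure.restrict_apply_univ]⟩
    obtain ⟨C, hC⟩ := hgc.exists_bound_of_continuous hg.continuous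
    exact Integrable.of_bound hg.continuous.aestronglyMeasurable C (ae_of_all _ hC)
  have e₃ := setIntegral_fderiv_eq_of_graph hn hv hW.measurableSet
    (fun y hy t ht => (hWγ y hy t ht).1) hg hgc hgs
  rw [e₃,
    ← integral_map hqm hg.continuous.aestronglyMeasurable, e₁, e₂]
  refine (abs_integral_sub_integral_le (one_le_pow₀ hK.le) h₁₂ h₂₁ hgi).trans ?_
  gcongr
  linarith

end LocalFormula

/-! ### The divergence -/

section Divergence

variable {d : ℕ}

/-- The divergence of a vector field. -/
noncomputable def divergence (F : EuclideanSpace ℝ (Fin d) → EuclideanSpace ℝ (Fin d))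
    (x : EuclideanSpace ℝ (Fin d)) : ℝ :=
  ∑ i, (fderiv ℝ F x (EuclideanSpace.single i 1)) i

lemma divergence_congr {F G : EuclideanSpace ℝ (Fin d) → EuclideanSpace ℝ (Fin d)}
    {x : EuclideanSpace ℝ (Fin d)} (h : F =ᶠ[𝓝 x] G) : divergence F x = divergence G x := by
  simp only [divergence, h.fderiv_eq]

lemma divergence_eq_zero {F : EuclideanSpace ℝ (Fin d) → EuclideanSpace ℝ (Fin d)}
    {x : EuclideanSpace ℝ (Fin d)} (h : F =ᶠ[𝓝 x] 0) : divergence F x = 0 := by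
  rw [divergence_congr h]; simp [divergence]

lemma divergence_eq_sum_fderiv_apply {F : EuclideanSpace ℝ (Fin d) → EuclideanSpace ℝ (Fin d)}
    {x : EuclideanSpace ℝ (Fin d)} (h : DifferentiableAt ℝ F x) :
    divergence F x = ∑ i, fderiv ℝ (fun y => F y i) x (EuclideanSpace.single i 1) := by
  refine Finset.sum_congr rfl fun i _ => ?_
  have := ((EuclideanSpace.proj (𝕜 := ℝ) i).hasFDerivAt (x := F x)).comp x h.hasFDerivAt
  have h' : HasFDerivAt (fun y => F y i) ((EuclideanSpace.proj (𝕜 := ℝ) i).comp (fderiv ℝ F x)) x :=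
    this
  rw [h'.fderiv]
  simp

lemma divergence_smul {χ : EuclideanSpace ℝ (Fin d) → ℝ}
    {F : EuclideanSpace ℝ (Fin d) → EuclideanSpace ℝ (Fin d)} {x : EuclideanSpace ℝ (Fin d)}
    (hχ : DifferentiableAt ℝ χ x) (hF : DifferentiableAt ℝ F x) :
    divergence (fun y => χ y • F y) x = χ x * divergence F x + fderiv ℝ χ x (F x) := by
  have hx : F x = ∑ i, F x i • EuclideanSpace.single i (1 : ℝ) := by
    ext j; simp [Finset.sum_apply, Pi.single_apply]
  have : fderiv ℝ χ x (F x) = ∑ i, F x i * fderiv ℝ χ x (EuclideanSpace.single i 1) := by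
    conv_lhs => rw [hx, map_sum]
    simp
  rw [this, divergence, divergence, fderiv_fun_smul hχ hF, Finset.mul_sum,
    ← Finset.sum_add_distrib]
  refine Finset.sum_congr rfl fun i _ => ?_
  simp [mul_comm]

lemma divergence_add {F G : EuclideanSpace ℝ (Fin d) → EuclideanSpace ℝ (Fin d)}
    {x : EuclideanSpace ℝ (Fin d)} (hF : DifferentiableAt ℝ F x) (hG : DifferentiableAt ℝ G x) :
    divergence (fun y => F y + G y) x = divergence F x + divergence G x := by
  simp [divergence, fderiv_fun_add hF hG, Finset.sum_add_distrib]

lemma divergence_comp_sub (F : EuclideanSpace ℝ (Fin d) → EuclideanSpace ℝ (Fin d))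
    (a x : EuclideanSpace ℝ (Fin d)) :
    divergence (fun y => F (y - a)) x = divergence F (x - a) := by
  simp [divergence, fderiv_comp_sub]

end Divergence

/-! ### Smooth cutoff functions -/

section Cutoff

variable {E : Type*} [NormedAddCommGroup E] [InnerProductSpace ℝ E] [FiniteDimensional ℝ E]

lemma exists_cutoff {K U : Set E} (hK : IsCompact K) (hU : IsOpen U) (hKU : K ⊆ U) :
    ∃ χ : E → ℝ, ContDiff ℝ ∞ χ ∧ HasCompactSupport χ ∧ tsupport χ ⊆ U ∧
      (∀ᶠ x in 𝓝ˢ K, χ x = 1) ∧ ∀ x, χ x ∈ Icc (0 : ℝ) 1 := by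
  obtain ⟨δ, hδ, hsub⟩ := hK.exists_cthickening_subset_open hU hKU
  obtain ⟨f, h1, h0, hI⟩ := exists_contMDiffMap_one_nhds_of_subset_interior
    (n := ⊤) (modelWithCornersSelf ℝ E) (s := K) (t := Metric.cthickening δ K) hK.isClosed
    ((Metric.self_subset_thickening hδ K).trans
      (interior_maximal (Metric.thickening_subset_cthickening δ K) Metric.isOpen_thickening))
  have hs : tsupport f ⊆ Metric.cthickening δ K := by
    refine closure_minimal (fun x hx => ?_) Metric.isClosed_cthickening
    by_contra h
    exact hx (h0 x h)
  exact ⟨f, f.contMDiff.contDiff, hK.cthickening.of_isClosed_subset (isClosed_tsupport _) hs,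
    hs.trans hsub, h1, hI⟩

end Cutoff

/-! ### Local Gauss–Green formula in an arbitrary direction -/

section LocalVector

variable {E : Type*} [NormedAddCommGroup E] [InnerProductSpace ℝ E] [FiniteDimensional ℝ E]
  [MeasurableSpace E] [BorelSpace E]

/-- Local Gauss–Green formula with a small relative error, for an arbitrary direction `w`, which is
a combination of two directions transversal to the boundary. -/
theorem exists_nhds_abs_setIntegral_fderiv_sub_inner_mul_le {n x₀ : E} (hn : ‖n‖ = 1) (w : E)
    {ρ : E → ℝ} {c : ℝ} (hc : 0 < c) (hρ : HasStrictFDerivAt ρ (c • innerSL ℝ n) x₀)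
    (h₀ : ρ x₀ = 0) {W O : Set E} (hW : IsOpen W) (hWO : ∀ y ∈ O, y ∈ W ↔ ρ y < 0)
    (hO : O ∈ 𝓝 x₀) {ε : ℝ} (hε : 0 < ε) (k : ℕ) (hk : Module.finrank ℝ (ℝ ∙ n)ᗮ = k) :
    ∃ V : Set E, IsOpen V ∧ x₀ ∈ V ∧ (μHE[k] : Measure E) (frontier W ∩ V) < ⊤ ∧
      ∀ g : E → ℝ, ContDiff ℝ 1 g → HasCompactSupport g → tsupport g ⊆ V →
        |(∫ x in W, fderiv ℝ g x w) - inner ℝ n w * ∫ x in frontier W, g x ∂μHE[k]|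
          ≤ ε * ∫ x in frontier W, |g x| ∂μHE[k] := by
  have hnn : inner ℝ n n = 1 := by rw [real_inner_self_eq_norm_sq, hn]; norm_num
  -- `w` is the transversal direction `w + c' • n` minus `c' • n`
  set c' := 1 - inner ℝ n w with hc'
  have hvv : inner ℝ n (w + c' • n) = 1 := by
    rw [inner_add_right, inner_smul_right, hnn]; ring
  have hε' : 0 < ε / (1 + |c'|) := by positivity
  obtain ⟨V₁, hV₁, hx₁, hf₁, h₁⟩ :=
    exists_nhds_abs_setIntegral_fderiv_sub_le hn hvv hc hρ h₀ hW hWO hO hε' k hk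
  obtain ⟨V₂, hV₂, hx₂, -, h₂⟩ :=
    exists_nhds_abs_setIntegral_fderiv_sub_le hn hnn hc hρ h₀ hW hWO hO hε' k hk
  refine ⟨V₁ ∩ V₂, hV₁.inter hV₂, ⟨hx₁, hx₂⟩,
    (measure_mono (inter_subset_inter_right _ inter_subset_left)).trans_lt hf₁,
    fun g hg hgc hgs => ?_⟩
  have e₁ := h₁ g hg hgc (hgs.trans inter_subset_left)
  have e₂ := h₂ g hg hgc (hgs.trans inter_subset_right)
  have hint : ∀ v : E, IntegrableOn (fun x => fderiv ℝ g x v) W := by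
    intro v
    have hcont : Continuous fun x => fderiv ℝ g x v := by
      have := hg.continuous_fderiv one_ne_zero
      fun_prop
    exact (hcont.integrable_of_hasCompactSupport
      ((hgc.fderiv ℝ).comp_left (g := fun L : E →L[ℝ] ℝ => L v) (by simp))).integrableOn
  have hlin : ∫ x in W, fderiv ℝ g x w
      = (∫ x in W, fderiv ℝ g x (w + c' • n)) - c' * ∫ x in W, fderiv ℝ g x n := by
    rw [← integral_const_mul, ← integral_sub (hint _) ((hint _).const_mul _)]
    simp
  set I := ∫ x in frontier W, g x ∂μHE[k]
  set J := ∫ x in frontier W, |g x| ∂μHE[k]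
  set A := ∫ x in W, fderiv ℝ g x (w + c' • n)
  set B := ∫ x in W, fderiv ℝ g x n
  have e₃ : |c' * (B - I)| ≤ |c'| * (ε / (1 + |c'|) * J) := by rw [abs_mul]; gcongr
  calc |(∫ x in W, fderiv ℝ g x w) - inner ℝ n w * I|
      = |(A - I) - c' * (B - I)| := by rw [hlin, hc']; ring_nf
    _ ≤ ε / (1 + |c'|) * J + |c'| * (ε / (1 + |c'|) * J) := (abs_sub _ _).trans (by gcongr)
    _ = ε * J := by field_simp

/-- Translation in the direction opposite to the outward normal moves boundary points into the
set. -/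
lemma exists_nhds_sub_smul_mem {n x₀ : E} (hn : ‖n‖ = 1) {ρ : E → ℝ} {c : ℝ} (hc : 0 < c)
    (hρ : HasStrictFDerivAt ρ (c • innerSL ℝ n) x₀) (h₀ : ρ x₀ = 0) {W O : Set E} (hW : IsOpen W)
    (hWO : ∀ y ∈ O, y ∈ W ↔ ρ y < 0) (hO : O ∈ 𝓝 x₀) :
    ∃ V : Set E, IsOpen V ∧ x₀ ∈ V ∧
      ∀ x ∈ closure W, x ∈ V → ∀ h > (0 : ℝ), x - h • n ∈ V → x - h • n ∈ W := by
  have hnn : inner ℝ n n = 1 := by rw [real_inner_self_eq_norm_sq, hn]; norm_num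
  obtain ⟨a, b, ha, hb, -, γ, -, hγ, hWγ, -⟩ :=
    exists_local_graph hnn hc hρ h₀ hW hWO hO one_lt_two
  refine ⟨cylinder x₀ n n a b, isOpen_cylinder hnn x₀ a b,
    ⟨(0, 0), ⟨Metric.mem_ball_self ha, by constructor <;> linarith⟩, by simp [slantMap]⟩, ?_⟩
  rintro x hx ⟨⟨y, t⟩, ⟨hy, ht⟩, rfl⟩ h hh hxh
  have hle : t ≤ γ y := by
    rw [closure_eq_self_union_frontier] at hx
    rcases hx with hx | hx
    · exact ((hWγ y hy t ht).1.1 hx).le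
    · exact ((hWγ y hy t ht).2.1 hx).le
  have he : slantMap x₀ n n (y, t) - h • n = slantMap x₀ n n (y, t - h) := by
    simp only [slantMap, sub_smul]; abel
  rw [he] at hxh ⊢
  rw [cylinder, (measurableEmbedding_slantMap hnn x₀).injective.mem_set_image] at hxh
  exact (hWγ y hy _ hxh.2).1.2 (by linarith)

end LocalVector

/-! ### Local Gauss–Green formula for vector fields -/

section LocalFlux

variable {d : ℕ}

/-- Vector fields to which the Gauss–Green formula on `W` applies: continuous up to the boundary,
continuously differentiable inside, with integrable divergence. The individual partial derivatives
need not be integrable. -/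
structure IsAdmissible (W : Set (EuclideanSpace ℝ (Fin d)))
    (F : EuclideanSpace ℝ (Fin d) → EuclideanSpace ℝ (Fin d)) : Prop where
  continuousOn : ContinuousOn F (closure W)
  contDiffOn : ContDiffOn ℝ 1 F W
  integrableOn : IntegrableOn (divergence F) W

lemma abs_apply_le_norm (x : EuclideanSpace ℝ (Fin d)) (i : Fin d) : |x i| ≤ ‖x‖ := by
  simpa using PiLp.norm_apply_le x i

/-- Local Gauss–Green formula with a small relative error, for compactly supported fields that are
smooth across the boundary. -/
theorem exists_nhds_abs_divergence_sub_le {n x₀ : EuclideanSpace ℝ (Fin d)} (hn : ‖n‖ = 1)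
    {ρ : EuclideanSpace ℝ (Fin d) → ℝ} {c : ℝ} (hc : 0 < c)
    (hρ : HasStrictFDerivAt ρ (c • innerSL ℝ n) x₀)
    (h₀ : ρ x₀ = 0) {W O : Set (EuclideanSpace ℝ (Fin d))} (hW : IsOpen W)
    (hWO : ∀ y ∈ O, y ∈ W ↔ ρ y < 0) (hO : O ∈ 𝓝 x₀) {ε : ℝ} (hε : 0 < ε) :
    ∃ V : Set (EuclideanSpace ℝ (Fin d)), IsOpen V ∧ x₀ ∈ V ∧
      (μHE[d - 1] : Measure (EuclideanSpace ℝ (Fin d))) (frontier W ∩ V) < ⊤ ∧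
      ∀ G : EuclideanSpace ℝ (Fin d) → EuclideanSpace ℝ (Fin d), ContDiff ℝ 1 G →
        HasCompactSupport G → tsupport G ⊆ V →
        |(∫ x in W, divergence G x) - ∫ x in frontier W, inner ℝ (G x) n ∂μHE[d - 1]|
          ≤ ε * ∫ x in frontier W, ‖G x‖ ∂μHE[d - 1] := by
  have hn0 : n ≠ 0 := by rintro rfl; simp at hn
  have hk : Module.finrank ℝ (ℝ ∙ n)ᗮ = d - 1 := by
    have := (ℝ ∙ n).finrank_add_finrank_orthogonal
    rw [finrank_span_singleton hn0, finrank_euclideanSpace_fin] at this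
    omega
  have hd : 0 < d := by
    rcases Nat.eq_zero_or_pos d with rfl | h
    · exact absurd (Subsingleton.elim n 0) hn0
    · exact h
  have hε' : 0 < ε / d := by positivity
  choose V hV hxV hfin hloc using fun i : Fin d =>
    exists_nhds_abs_setIntegral_fderiv_sub_inner_mul_le hn (EuclideanSpace.single i (1 : ℝ)) hc hρ
      h₀ hW hWO hO hε' (d - 1) hk
  refine ⟨⋂ i, V i, isOpen_iInter_of_finite hV, mem_iInter.2 hxV,
    (measure_mono (inter_subset_inter_right _ (iInter_subset V ⟨0, hd⟩))).trans_lt (hfin _),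
    fun G hG hGc hGs => ?_⟩
  set ν := (μHE[d - 1] : Measure (EuclideanSpace ℝ (Fin d))).restrict (frontier W) with hν
  have hGi : ∀ i, ContDiff ℝ 1 fun y => G y i := fun i => by fun_prop
  have hGic : ∀ i, HasCompactSupport fun y => G y i := fun i =>
    hGc.comp_left (g := fun z : EuclideanSpace ℝ (Fin d) => z i) (by simp)
  have hGis : ∀ i, tsupport (fun y => G y i) ⊆ V i := fun i =>
    (closure_mono fun x hx => by
      simp only [Function.mem_support] at hx ⊢
      exact fun h => hx (by simp [h])).trans (hGs.trans (iInter_subset V i))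
  -- the surface measure is finite on the support of the field
  have hint : ∀ {X : Type} [NormedAddCommGroup X] (g : EuclideanSpace ℝ (Fin d) → X),
      Continuous g → (∀ x, G x = 0 → g x = 0) → Integrable g ν := by
    intro X _ g hg hg0
    have hgs : Function.support g ⊆ Function.support G := fun x hx h => hx (hg0 x h)
    have hgc : HasCompactSupport g := hGc.mono' (hgs.trans (subset_tsupport _))
    obtain ⟨C, hC⟩ := hgc.exists_bound_of_continuous hg
    have hsub : frontier W ∩ tsupport G ⊆ frontier W ∩ V ⟨0, hd⟩ :=
      inter_subset_inter_right _ (hGs.trans (iInter_subset V _))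
    have h1 : IntegrableOn g (tsupport G) ν := by
      refine Measure.integrableOn_of_bounded (M := C) ?_ hg.aestronglyMeasurable (ae_of_all _ hC)
      rw [hν, Measure.restrict_apply (isClosed_tsupport G).measurableSet, inter_comm]
      exact ((measure_mono hsub).trans_lt (hfin _)).ne
    rw [← integrableOn_univ]
    exact h1.of_forall_sdiff_eq_zero MeasurableSet.univ fun x hx =>
      hg0 x (image_eq_zero_of_notMem_tsupport hx.2)
  have hfd : ∀ i, IntegrableOn
      (fun x => fderiv ℝ (fun y => G y i) x (EuclideanSpace.single i 1)) W := by
    intro i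
    have hcont : Continuous fun x => fderiv ℝ (fun y => G y i) x (EuclideanSpace.single i 1) := by
      have := (hGi i).continuous_fderiv one_ne_zero
      fun_prop
    exact (hcont.integrable_of_hasCompactSupport (((hGic i).fderiv ℝ).comp_left
      (g := fun L : EuclideanSpace ℝ (Fin d) →L[ℝ] ℝ => L (EuclideanSpace.single i 1))
        (by simp))).integrableOn
  have e₁ : ∫ x in W, divergence G x
      = ∑ i, ∫ x in W, fderiv ℝ (fun y => G y i) x (EuclideanSpace.single i 1) := by
    rw [← integral_finsetSum _ fun i _ => hfd i]
    congr 1 with x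
    exact divergence_eq_sum_fderiv_apply (hG.differentiable one_ne_zero x)
  have e₂ : ∫ x, inner ℝ (G x) n ∂ν = ∑ i, n i * ∫ x, G x i ∂ν := by
    simp_rw [← integral_const_mul]
    rw [← integral_finsetSum _ fun i _ => (hint (fun x => n i * G x i)
      (by have := hG.continuous; fun_prop) (by simp +contextual))]
    simp [PiLp.inner_apply]
  rw [e₁, e₂, ← Finset.sum_sub_distrib]
  refine (Finset.abs_sum_le_sum_abs _ _).trans ?_
  have hterm : ∀ i ∈ Finset.univ,
      |(∫ x in W, fderiv ℝ (fun y => G y i) x (EuclideanSpace.single i 1)) - n i * ∫ x, G x i ∂ν|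
        ≤ ε / d * ∫ x, ‖G x‖ ∂ν := by
    intro i _
    have h := hloc i _ (hGi i) (hGic i) (hGis i)
    have hi : inner ℝ n (EuclideanSpace.single i (1 : ℝ)) = n i := by
      simp [EuclideanSpace.inner_single_right]
    rw [hi] at h
    refine h.trans ?_
    have hGcont := hG.continuous
    exact mul_le_mul_of_nonneg_left (integral_mono (hint _ (by fun_prop) (by simp +contextual))
      (hint _ (by fun_prop) (by simp +contextual)) fun x => abs_apply_le_norm (G x) i) hε'.le
  refine (Finset.sum_le_sum hterm).trans_eq ?_
  have : (d : ℝ) ≠ 0 := by positivity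
  simp only [Finset.sum_const, Finset.card_univ, Fintype.card_fin, nsmul_eq_mul]
  field_simp

/-- Translating a field inwards makes it smooth across the boundary, so that the local
Gauss–Green formula extends to fields that are only continuous up to the boundary. -/
theorem exists_nhds_abs_divergence_sub_le_of_isAdmissible {n x₀ : EuclideanSpace ℝ (Fin d)}
    (hn : ‖n‖ = 1) {ρ : EuclideanSpace ℝ (Fin d) → ℝ} {c : ℝ} (hc : 0 < c)
    (hρ : HasStrictFDerivAt ρ (c • innerSL ℝ n) x₀)
    (h₀ : ρ x₀ = 0) {W O : Set (EuclideanSpace ℝ (Fin d))} (hW : IsOpen W)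
    (hWO : ∀ y ∈ O, y ∈ W ↔ ρ y < 0) (hO : O ∈ 𝓝 x₀)
    (hfin : (μHE[d - 1] : Measure (EuclideanSpace ℝ (Fin d))) (frontier W) < ⊤)
    {ε : ℝ} (hε : 0 < ε) :
    ∃ V : Set (EuclideanSpace ℝ (Fin d)), IsOpen V ∧ x₀ ∈ V ∧
      ∀ (F : EuclideanSpace ℝ (Fin d) → EuclideanSpace ℝ (Fin d))
        (C : Set (EuclideanSpace ℝ (Fin d))), IsAdmissible W F → IsCompact C → C ⊆ V →
        (∀ x ∈ closure W, x ∉ C → F x = 0) →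
        |(∫ x in W, divergence F x) - ∫ x in frontier W, inner ℝ (F x) n ∂μHE[d - 1]|
          ≤ ε * ∫ x in frontier W, ‖F x‖ ∂μHE[d - 1] := by
  obtain ⟨V₁, hV₁, hx₁, -, hloc⟩ := exists_nhds_abs_divergence_sub_le hn hc hρ h₀ hW hWO hO hε
  obtain ⟨V₂, hV₂, hx₂, hshift⟩ := exists_nhds_sub_smul_mem hn hc hρ h₀ hW hWO hO
  refine ⟨V₁ ∩ V₂, hV₁.inter hV₂, ⟨hx₁, hx₂⟩, fun F C hF hC hCV hF0 => ?_⟩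
  obtain ⟨h₁, hh₁, hthick⟩ := hC.exists_cthickening_subset_open (hV₁.inter hV₂) hCV
  have hthick' : ∀ h ∈ Ioo 0 h₁, ∀ x, x - h • n ∈ C → x ∈ V₁ ∩ V₂ := by
    intro h hh x hx
    refine hthick (Metric.mem_cthickening_of_dist_le x _ _ _ hx ?_)
    rw [dist_eq_norm, sub_sub_cancel, norm_smul, hn, mul_one, Real.norm_eq_abs, abs_of_pos hh.1]
    exact hh.2.le
  have hmem : ∀ h ∈ Ioo 0 h₁, ∀ x ∈ closure W, x - h • n ∈ C → x - h • n ∈ W := by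
    intro h hh x hx hxC
    exact hshift x hx (hthick' h hh x hxC).2 h hh.1 (hCV hxC).2
  have hF0' : ∀ z, z ∉ C → W.indicator F z = 0 := by
    intro z hz
    by_cases hzW : z ∈ W
    · rw [indicator_of_mem hzW, hF0 z (subset_closure hzW) hz]
    · rw [indicator_of_notMem hzW]
  have hsubc : ∀ h : ℝ, Continuous fun x : EuclideanSpace ℝ (Fin d) => x - h • n := by
    intro h; fun_prop
  have hzero : ∀ (h : ℝ) x, x - h • n ∉ C → (fun y => W.indicator F (y - h • n)) =ᶠ[𝓝 x] 0 := by
    intro h x hx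
    filter_upwards [((hsubc h).tendsto x).eventually (hC.isClosed.isOpen_compl.mem_nhds hx)]
      with y hy
    exact hF0' _ hy
  have heq : ∀ (h : ℝ) x, x - h • n ∈ W →
      (fun y => W.indicator F (y - h • n)) =ᶠ[𝓝 x] fun y => F (y - h • n) := by
    intro h x hx
    filter_upwards [((hsubc h).tendsto x).eventually (hW.mem_nhds hx)] with y hy
    rw [indicator_of_mem hy]
  have hdiv : ∀ h ∈ Ioo 0 h₁, ∀ x ∈ closure W,
      divergence (fun y => W.indicator F (y - h • n)) x = W.indicator (divergence F) (x - h • n) := by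
    intro h hh x hx
    by_cases hxW : x - h • n ∈ W
    · rw [divergence_congr (heq h x hxW), divergence_comp_sub, indicator_of_mem hxW]
    · rw [indicator_of_notMem hxW]
      exact divergence_eq_zero (hzero h x fun hxC => hxW (hmem h hh x hx hxC))
  -- the translated field agrees on the closure of `W` with a compactly supported smooth field
  have hG : ∀ h ∈ Ioo 0 h₁, ∃ G : EuclideanSpace ℝ (Fin d) → EuclideanSpace ℝ (Fin d),
      ContDiff ℝ 1 G ∧ HasCompactSupport G ∧ tsupport G ⊆ V₁ ∧
      (∀ x ∈ closure W, G =ᶠ[𝓝 x] fun y => W.indicator F (y - h • n)) := by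
    intro h hh
    set Fh := fun y => W.indicator F (y - h • n) with hFh
    have hsm : ∀ x ∈ closure W, ContDiffAt ℝ 1 Fh x := by
      intro x hx
      by_cases hxC : x - h • n ∈ C
      · have hxW := hmem h hh x hx hxC
        refine ContDiffAt.congr_of_eventuallyEq ?_ (heq h x hxW)
        exact (hF.contDiffOn.contDiffAt (hW.mem_nhds hxW)).comp x (by fun_prop)
      · exact contDiffAt_const.congr_of_eventuallyEq (hzero h x hxC)
    have hopen : IsOpen {x | ContDiffAt ℝ 1 Fh x} := by
      rw [isOpen_iff_mem_nhds]
      intro x hx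
      exact ContDiffAt.eventually hx (by simp)
    have hK : IsCompact (closure W ∩ (fun x => x + h • n) '' C) :=
      (hC.image (by fun_prop)).inter_left isClosed_closure
    have hKmem : ∀ x, x ∈ (fun x => x + h • n) '' C ↔ x - h • n ∈ C := by
      intro x
      constructor
      · rintro ⟨z, hz, rfl⟩; simpa using hz
      · intro hx; exact ⟨_, hx, by simp⟩
    have hKU : closure W ∩ (fun x => x + h • n) '' C ⊆ {x | ContDiffAt ℝ 1 Fh x} ∩ V₁ :=
      fun x hx => ⟨hsm x hx.1, (hthick' h hh x ((hKmem x).1 hx.2)).1⟩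
    obtain ⟨χ, hχ, hχc, hχs, hχ1, -⟩ := exists_cutoff hK (hopen.inter hV₁) hKU
    refine ⟨fun x => χ x • Fh x, ?_, hχc.smul_right, ?_, ?_⟩
    · rw [contDiff_iff_contDiffAt]
      intro x
      by_cases hx : x ∈ tsupport χ
      · exact ((hχ.of_le (by simp)).contDiffAt).smul (hχs hx).1
      · refine contDiffAt_const (c := 0) |>.congr_of_eventuallyEq ?_
        filter_upwards [(isClosed_tsupport χ).isOpen_compl.mem_nhds hx] with y hy
        rw [image_eq_zero_of_notMem_tsupport hy, zero_smul]
    · exact (tsupport_smul_subset_left _ _).trans (hχs.trans inter_subset_right)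
    · intro x hx
      by_cases hxC : x - h • n ∈ C
      · filter_upwards [hχ1.filter_mono (nhds_le_nhdsSet
          (show x ∈ closure W ∩ (fun x => x + h • n) '' C from ⟨hx, (hKmem x).2 hxC⟩))] with y hy
        rw [hy, one_smul]
      · filter_upwards [hzero h x hxC] with y hy
        rw [show Fh y = 0 from hy, smul_zero]
  set ν := (μHE[d - 1] : Measure (EuclideanSpace ℝ (Fin d))).restrict (frontier W) with hν
  have hνfin : IsFiniteMeasure ν := ⟨by rwa [hν, Measure.restrict_apply_univ]⟩
  have hfr : ∀ᵐ x ∂ν, x ∈ frontier W := ae_restrict_mem isClosed_frontier.measurableSet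
  have hineq : ∀ h ∈ Ioo 0 h₁,
      |(∫ z in W, W.indicator (divergence F) ((z + h • n) - h • n) *
          W.indicator (fun _ => (1 : ℝ)) (z + h • n)) -
        ∫ x, inner ℝ (W.indicator F (x - h • n)) n ∂ν|
          ≤ ε * ∫ x, ‖W.indicator F (x - h • n)‖ ∂ν := by
    intro h hh
    obtain ⟨G, hG1, hGc, hGs, hGe⟩ := hG h hh
    have key := hloc G hG1 hGc hGs
    have a₁ : ∫ x in W, divergence G x = ∫ z in W, W.indicator (divergence F) ((z + h • n) - h • n) *
          W.indicator (fun _ => (1 : ℝ)) (z + h • n) := by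
      have b₁ : ∫ x in W, divergence G x = ∫ x in W, W.indicator (divergence F) (x - h • n) := by
        refine setIntegral_congr_fun hW.measurableSet fun x hx => ?_
        rw [divergence_congr (hGe x (subset_closure hx)), hdiv h hh x (subset_closure hx)]
      rw [b₁, ← integral_indicator hW.measurableSet, ← integral_indicator hW.measurableSet,
        ← integral_add_right_eq_self _ (h • n)]
      congr 1 with z
      by_cases hz : z ∈ W <;> by_cases hz' : z + h • n ∈ W <;> simp [hz, hz']
    have a₂ : ∫ x, inner ℝ (G x) n ∂ν = ∫ x, inner ℝ (W.indicator F (x - h • n)) n ∂ν := by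
      refine integral_congr_ae ?_
      filter_upwards [hfr] with x hx
      rw [(hGe x (frontier_subset_closure hx)).self_of_nhds]
    have a₃ : ∫ x, ‖G x‖ ∂ν = ∫ x, ‖W.indicator F (x - h • n)‖ ∂ν := by
      refine integral_congr_ae ?_
      filter_upwards [hfr] with x hx
      rw [(hGe x (frontier_subset_closure hx)).self_of_nhds]
    rw [← a₁, ← a₂, ← a₃]
    exact key
  have hpos : ∀ᶠ h in 𝓝[>] (0 : ℝ), h ∈ Ioo 0 h₁ := Ioo_mem_nhdsGT hh₁
  have hto : ∀ x : EuclideanSpace ℝ (Fin d),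
      Tendsto (fun h : ℝ => x - h • n) (𝓝[>] 0) (𝓝 x) := by
    intro x
    have : Continuous fun h : ℝ => x - h • n := by fun_prop
    simpa using (this.tendsto 0).mono_left nhdsWithin_le_nhds
  have hto' : ∀ x : EuclideanSpace ℝ (Fin d),
      Tendsto (fun h : ℝ => x + h • n) (𝓝[>] 0) (𝓝 x) := by
    intro x
    have : Continuous fun h : ℝ => x + h • n := by fun_prop
    simpa using (this.tendsto 0).mono_left nhdsWithin_le_nhds
  -- the translated field converges on the boundary, with a uniform bound
  obtain ⟨M, hM⟩ : ∃ M, ∀ z, ‖W.indicator F z‖ ≤ M := by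
    obtain ⟨M, hM⟩ := (hC.inter_right isClosed_closure).exists_bound_of_continuousOn
      (hF.continuousOn.mono (inter_subset_right : C ∩ closure W ⊆ _))
    refine ⟨max M 0, fun z => ?_⟩
    by_cases hz : z ∈ C ∧ z ∈ W
    · rw [indicator_of_mem hz.2]
      exact (hM z ⟨hz.1, subset_closure hz.2⟩).trans (le_max_left _ _)
    · have : W.indicator F z = 0 := by
        by_cases hzC : z ∈ C
        · exact indicator_of_notMem (fun h => hz ⟨hzC, h⟩) _
        · exact hF0' z hzC
      rw [this, norm_zero]; exact le_max_right _ _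
  have hlim : ∀ᵐ x ∂ν, Tendsto (fun h : ℝ => W.indicator F (x - h • n)) (𝓝[>] 0) (𝓝 (F x)) := by
    filter_upwards [hfr] with x hx
    have hxc := frontier_subset_closure hx
    by_cases hxV : x ∈ V₂
    · have hev : ∀ᶠ h in 𝓝[>] (0 : ℝ), x - h • n ∈ W := by
        filter_upwards [hpos, (hto x).eventually (hV₂.mem_nhds hxV)] with h hh hxh
        exact hshift x hxc hxV h hh.1 hxh
      have h1 : Tendsto (fun h : ℝ => F (x - h • n)) (𝓝[>] 0) (𝓝 (F x)) := by
        refine (hF.continuousOn x hxc).tendsto.comp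
          (tendsto_nhdsWithin_iff.2 ⟨hto x, hev.mono fun h hh => subset_closure hh⟩)
      refine h1.congr' ?_
      filter_upwards [hev] with h hh
      rw [indicator_of_mem hh]
    · have hxC : x ∉ C := fun h => hxV (hCV h).2
      rw [hF0 x hxc hxC]
      refine tendsto_const_nhds.congr' ?_
      filter_upwards [(hto x).eventually (hC.isClosed.isOpen_compl.mem_nhds hxC)] with h hh
      rw [hF0' _ hh]
  have hmeas : ∀ᶠ h in 𝓝[>] (0 : ℝ),
      AEStronglyMeasurable (fun x => W.indicator F (x - h • n)) ν := by
    filter_upwards [hpos] with h hh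
    obtain ⟨G, hG1, -, -, hGe⟩ := hG h hh
    refine hG1.continuous.aestronglyMeasurable.congr ?_
    filter_upwards [hfr] with x hx
    exact (hGe x (frontier_subset_closure hx)).self_of_nhds
  have L₁ : Tendsto (fun h : ℝ => ∫ x, inner ℝ (W.indicator F (x - h • n)) n ∂ν) (𝓝[>] 0)
      (𝓝 (∫ x, inner ℝ (F x) n ∂ν)) := by
    refine tendsto_integral_filter_of_dominated_convergence (fun _ => M) ?_ ?_
      (integrable_const _) ?_
    · filter_upwards [hmeas] with h hh
      exact hh.inner aestronglyMeasurable_const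
    · refine Eventually.of_forall fun h => ae_of_all _ fun x => ?_
      refine (norm_inner_le_norm _ _).trans ?_
      rw [hn, mul_one]; exact hM _
    · filter_upwards [hlim] with x hx
      exact hx.inner tendsto_const_nhds
  have L₂ : Tendsto (fun h : ℝ => ∫ x, ‖W.indicator F (x - h • n)‖ ∂ν) (𝓝[>] 0)
      (𝓝 (∫ x, ‖F x‖ ∂ν)) := by
    refine tendsto_integral_filter_of_dominated_convergence (fun _ => M) ?_ ?_
      (integrable_const _) ?_
    · filter_upwards [hmeas] with h hh
      exact hh.norm
    · refine Eventually.of_forall fun h => ae_of_all _ fun x => ?_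
      rw [norm_norm]; exact hM _
    · filter_upwards [hlim] with x hx
      exact hx.norm
  have L₃ : Tendsto (fun h : ℝ => ∫ z in W, W.indicator (divergence F) ((z + h • n) - h • n) *
          W.indicator (fun _ => (1 : ℝ)) (z + h • n)) (𝓝[>] 0) (𝓝 (∫ z in W, divergence F z)) := by
    refine tendsto_integral_filter_of_dominated_convergence (fun z => ‖divergence F z‖) ?_ ?_
      hF.integrableOn.norm ?_
    · refine Eventually.of_forall fun h => ?_
      have m₁ : AEStronglyMeasurable (fun z => W.indicator (divergence F) ((z + h • n) - h • n))
          (volume.restrict W) := by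
        simp only [add_sub_cancel_right]
        exact hF.integrableOn.aestronglyMeasurable.indicator hW.measurableSet
      refine m₁.mul (Measurable.aestronglyMeasurable ?_)
      exact (measurable_const.indicator hW.measurableSet).comp (by fun_prop)
    · refine Eventually.of_forall fun h => ae_of_all _ fun z => ?_
      rw [add_sub_cancel_right]
      by_cases hz : z ∈ W <;> by_cases hz' : z + h • n ∈ W <;> simp [hz, hz']
    · filter_upwards [ae_restrict_mem hW.measurableSet] with z hz
      refine tendsto_const_nhds.congr' ?_
      filter_upwards [(hto' z).eventually (hW.mem_nhds hz)] with h hh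
      rw [add_sub_cancel_right, indicator_of_mem hz,
        indicator_of_mem (show z + h • n ∈ W from hh), mul_one]
  exact le_of_tendsto_of_tendsto (L₃.sub L₁).abs (L₂.const_mul ε) (hpos.mono fun h hh => hineq h hh)

end LocalFlux

/-! ### The outward normal -/

section Normal

variable {d : ℕ} {W : Set (EuclideanSpace ℝ (Fin d))} {x : EuclideanSpace ℝ (Fin d)}
  {ρ : EuclideanSpace ℝ (Fin d) → ℝ}

lemma IsDefiningFunction.contDiffAt (h : IsDefiningFunction W x ρ) : ContDiffAt ℝ ∞ ρ x := by
  obtain ⟨-, -, U, hU, hx, hρ, -⟩ := h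
  exact hρ.contDiffAt (hU.mem_nhds hx)

lemma IsDefiningFunction.norm_unit (h : IsDefiningFunction W x ρ) :
    ‖‖gradient ρ x‖⁻¹ • gradient ρ x‖ = 1 := by
  rw [norm_smul, norm_inv, norm_norm, inv_mul_cancel₀ (norm_ne_zero_iff.2 h.2.1)]

lemma IsDefiningFunction.hasStrictFDerivAt (h : IsDefiningFunction W x ρ) :
    HasStrictFDerivAt ρ (‖gradient ρ x‖ • innerSL ℝ (‖gradient ρ x‖⁻¹ • gradient ρ x)) x := by
  have h1 := h.contDiffAt.hasStrictFDerivAt (by simp)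
  have h0 : ‖gradient ρ x‖ ≠ 0 := norm_ne_zero_iff.2 h.2.1
  have e : fderiv ℝ ρ x = ‖gradient ρ x‖ • innerSL ℝ (‖gradient ρ x‖⁻¹ • gradient ρ x) := by
    rw [map_smul, smul_inv_smul₀ h0]
    ext v
    simp [gradient]
  rwa [← e]

/-- A defining function is positive on one side of the tangent plane and negative on the other. -/
lemma IsDefiningFunction.eventually_mem_iff (h : IsDefiningFunction W x ρ)
    {v : EuclideanSpace ℝ (Fin d)} (hv : inner ℝ (gradient ρ x) v ≠ 0) :
    ∀ᶠ t in 𝓝[>] (0 : ℝ), (x + t • v ∈ W ↔ inner ℝ (gradient ρ x) v < 0) := by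
  obtain ⟨h0, hg, U, hU, hxU, hρ, hW⟩ := id h
  have hline : HasDerivAt (fun t : ℝ => ρ (x + t • v)) (inner ℝ (gradient ρ x) v) 0 := by
    have h1 : HasFDerivAt ρ (fderiv ℝ ρ x) (x + (0 : ℝ) • v) := by
      rw [zero_smul, add_zero]
      exact (h.contDiffAt.differentiableAt (by simp)).hasFDerivAt
    have h2 : HasDerivAt (fun t : ℝ => x + t • v) v 0 := by
      simpa using ((hasDerivAt_id (0 : ℝ)).smul_const v).const_add x
    have := h1.comp_hasDerivAt 0 h2
    simpa [gradient, Function.comp_def] using this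
  have hslope := hline.tendsto_slope_zero_right
  simp only [zero_add, zero_smul, add_zero, h0, sub_zero] at hslope
  have hto : Tendsto (fun t : ℝ => x + t • v) (𝓝[>] 0) (𝓝 x) := by
    have : Continuous fun t : ℝ => x + t • v := by fun_prop
    simpa using (this.tendsto 0).mono_left nhdsWithin_le_nhds
  have hmem : ∀ᶠ t in 𝓝[>] (0 : ℝ), x + t • v ∈ U := hto.eventually (hU.mem_nhds hxU)
  rcases lt_or_gt_of_ne hv with hneg | hpos
  · filter_upwards [hmem, hslope.eventually (gt_mem_nhds hneg), self_mem_nhdsWithin] with t ht hs h0t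
    rw [hW _ ht]
    have h0t' : (0 : ℝ) < t := h0t
    simp only [hneg, iff_true]
    rw [smul_eq_mul] at hs
    exact (pos_iff_neg_of_mul_neg hs).1 (by positivity)
  · filter_upwards [hmem, hslope.eventually (lt_mem_nhds hpos), self_mem_nhdsWithin] with t ht hs h0t
    rw [hW _ ht]
    have h0t' : (0 : ℝ) < t := h0t
    simp only [not_lt.2 hpos.le, iff_false, not_lt]
    rw [smul_eq_mul] at hs
    exact ((pos_iff_pos_of_mul_pos hs).1 (by positivity)).le

lemma IsDefiningFunction.unit_gradient_eq {ρ' : EuclideanSpace ℝ (Fin d) → ℝ}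
    (h : IsDefiningFunction W x ρ) (h' : IsDefiningFunction W x ρ') :
    ‖gradient ρ x‖⁻¹ • gradient ρ x = ‖gradient ρ' x‖⁻¹ • gradient ρ' x := by
  set a := ‖gradient ρ x‖⁻¹ • gradient ρ x with ha
  set b := ‖gradient ρ' x‖⁻¹ • gradient ρ' x with hb
  have hna : ‖a‖ = 1 := h.norm_unit
  have hnb : ‖b‖ = 1 := h'.norm_unit
  by_contra hne
  have hlt : inner ℝ a b < 1 := (inner_lt_one_iff_real_of_norm_eq_one hna hnb).2 hne
  have ha' : gradient ρ x = ‖gradient ρ x‖ • a := by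
    rw [ha, smul_inv_smul₀ (norm_ne_zero_iff.2 h.2.1)]
  have hb' : gradient ρ' x = ‖gradient ρ' x‖ • b := by
    rw [hb, smul_inv_smul₀ (norm_ne_zero_iff.2 h'.2.1)]
  -- the direction `b - a` would point into the set by one function and out of it by the other
  have h1 : inner ℝ (gradient ρ x) (b - a) < 0 := by
    rw [ha', inner_smul_left, inner_sub_right, real_inner_self_eq_norm_sq, hna]
    exact mul_neg_of_pos_of_neg (by simpa using h.2.1) (by linarith)
  have h2 : 0 < inner ℝ (gradient ρ' x) (b - a) := by
    rw [hb', inner_smul_left, inner_sub_right, real_inner_self_eq_norm_sq, hnb,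
      real_inner_comm]
    exact mul_pos (by simpa using h'.2.1) (by linarith)
  obtain ⟨t, ht1, ht2⟩ :=
    ((h.eventually_mem_iff h1.ne).and (h'.eventually_mem_iff h2.ne')).exists
  exact absurd (ht2.1 (ht1.2 h1)) (not_lt.2 h2.le)

lemma IsDefiningFunction.outwardNormal_eq (h : IsDefiningFunction W x ρ) :
    outwardNormal W x = ‖gradient ρ x‖⁻¹ • gradient ρ x := by
  have hs : IsSmoothBoundaryPoint W x := ⟨ρ, h⟩
  rw [outwardNormal, dif_pos hs]
  exact hs.choose_spec.unit_gradient_eq h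

lemma norm_outwardNormal_le (W : Set (EuclideanSpace ℝ (Fin d))) (x : EuclideanSpace ℝ (Fin d)) :
    ‖outwardNormal W x‖ ≤ 1 := by
  by_cases hs : IsSmoothBoundaryPoint W x
  · obtain ⟨ρ, h⟩ := hs
    rw [h.outwardNormal_eq, h.norm_unit]
  · rw [outwardNormal, dif_neg hs, norm_zero]; exact zero_le_one

lemma IsDefiningFunction.continuousAt_gradient (h : IsDefiningFunction W x ρ) :
    ContinuousAt (gradient ρ) x := by
  have := (h.contDiffAt.fderiv_right (m := 0) (by simp)).continuousAt
  exact ((InnerProductSpace.toDual ℝ (EuclideanSpace ℝ (Fin d))).symm.continuous.continuousAt).comp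
    this

/-- A defining function at a boundary point is one at all boundary points nearby. -/
lemma IsDefiningFunction.eventually_isDefiningFunction (hW : IsOpen W)
    (h : IsDefiningFunction W x ρ) :
    ∀ᶠ y in 𝓝 x, y ∈ frontier W → IsDefiningFunction W y ρ := by
  obtain ⟨-, hg, U, hU, hxU, hρ, hWU⟩ := id h
  filter_upwards [hU.mem_nhds hxU, h.continuousAt_gradient.eventually_ne hg] with y hyU hgy hyf
  refine ⟨le_antisymm ?_ ?_, hgy, U, hU, hyU, hρ, hWU⟩
  · by_contra hlt
    have hev : ∀ᶠ z in 𝓝 y, z ∉ W := by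
      filter_upwards [hU.mem_nhds hyU, (hρ.continuousOn.continuousAt
        (hU.mem_nhds hyU)).eventually (lt_mem_nhds (not_le.1 hlt))] with z hz hz'
      rw [hWU z hz]; exact not_lt.2 hz'.le
    exact mem_closure_iff_frequently.1 (frontier_subset_closure hyf) hev
  · have : y ∉ W := by
      rw [hW.frontier_eq] at hyf
      exact hyf.2
    rw [hWU y hyU] at this
    exact not_lt.1 this

lemma continuousWithinAt_outwardNormal (hW : IsOpen W) (hx : IsSmoothBoundaryPoint W x) :
    ContinuousWithinAt (outwardNormal W) (frontier W) x := by
  obtain ⟨ρ, h⟩ := hx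
  have hc : ContinuousAt (fun y => ‖gradient ρ y‖⁻¹ • gradient ρ y) x :=
    (h.continuousAt_gradient.norm.inv₀ (norm_ne_zero_iff.2 h.2.1)).smul h.continuousAt_gradient
  refine hc.continuousWithinAt.congr_of_eventuallyEq ?_ h.outwardNormal_eq
  filter_upwards [nhdsWithin_le_nhds (h.eventually_isDefiningFunction hW), self_mem_nhdsWithin]
    with y hy hyf
  exact (hy hyf).outwardNormal_eq

lemma isClosed_nonsmooth (hW : IsOpen W) :
    IsClosed {x ∈ frontier W | ¬ IsSmoothBoundaryPoint W x} := by
  rw [← isOpen_compl_iff, isOpen_iff_mem_nhds]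
  intro x hx
  by_cases hxf : x ∈ frontier W
  · have hs : IsSmoothBoundaryPoint W x := by
      by_contra h
      exact hx ⟨hxf, h⟩
    obtain ⟨ρ, h⟩ := hs
    filter_upwards [h.eventually_isDefiningFunction hW] with y hy hy'
    exact hy'.2 ⟨ρ, hy hy'.1⟩
  · filter_upwards [isClosed_frontier.isOpen_compl.mem_nhds hxf] with y hy hy'
    exact hy hy'.1

/-- The normal is continuous on the smooth part of the boundary, which is relatively open. -/
lemma aestronglyMeasurable_outwardNormal (hW : IsOpen W)
    {ν : Measure (EuclideanSpace ℝ (Fin d))}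
    (hnull : ν {x ∈ frontier W | ¬ IsSmoothBoundaryPoint W x} = 0) :
    AEStronglyMeasurable (outwardNormal W) (ν.restrict (frontier W)) := by
  have hc : ContinuousOn (outwardNormal W)
      (frontier W \ {x ∈ frontier W | ¬ IsSmoothBoundaryPoint W x}) := by
    rintro x ⟨hxf, hx⟩
    refine (continuousWithinAt_outwardNormal hW ?_).mono sdiff_subset
    by_contra h
    exact hx ⟨hxf, h⟩
  have := hc.aestronglyMeasurable (μ := ν)
    (isClosed_frontier.measurableSet.diff (isClosed_nonsmooth hW).measurableSet)
  rwa [Measure.restrict_congr_set (sdiff_null_ae_eq_self hnull)] at this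

end Normal

/-! ### From local to global -/

section LocalToGlobal

variable {d : ℕ} {W : Set (EuclideanSpace ℝ (Fin d))}

/-- The Gauss–Green formula holds with relative error `ε` for fields supported in `V`. -/
def HasApproxFlux (W V : Set (EuclideanSpace ℝ (Fin d))) (ε : ℝ) : Prop :=
  ∀ (F : EuclideanSpace ℝ (Fin d) → EuclideanSpace ℝ (Fin d))
    (C : Set (EuclideanSpace ℝ (Fin d))), IsAdmissible W F → IsCompact C → C ⊆ V →
    (∀ x ∈ closure W, x ∉ C → F x = 0) →
    |(∫ x in W, divergence F x) -
        ∫ x in frontier W, inner ℝ (F x) (outwardNormal W x) ∂μHE[d - 1]|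
      ≤ ε * ∫ x in frontier W, ‖F x‖ ∂μHE[d - 1]

lemma HasApproxFlux.mono {V V' : Set (EuclideanSpace ℝ (Fin d))} {ε : ℝ}
    (h : HasApproxFlux W V ε) (hV : V' ⊆ V) : HasApproxFlux W V' ε :=
  fun F C hF hC hCV hF0 => h F C hF hC (hCV.trans hV) hF0

lemma IsAdmissible.smul (hb : Bornology.IsBounded W) (hW : IsOpen W)
    {F : EuclideanSpace ℝ (Fin d) → EuclideanSpace ℝ (Fin d)} (hF : IsAdmissible W F)
    {χ : EuclideanSpace ℝ (Fin d) → ℝ} (hχ : ContDiff ℝ 1 χ) :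
    IsAdmissible W fun x => χ x • F x := by
  have hcpt : IsCompact (closure W) := hb.isCompact_closure
  refine ⟨hχ.continuous.continuousOn.smul hF.continuousOn, hχ.contDiffOn.smul hF.contDiffOn, ?_⟩
  have hdiv : EqOn (divergence fun x => χ x • F x)
      (fun x => χ x * divergence F x + fderiv ℝ χ x (F x)) W := fun x hx =>
    divergence_smul (hχ.differentiable one_ne_zero x)
      ((hF.contDiffOn.contDiffAt (hW.mem_nhds hx)).differentiableAt one_ne_zero)
  rw [integrableOn_congr_fun hdiv hW.measurableSet]
  refine Integrable.add ?_ ?_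
  · obtain ⟨M, hM⟩ := hcpt.exists_bound_of_continuousOn hχ.continuous.continuousOn
    refine Integrable.bdd_mul (c := M) hF.integrableOn hχ.continuous.aestronglyMeasurable ?_
    filter_upwards [ae_restrict_mem hW.measurableSet] with x hx
    exact hM x (subset_closure hx)
  · have hc : ContinuousOn (fun x => fderiv ℝ χ x (F x)) (closure W) :=
      (hχ.continuous_fderiv one_ne_zero).continuousOn.clm_apply hF.continuousOn
    exact (hc.integrableOn_compact hcpt).mono_set subset_closure

lemma integrableOn_frontier_of_continuousOn (hb : Bornology.IsBounded W)
    {ν : Measure (EuclideanSpace ℝ (Fin d))} (hfin : ν (frontier W) < ⊤)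
    {X : Type*} [NormedAddCommGroup X] [SecondCountableTopologyEither (EuclideanSpace ℝ (Fin d)) X]
    {F : EuclideanSpace ℝ (Fin d) → X} (hF : ContinuousOn F (closure W)) :
    IntegrableOn F (frontier W) ν := by
  have hcpt : IsCompact (frontier W) :=
    hb.isCompact_closure.of_isClosed_subset isClosed_frontier frontier_subset_closure
  have hc := hF.mono frontier_subset_closure
  obtain ⟨M, hM⟩ := hcpt.exists_bound_of_continuousOn hc
  refine IntegrableOn.of_bound hfin
    (hc.aestronglyMeasurable isClosed_frontier.measurableSet) M ?_
  filter_upwards [ae_restrict_mem isClosed_frontier.measurableSet] with x hx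
  exact hM x hx

lemma integrableOn_inner_outwardNormal (hb : Bornology.IsBounded W) (hW : IsOpen W)
    {ν : Measure (EuclideanSpace ℝ (Fin d))} (hfin : ν (frontier W) < ⊤)
    (hnull : ν {x ∈ frontier W | ¬ IsSmoothBoundaryPoint W x} = 0)
    {F : EuclideanSpace ℝ (Fin d) → EuclideanSpace ℝ (Fin d)} (hF : ContinuousOn F (closure W)) :
    IntegrableOn (fun x => inner ℝ (F x) (outwardNormal W x)) (frontier W) ν := by
  have h := integrableOn_frontier_of_continuousOn hb hfin hF
  refine Integrable.mono' h.norm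
    (h.aestronglyMeasurable.inner (aestronglyMeasurable_outwardNormal hW hnull)) ?_
  refine ae_of_all _ fun x => (norm_inner_le_norm _ _).trans ?_
  exact mul_le_of_le_one_right (norm_nonneg _) (norm_outwardNormal_le W x)

lemma integrableOn_smul_outwardNormal (hb : Bornology.IsBounded W) (hW : IsOpen W)
    {ν : Measure (EuclideanSpace ℝ (Fin d))} (hfin : ν (frontier W) < ⊤)
    (hnull : ν {x ∈ frontier W | ¬ IsSmoothBoundaryPoint W x} = 0)
    {g : EuclideanSpace ℝ (Fin d) → ℝ} (hg : ContinuousOn g (closure W)) :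
    IntegrableOn (fun x => g x • outwardNormal W x) (frontier W) ν := by
  have h := integrableOn_frontier_of_continuousOn hb hfin hg
  refine Integrable.mono' h.norm
    (h.aestronglyMeasurable.smul (aestronglyMeasurable_outwardNormal hW hnull)) ?_
  refine ae_of_all _ fun x => ?_
  rw [norm_smul]
  exact mul_le_of_le_one_right (norm_nonneg _) (norm_outwardNormal_le W x)

/-- Fields supported in the union of two open sets are sums of fields supported in one of them, and
the norms add up. -/
lemma HasApproxFlux.union (hb : Bornology.IsBounded W) (hW : IsOpen W)
    (hfin : (μHE[d - 1] : Measure (EuclideanSpace ℝ (Fin d))) (frontier W) < ⊤)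
    (hnull : (μHE[d - 1] : Measure (EuclideanSpace ℝ (Fin d)))
      {x ∈ frontier W | ¬ IsSmoothBoundaryPoint W x} = 0)
    {V₁ V₂ : Set (EuclideanSpace ℝ (Fin d))} {ε : ℝ} (hV₁ : IsOpen V₁) (hV₂ : IsOpen V₂)
    (h₁ : HasApproxFlux W V₁ ε) (h₂ : HasApproxFlux W V₂ ε) : HasApproxFlux W (V₁ ∪ V₂) ε := by
  intro F C hF hC hCV hF0
  have hK : IsCompact (C \ V₂) := hC.diff hV₂
  have hKV : C \ V₂ ⊆ V₁ := fun x hx => (hCV hx.1).resolve_right hx.2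
  obtain ⟨χ, hχ, hχc, hχs, hχ1, hχI⟩ := exists_cutoff hK hV₁ hKV
  have hχ' : ContDiff ℝ 1 χ := hχ.of_le (by simp)
  have hχ'' : ContDiff ℝ 1 fun x => 1 - χ x := contDiff_const.sub hχ'
  have a₁ := hF.smul hb hW hχ'
  have a₂ := hF.smul hb hW hχ''
  have e₁ := h₁ _ (C ∩ tsupport χ) a₁ (hC.inter_right (isClosed_tsupport χ))
    (inter_subset_right.trans hχs) (by
      intro x hx hxC
      by_cases hxC' : x ∈ C
      · have : x ∉ tsupport χ := fun h => hxC ⟨hxC', h⟩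
        rw [image_eq_zero_of_notMem_tsupport this, zero_smul]
      · rw [hF0 x hx hxC', smul_zero])
  have e₂ := h₂ _ (C ∩ closure {x | χ x ≠ 1}) a₂ (hC.inter_right isClosed_closure) (by
      rintro x ⟨hxC, hx⟩
      by_contra hxV
      have : ∀ᶠ y in 𝓝 x, χ y = 1 :=
        hχ1.filter_mono (nhds_le_nhdsSet (show x ∈ C \ V₂ from ⟨hxC, hxV⟩))
      exact mem_closure_iff_frequently.1 hx (this.mono fun y hy => not_not.2 hy)) (by
      intro x hx hxC
      by_cases hxC' : x ∈ C
      · have h1 : χ x = 1 := by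
          by_contra h
          exact hxC ⟨hxC', subset_closure h⟩
        rw [h1, sub_self, zero_smul]
      · rw [hF0 x hx hxC', smul_zero])
  have hd : ∀ x ∈ W, divergence F x
      = divergence (fun y => χ y • F y) x + divergence (fun y => (1 - χ y) • F y) x := by
    intro x hx
    have hFd := (hF.contDiffOn.contDiffAt (hW.mem_nhds hx)).differentiableAt one_ne_zero
    rw [← divergence_add ((hχ'.differentiable one_ne_zero x).fun_smul hFd)
      ((hχ''.differentiable one_ne_zero x).fun_smul hFd)]
    congr 1
    ext1 y
    rw [← add_smul]; simp
  have s₁ : ∫ x in W, divergence F x = (∫ x in W, divergence (fun y => χ y • F y) x)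
      + ∫ x in W, divergence (fun y => (1 - χ y) • F y) x := by
    rw [← integral_add a₁.integrableOn a₂.integrableOn]
    exact setIntegral_congr_fun hW.measurableSet hd
  have s₂ : ∫ x in frontier W, inner ℝ (F x) (outwardNormal W x) ∂μHE[d - 1]
      = (∫ x in frontier W, inner ℝ (χ x • F x) (outwardNormal W x) ∂μHE[d - 1])
      + ∫ x in frontier W, inner ℝ ((1 - χ x) • F x) (outwardNormal W x) ∂μHE[d - 1] := by
    rw [← integral_add (integrableOn_inner_outwardNormal hb hW hfin hnull a₁.continuousOn)
      (integrableOn_inner_outwardNormal hb hW hfin hnull a₂.continuousOn)]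
    congr 1 with x
    rw [← inner_add_left, ← add_smul]; simp
  have s₃ : ∫ x in frontier W, ‖F x‖ ∂μHE[d - 1]
      = (∫ x in frontier W, ‖χ x • F x‖ ∂μHE[d - 1])
      + ∫ x in frontier W, ‖(1 - χ x) • F x‖ ∂μHE[d - 1] := by
    rw [← integral_add (integrableOn_frontier_of_continuousOn hb hfin a₁.continuousOn).norm
      (integrableOn_frontier_of_continuousOn hb hfin a₂.continuousOn).norm]
    congr 1 with x
    rw [norm_smul, norm_smul, Real.norm_of_nonneg (hχI x).1,
      Real.norm_of_nonneg (sub_nonneg.2 (hχI x).2)]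
    ring
  rw [s₁, s₂, s₃, mul_add, add_sub_add_comm]
  exact (abs_add_le _ _).trans (add_le_add e₁ e₂)

/-- The formula is exact for fields supported inside `W`. -/
lemma hasApproxFlux_self (hW : IsOpen W) {ε : ℝ} (hε : 0 ≤ ε) : HasApproxFlux W W ε := by
  intro F C hF hC hCW hF0
  have hfr : ∀ x ∈ frontier W, F x = 0 := by
    intro x hx
    refine hF0 x (frontier_subset_closure hx) fun hxC => ?_
    rw [hW.frontier_eq] at hx
    exact hx.2 (hCW hxC)
  have h2 : ∫ x in frontier W, inner ℝ (F x) (outwardNormal W x) ∂μHE[d - 1] = 0 := by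
    refine setIntegral_eq_zero_of_forall_eq_zero fun x hx => ?_
    rw [hfr x hx, inner_zero_left]
  have hz : ∀ x, x ∉ C → W.indicator F x = 0 := by
    intro x hx
    by_cases hxW : x ∈ W
    · rw [indicator_of_mem hxW, hF0 x (subset_closure hxW) hx]
    · rw [indicator_of_notMem hxW]
  have heq : ∀ x ∈ W, W.indicator F =ᶠ[𝓝 x] F := by
    intro x hx
    filter_upwards [hW.mem_nhds hx] with y hy
    rw [indicator_of_mem hy]
  have hG : ContDiff ℝ 1 (W.indicator F) := by
    rw [contDiff_iff_contDiffAt]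
    intro x
    by_cases hx : x ∈ C
    · exact (hF.contDiffOn.contDiffAt (hW.mem_nhds (hCW hx))).congr_of_eventuallyEq
        (heq x (hCW hx))
    · refine contDiffAt_const (c := 0) |>.congr_of_eventuallyEq ?_
      filter_upwards [hC.isClosed.isOpen_compl.mem_nhds hx] with y hy
      exact hz y hy
  have hGc : HasCompactSupport (W.indicator F) := HasCompactSupport.intro hC hz
  have h1 : ∫ x in W, divergence F x = 0 := by
    have e1 : ∫ x in W, divergence F x = ∫ x, divergence (W.indicator F) x := by
      rw [← integral_indicator hW.measurableSet]
      congr 1 with x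
      by_cases hx : x ∈ W
      · rw [indicator_of_mem hx, divergence_congr (heq x hx)]
      · rw [indicator_of_notMem hx, divergence_eq_zero]
        have hxC : x ∉ C := fun h => hx (hCW h)
        filter_upwards [hC.isClosed.isOpen_compl.mem_nhds hxC] with y hy
        exact hz y hy
    have hGi : ∀ i, ContDiff ℝ 1 fun y => W.indicator F y i := fun i => by fun_prop
    have hGic : ∀ i, HasCompactSupport fun y => W.indicator F y i := fun i =>
      hGc.comp_left (g := fun z : EuclideanSpace ℝ (Fin d) => z i) (by simp)
    have hfd : ∀ i, Integrable
        (fun x => fderiv ℝ (fun y => W.indicator F y i) x (EuclideanSpace.single i 1)) := by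
      intro i
      have hcont : Continuous fun x =>
          fderiv ℝ (fun y => W.indicator F y i) x (EuclideanSpace.single i 1) := by
        have := (hGi i).continuous_fderiv one_ne_zero
        fun_prop
      exact hcont.integrable_of_hasCompactSupport (((hGic i).fderiv ℝ).comp_left
        (g := fun L : EuclideanSpace ℝ (Fin d) →L[ℝ] ℝ => L (EuclideanSpace.single i 1)) (by simp))
    rw [e1]
    simp_rw [fun x => divergence_eq_sum_fderiv_apply (hG.differentiable one_ne_zero x)]
    rw [integral_finsetSum _ fun i _ => hfd i]
    refine Finset.sum_eq_zero fun i _ => ?_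
    have := integral_mul_fderiv_eq_neg_fderiv_mul_of_integrable (𝕜 := ℝ)
      (μ := (volume : Measure (EuclideanSpace ℝ (Fin d)))) (f := fun _ => (1 : ℝ))
      (g := fun y => W.indicator F y i) (v := EuclideanSpace.single i 1)
      (by simp) (by simpa using hfd i)
      (by simpa using (hGi i).continuous.integrable_of_hasCompactSupport (hGic i))
      (by simp) (fun x _ => (hGi i).differentiable one_ne_zero x)
    simpa using this
  rw [h1, h2, sub_self, abs_zero]
  exact mul_nonneg hε (integral_nonneg fun x => norm_nonneg _)

/-- The error in the local Gauss–Green formula, relative to the field, is as small as desired near a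
smooth boundary point. -/
lemma IsSmoothBoundaryPoint.exists_hasApproxFlux (hb : Bornology.IsBounded W) (hW : IsOpen W)
    (hfin : (μHE[d - 1] : Measure (EuclideanSpace ℝ (Fin d))) (frontier W) < ⊤)
    (hnull : (μHE[d - 1] : Measure (EuclideanSpace ℝ (Fin d)))
      {x ∈ frontier W | ¬ IsSmoothBoundaryPoint W x} = 0)
    {x₀ : EuclideanSpace ℝ (Fin d)} (hx₀ : IsSmoothBoundaryPoint W x₀) {ε : ℝ} (hε : 0 < ε) :
    ∃ V, IsOpen V ∧ x₀ ∈ V ∧ HasApproxFlux W V ε := by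
  have hcont := continuousWithinAt_outwardNormal hW hx₀
  obtain ⟨ρ, hρ⟩ := hx₀
  obtain ⟨h0, hg, U, hU, hxU, -, hWU⟩ := id hρ
  obtain ⟨V, hV, hxV, hloc⟩ := exists_nhds_abs_divergence_sub_le_of_isAdmissible hρ.norm_unit
    (norm_pos_iff.2 hg) hρ.hasStrictFDerivAt h0 hW hWU (hU.mem_nhds hxU) hfin (half_pos hε)
  set n := ‖gradient ρ x₀‖⁻¹ • gradient ρ x₀ with hn
  have hclose : ∀ᶠ y in 𝓝 x₀, y ∈ frontier W → ‖n - outwardNormal W y‖ ≤ ε / 2 := by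
    have := hcont.eventually (Metric.closedBall_mem_nhds _ (half_pos hε))
    rw [eventually_nhdsWithin_iff] at this
    filter_upwards [this] with y hy hyf
    have h := hy hyf
    rwa [dist_comm, dist_eq_norm, hρ.outwardNormal_eq] at h
  obtain ⟨V', hV'sub, hV', hxV'⟩ := eventually_nhds_iff.1 hclose
  refine ⟨V ∩ V', hV.inter hV', ⟨hxV, hxV'⟩, fun F C hF hC hCV hF0 => ?_⟩
  have key := hloc F C hF hC (hCV.trans inter_subset_left) hF0
  have hFi := integrableOn_frontier_of_continuousOn hb hfin hF.continuousOn
  have hNi := integrableOn_inner_outwardNormal hb hW hfin hnull hF.continuousOn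
  have hni : IntegrableOn (fun x => inner ℝ (F x) n) (frontier W) μHE[d - 1] := by
    refine Integrable.mono' hFi.norm (hFi.aestronglyMeasurable.inner aestronglyMeasurable_const) ?_
    refine ae_of_all _ fun x => (norm_inner_le_norm _ _).trans ?_
    rw [hn, hρ.norm_unit, mul_one]
  have hdiff : |(∫ x in frontier W, inner ℝ (F x) n ∂μHE[d - 1]) -
      ∫ x in frontier W, inner ℝ (F x) (outwardNormal W x) ∂μHE[d - 1]|
        ≤ ε / 2 * ∫ x in frontier W, ‖F x‖ ∂μHE[d - 1] := by
    rw [← integral_sub hni hNi, ← integral_const_mul, ← Real.norm_eq_abs]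
    refine norm_integral_le_of_norm_le (hFi.norm.const_mul _) ?_
    filter_upwards [ae_restrict_mem isClosed_frontier.measurableSet] with x hx
    rw [← inner_sub_right]
    refine (norm_inner_le_norm _ _).trans ?_
    rw [mul_comm]
    by_cases hxC : x ∈ C
    · gcongr
      exact hV'sub x (hCV hxC).2 hx
    · rw [hF0 x (frontier_subset_closure hx) hxC]; simp
  calc |(∫ x in W, divergence F x) -
        ∫ x in frontier W, inner ℝ (F x) (outwardNormal W x) ∂μHE[d - 1]|
      ≤ ε / 2 * (∫ x in frontier W, ‖F x‖ ∂μHE[d - 1])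
        + ε / 2 * ∫ x in frontier W, ‖F x‖ ∂μHE[d - 1] :=
        (abs_sub_le _ _ _).trans (add_le_add key hdiff)
    _ = ε * ∫ x in frontier W, ‖F x‖ ∂μHE[d - 1] := by ring

/-- The Gauss–Green formula for fields that vanish near the singular part of the boundary. -/
theorem integral_divergence_eq_of_eq_zero_nhds (hb : Bornology.IsBounded W) (hW : IsOpen W)
    (hfin : (μHE[d - 1] : Measure (EuclideanSpace ℝ (Fin d))) (frontier W) < ⊤)
    (hnull : (μHE[d - 1] : Measure (EuclideanSpace ℝ (Fin d)))
      {x ∈ frontier W | ¬ IsSmoothBoundaryPoint W x} = 0)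
    {F : EuclideanSpace ℝ (Fin d) → EuclideanSpace ℝ (Fin d)} (hF : IsAdmissible W F)
    {U : Set (EuclideanSpace ℝ (Fin d))} (hU : IsOpen U)
    (hsing : {x ∈ frontier W | ¬ IsSmoothBoundaryPoint W x} ⊆ U)
    (hF0 : ∀ x ∈ closure W, x ∈ U → F x = 0) :
    ∫ x in W, divergence F x =
      ∫ x in frontier W, inner ℝ (F x) (outwardNormal W x) ∂μHE[d - 1] := by
  have hC : IsCompact (closure W \ U) := hb.isCompact_closure.diff hU
  have key : ∀ ε > 0, |(∫ x in W, divergence F x) -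
        ∫ x in frontier W, inner ℝ (F x) (outwardNormal W x) ∂μHE[d - 1]|
      ≤ ε * ∫ x in frontier W, ‖F x‖ ∂μHE[d - 1] := by
    intro ε hε
    obtain ⟨V, hV, hCV, hflux⟩ : ∃ V, IsOpen V ∧ closure W \ U ⊆ V ∧ HasApproxFlux W V ε := by
      refine hC.induction_on (p := fun s => ∃ V, IsOpen V ∧ s ⊆ V ∧ HasApproxFlux W V ε) ?_ ?_ ?_ ?_
      · exact ⟨∅, isOpen_empty, subset_rfl, (hasApproxFlux_self hW hε.le).mono (empty_subset _)⟩
      · rintro s t hst ⟨V, hV, htV, h⟩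
        exact ⟨V, hV, hst.trans htV, h⟩
      · rintro s t ⟨V₁, hV₁, hs, h₁⟩ ⟨V₂, hV₂, ht, h₂⟩
        exact ⟨V₁ ∪ V₂, hV₁.union hV₂, union_subset_union hs ht,
          h₁.union hb hW hfin hnull hV₁ hV₂ h₂⟩
      · rintro x ⟨hx, hxU⟩
        rw [closure_eq_self_union_frontier] at hx
        rcases hx with hx | hx
        · exact ⟨W, mem_nhdsWithin_of_mem_nhds (hW.mem_nhds hx), W, hW, subset_rfl,
            hasApproxFlux_self hW hε.le⟩
        · have hs : IsSmoothBoundaryPoint W x := by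
            by_contra h
            exact hxU (hsing ⟨hx, h⟩)
          obtain ⟨V, hV, hxV, h⟩ := hs.exists_hasApproxFlux hb hW hfin hnull hε
          exact ⟨V, mem_nhdsWithin_of_mem_nhds (hV.mem_nhds hxV), V, hV, subset_rfl, h⟩
    refine hflux F _ hF hC hCV fun x hx hxC => hF0 x hx ?_
    by_contra h
    exact hxC ⟨hx, h⟩
  have hlim : Tendsto (fun ε : ℝ => ε * ∫ x in frontier W, ‖F x‖ ∂μHE[d - 1]) (𝓝[>] 0) (𝓝 0) := by
    have : Continuous fun ε : ℝ => ε * ∫ x in frontier W, ‖F x‖ ∂μHE[d - 1] := by fun_prop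
    simpa using (this.tendsto 0).mono_left nhdsWithin_le_nhds
  have := ge_of_tendsto hlim (by filter_upwards [self_mem_nhdsWithin] with ε hε using key ε hε)
  exact sub_eq_zero.1 (abs_nonpos_iff.1 this)

end LocalToGlobal

/-! ### Cutting off sets of zero surface measure -/

section NullCover

/-- A compact set of zero `k`-dimensional Hausdorff measure has finite covers by balls whose radii
have a small sum of `k`-th powers. -/
lemma exists_finset_ball_cover {X : Type*} [MetricSpace X] [MeasurableSpace X] [BorelSpace X]
    [Nonempty X] {N : Set X} (hN : IsCompact N) (k : ℕ) (hnull : (μHE[k] : Measure X) N = 0)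
    {δ ε : ℝ} (hδ : 0 < δ) (hε : 0 < ε) :
    ∃ (I : Finset ℕ) (x : ℕ → X) (r : ℕ → ℝ), (∀ i ∈ I, x i ∈ N ∧ 0 < r i ∧ r i ≤ δ) ∧
      N ⊆ ⋃ i ∈ I, Metric.ball (x i) (r i) ∧ ∑ i ∈ I, r i ^ k ≤ ε := by
  have hH : (μH[k] : Measure X) N = 0 := by
    rw [Measure.euclideanHausdorffMeasure_def, Measure.smul_apply, ENNReal.smul_def,
      smul_eq_mul] at hnull
    refine (mul_eq_zero.1 hnull).resolve_left ?_
    exact_mod_cast Measure.addHaarScalarFactor_volume_hausdorffMeasure_ne_zero k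
  have hε2 : (0 : ENNReal) < ENNReal.ofReal (ε / 2) := by simpa using hε
  have hδ2 : (0 : ENNReal) < ENNReal.ofReal (δ / 2) := by simpa using hδ
  rw [Measure.hausdorffMeasure_apply] at hH
  have h1 := (le_iSup₂ (f := fun (r : ENNReal) (_ : 0 < r) =>
    ⨅ (t : ℕ → Set X) (_ : N ⊆ ⋃ n, t n) (_ : ∀ n, Metric.ediam (t n) ≤ r),
      ∑' n, ⨆ _ : (t n).Nonempty, Metric.ediam (t n) ^ (k : ℝ)) _ hδ2).trans_eq hH
  have h2 := h1.trans_lt hε2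
  simp only [iInf_lt_iff] at h2
  obtain ⟨t, htN, htd, hsum⟩ := h2
  obtain ⟨e, he0, hesum⟩ := ENNReal.exists_pos_sum_of_countable' (ε := ENNReal.ofReal (ε / 2))
    hε2.ne' ℕ
  -- choose a ball for each set of the cover that meets `N`
  have hball : ∀ n, (t n ∩ N).Nonempty → ∃ x ∈ t n ∩ N, ∃ r : ℝ, 0 < r ∧ r ≤ δ ∧
      t n ⊆ Metric.ball x r ∧
        ENNReal.ofReal r ^ k ≤ (⨆ _ : (t n).Nonempty, Metric.ediam (t n) ^ (k : ℝ)) + e n := by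
    rintro n ⟨x, hx⟩
    have hne : (t n).Nonempty := ⟨x, hx.1⟩
    have hfin : Metric.ediam (t n) ≠ ⊤ := ((htd n).trans_lt ENNReal.ofReal_lt_top).ne
    have hcont : Tendsto (fun r : ℝ => ENNReal.ofReal r ^ k) (𝓝[>] (Metric.diam (t n)))
        (𝓝 (Metric.ediam (t n) ^ k)) := by
      have hc : Continuous fun r : ℝ => ENNReal.ofReal r ^ k :=
        (ENNReal.continuous_pow k).comp ENNReal.continuous_ofReal
      have := (hc.tendsto (Metric.diam (t n))).mono_left
        (nhdsWithin_le_nhds (s := Ioi (Metric.diam (t n))))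
      rwa [Metric.diam, ENNReal.ofReal_toReal hfin] at this
    have hlt : Metric.ediam (t n) ^ k < Metric.ediam (t n) ^ k + e n :=
      ENNReal.lt_add_right (ENNReal.pow_ne_top hfin) (he0 n).ne'
    have hdδ : Metric.diam (t n) < δ := by
      have : Metric.diam (t n) ≤ δ / 2 := ENNReal.toReal_le_of_le_ofReal (by positivity) (htd n)
      linarith
    obtain ⟨r, ⟨hr1, hr2⟩, hr3⟩ := ((hcont.eventually (gt_mem_nhds hlt)).and
      (Ioo_mem_nhdsGT hdδ)).exists |>.imp fun r hr => And.intro hr.2 hr.1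
    refine ⟨x, hx, r, Metric.diam_nonneg.trans_lt hr1, hr2.le, fun y hy => ?_, ?_⟩
    · exact (Metric.dist_le_diam_of_mem' hfin hy hx.1).trans_lt hr1
    · rw [iSup_pos hne, ENNReal.rpow_natCast]; exact hr3.le
  have hbx : ∀ n, ∃ (x : X) (r : ℝ), (t n ∩ N).Nonempty → x ∈ N ∧ 0 < r ∧ r ≤ δ ∧
      t n ⊆ Metric.ball x r ∧
        ENNReal.ofReal r ^ k ≤ (⨆ _ : (t n).Nonempty, Metric.ediam (t n) ^ (k : ℝ)) + e n := by
    intro n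
    by_cases h : (t n ∩ N).Nonempty
    · obtain ⟨x, hx, r, h'⟩ := hball n h
      exact ⟨x, r, fun _ => ⟨hx.2, h'⟩⟩
    · exact ⟨Classical.arbitrary X, 0, fun h' => absurd h' h⟩
  choose x r hxr using hbx
  classical
  obtain ⟨I, hI⟩ := hN.elim_finite_subcover_image (b := {n | (t n ∩ N).Nonempty})
    (c := fun n => Metric.ball (x n) (r n)) (fun _ _ => Metric.isOpen_ball) (by
      intro y hy
      obtain ⟨n, hn⟩ := mem_iUnion.1 (htN hy)
      have hne : (t n ∩ N).Nonempty := ⟨y, hn, hy⟩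
      exact mem_biUnion hne ((hxr n hne).2.2.2.1 hn))
  obtain ⟨hIsub, hIfin, hIcov⟩ := hI
  refine ⟨hIfin.toFinset, x, r, fun i hi => ?_, by simpa using hIcov, ?_⟩
  · have := hxr i (hIsub (hIfin.mem_toFinset.1 hi))
    exact ⟨this.1, this.2.1, this.2.2.1⟩
  · have hle : ∑ i ∈ hIfin.toFinset, ENNReal.ofReal (r i) ^ k ≤ ENNReal.ofReal ε := by
      calc ∑ i ∈ hIfin.toFinset, ENNReal.ofReal (r i) ^ k
          ≤ ∑ i ∈ hIfin.toFinset,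
              ((⨆ _ : (t i).Nonempty, Metric.ediam (t i) ^ (k : ℝ)) + e i) :=
            Finset.sum_le_sum fun i hi =>
              (hxr i (hIsub (hIfin.mem_toFinset.1 hi))).2.2.2.2
        _ ≤ ∑' i, ((⨆ _ : (t i).Nonempty, Metric.ediam (t i) ^ (k : ℝ)) + e i) :=
            ENNReal.sum_le_tsum _
        _ ≤ ENNReal.ofReal (ε / 2) + ENNReal.ofReal (ε / 2) := by
            rw [ENNReal.tsum_add]; exact add_le_add hsum.le hesum.le
        _ = ENNReal.ofReal ε := by
            rw [← ENNReal.ofReal_add (by positivity) (by positivity)]; ring_nf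
    have hr0 : ∀ i ∈ hIfin.toFinset, 0 ≤ r i := fun i hi =>
      (hxr i (hIsub (hIfin.mem_toFinset.1 hi))).2.1.le
    rw [← ENNReal.ofReal_le_ofReal_iff hε.le, ENNReal.ofReal_sum_of_nonneg fun i hi =>
      pow_nonneg (hr0 i hi) k]
    refine (Finset.sum_le_sum fun i hi => ?_).trans hle
    rw [ENNReal.ofReal_pow (hr0 i hi)]

end NullCover

section Cutoffs

variable {d : ℕ}

/-- There is a cutoff function around a point at scale `r`; its gradient has an integral of the
order of `r ^ (d - 1)`. -/
lemma exists_bump_constant (hd : 1 ≤ d) : ∃ A : ℝ, 0 ≤ A ∧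
    ∀ (x : EuclideanSpace ℝ (Fin d)) (r : ℝ), 0 < r →
      ∃ η : EuclideanSpace ℝ (Fin d) → ℝ, ContDiff ℝ 1 η ∧ (∀ y, η y ∈ Icc (0 : ℝ) 1) ∧
        (∀ y ∈ Metric.ball x r, η y = 1) ∧ (∀ y, 2 * r ≤ dist y x → η y = 0) ∧
        Integrable (fun y => ‖fderiv ℝ η y‖) ∧ ∫ y, ‖fderiv ℝ η y‖ ≤ A * r ^ (d - 1) := by
  let f : ContDiffBump (0 : EuclideanSpace ℝ (Fin d)) := ⟨1, 2, one_pos, one_lt_two⟩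
  have hf : ContDiff ℝ 1 f := f.contDiff
  refine ⟨∫ y, ‖fderiv ℝ f y‖, integral_nonneg fun _ => norm_nonneg _, fun x r hr => ?_⟩
  have hint : Integrable fun y => ‖fderiv ℝ f y‖ :=
    (hf.continuous_fderiv one_ne_zero).norm.integrable_of_hasCompactSupport
      ((f.hasCompactSupport.fderiv ℝ).norm)
  have hder : ∀ y, fderiv ℝ (fun y => f (r⁻¹ • (y - x))) y = r⁻¹ • fderiv ℝ f (r⁻¹ • (y - x)) := by
    intro y
    have h1 := (hf.differentiable one_ne_zero (r⁻¹ • (y - x))).hasFDerivAt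
    have h2 : HasFDerivAt (fun y : EuclideanSpace ℝ (Fin d) => r⁻¹ • (y - x))
        (r⁻¹ • ContinuousLinearMap.id ℝ _) y := ((hasFDerivAt_id y).sub_const x).const_smul r⁻¹
    have h3 := (h1.comp y h2).fderiv
    simp only [Function.comp_def] at h3
    rw [h3]
    ext v; simp
  have hnorm : (fun y => ‖fderiv ℝ (fun y => f (r⁻¹ • (y - x))) y‖)
      = fun y => r⁻¹ * (fun z => ‖fderiv ℝ f (r⁻¹ • z)‖) (y - x) := by
    ext y
    rw [hder, norm_smul, Real.norm_of_nonneg (by positivity)]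
  refine ⟨fun y => f (r⁻¹ • (y - x)), by fun_prop, fun y => ⟨f.nonneg, f.le_one⟩, ?_, ?_, ?_, ?_⟩
  · intro y hy
    apply f.one_of_mem_closedBall
    rw [mem_closedBall_zero_iff, norm_smul, Real.norm_of_nonneg (by positivity),
      inv_mul_le_iff₀ hr, ← dist_eq_norm]
    simpa [f] using (Metric.mem_ball.1 hy).le
  · intro y hy
    apply f.zero_of_le_dist
    rw [dist_zero_right, norm_smul, Real.norm_of_nonneg (by positivity), le_inv_mul_iff₀ hr,
      ← dist_eq_norm]
    simpa [f, mul_comm] using hy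
  · rw [hnorm]
    exact ((hint.comp_smul (inv_ne_zero hr.ne')).comp_sub_right x).const_mul _
  · rw [hnorm, integral_const_mul, integral_sub_right_eq_self (fun z => ‖fderiv ℝ f (r⁻¹ • z)‖) x,
      Measure.integral_comp_inv_smul_of_nonneg volume (fun z => ‖fderiv ℝ f z‖) hr.le,
      finrank_euclideanSpace_fin, smul_eq_mul]
    obtain ⟨k, rfl⟩ : ∃ k, d = k + 1 := ⟨d - 1, by omega⟩
    rw [Nat.add_sub_cancel, pow_succ]
    apply le_of_eq
    field_simp

/-- The product of the functions `1 - η i` vanishes wherever one of the `η i` is one, and its gradient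
is bounded by the sum of their gradients. -/
lemma contDiff_prod_one_sub {E : Type*} [NormedAddCommGroup E] [NormedSpace ℝ E] (I : Finset ℕ)
    (η : ℕ → E → ℝ) (hη : ∀ i ∈ I, ContDiff ℝ 1 (η i)) (hI : ∀ i ∈ I, ∀ y, η i y ∈ Icc (0 : ℝ) 1) :
    ContDiff ℝ 1 (fun y => ∏ i ∈ I, (1 - η i y)) ∧ (∀ y, ∏ i ∈ I, (1 - η i y) ∈ Icc (0 : ℝ) 1) ∧
      ∀ y, ‖fderiv ℝ (fun y => ∏ i ∈ I, (1 - η i y)) y‖ ≤ ∑ i ∈ I, ‖fderiv ℝ (η i) y‖ := by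
  classical
  induction I using Finset.induction_on with
  | empty => simpa using contDiff_const
  | insert a I ha ih =>
    obtain ⟨h1, h2, h3⟩ := ih (fun i hi => hη i (Finset.mem_insert_of_mem hi))
      (fun i hi => hI i (Finset.mem_insert_of_mem hi))
    have ha1 : ContDiff ℝ 1 fun y => 1 - η a y :=
      contDiff_const.sub (hη a (Finset.mem_insert_self a I))
    have ha2 : ∀ y, 1 - η a y ∈ Icc (0 : ℝ) 1 := fun y => by
      have := hI a (Finset.mem_insert_self a I) y
      exact ⟨by linarith [this.2], by linarith [this.1]⟩
    simp only [Finset.prod_insert ha, Finset.sum_insert ha]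
    refine ⟨ha1.mul h1, fun y => ⟨mul_nonneg (ha2 y).1 (h2 y).1,
      mul_le_one₀ (ha2 y).2 (h2 y).1 (h2 y).2⟩, fun y => ?_⟩
    rw [fderiv_fun_mul (ha1.differentiable one_ne_zero y) (h1.differentiable one_ne_zero y)]
    have e1 : fderiv ℝ (fun y => 1 - η a y) y = - fderiv ℝ (η a) y := by
      rw [fderiv_const_sub]
    refine (norm_add_le _ _).trans ?_
    rw [norm_smul, norm_smul, e1, norm_neg, Real.norm_of_nonneg (ha2 y).1,
      Real.norm_of_nonneg (h2 y).1, add_comm]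
    refine add_le_add ?_ ?_
    · exact mul_le_of_le_one_left (norm_nonneg _) (h2 y).2
    · exact (mul_le_of_le_one_left (norm_nonneg _) (ha2 y).2).trans (h3 y)

/-- A compact set of zero `(d - 1)`-dimensional measure has zero capacity for the `W^{1,1}` norm:
it can be cut off by functions with small gradients. -/
lemma exists_cutoff_of_null (hd : 1 ≤ d) {N : Set (EuclideanSpace ℝ (Fin d))} (hN : IsCompact N)
    (hnull : (μHE[d - 1] : Measure (EuclideanSpace ℝ (Fin d))) N = 0) {ε : ℝ} (hε : 0 < ε) :
    ∃ ζ : EuclideanSpace ℝ (Fin d) → ℝ, ContDiff ℝ 1 ζ ∧ (∀ y, ζ y ∈ Icc (0 : ℝ) 1) ∧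
      (∃ U, IsOpen U ∧ N ⊆ U ∧ ∀ y ∈ U, ζ y = 0) ∧ (∀ y, ζ y ≠ 1 → ∃ x ∈ N, dist y x < ε) ∧
      Integrable (fun y => ‖fderiv ℝ ζ y‖) ∧ ∫ y, ‖fderiv ℝ ζ y‖ ≤ ε := by
  obtain ⟨A, hA, hbump⟩ := exists_bump_constant hd
  obtain ⟨I, x, r, hxr, hcov, hsum⟩ := exists_finset_ball_cover hN (d - 1) hnull
    (δ := ε / 2) (ε := ε / (A + 1)) (by positivity) (by positivity)
  have hη' : ∀ i, ∃ η : EuclideanSpace ℝ (Fin d) → ℝ, i ∈ I → ContDiff ℝ 1 η ∧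
      (∀ y, η y ∈ Icc (0 : ℝ) 1) ∧
        (∀ y ∈ Metric.ball (x i) (r i), η y = 1) ∧ (∀ y, 2 * r i ≤ dist y (x i) → η y = 0) ∧
        Integrable (fun y => ‖fderiv ℝ η y‖) ∧ ∫ y, ‖fderiv ℝ η y‖ ≤ A * r i ^ (d - 1) := by
    intro i
    by_cases hi : i ∈ I
    · obtain ⟨η, h⟩ := hbump (x i) (r i) (hxr i hi).2.1
      exact ⟨η, fun _ => h⟩
    · exact ⟨0, fun h => absurd h hi⟩
  choose η hη using hη'
  obtain ⟨h1, h2, h3⟩ := contDiff_prod_one_sub I η (fun i hi => (hη i hi).1)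
    (fun i hi => (hη i hi).2.1)
  have hisum : Integrable fun y => ∑ i ∈ I, ‖fderiv ℝ (η i) y‖ :=
    integrable_finsetSum _ fun i hi => (hη i hi).2.2.2.2.1
  have hint : Integrable fun y => ‖fderiv ℝ (fun y => ∏ i ∈ I, (1 - η i y)) y‖ :=
    hisum.mono' (h1.continuous_fderiv one_ne_zero).norm.aestronglyMeasurable
      (ae_of_all _ fun y => by rw [norm_norm]; exact h3 y)
  refine ⟨_, h1, h2, ⟨⋃ i ∈ I, Metric.ball (x i) (r i),
    isOpen_biUnion fun _ _ => Metric.isOpen_ball, hcov, ?_⟩, ?_, hint, ?_⟩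
  · intro y hy
    obtain ⟨i, hi, hyi⟩ := mem_iUnion₂.1 hy
    refine Finset.prod_eq_zero hi ?_
    rw [(hη i hi).2.2.1 y hyi, sub_self]
  · intro y hy
    by_contra! hfar
    refine hy (Finset.prod_eq_one fun i hi => ?_)
    rw [(hη i hi).2.2.2.1 y, sub_zero]
    have := hfar (x i) (hxr i hi).1
    linarith [(hxr i hi).2.2]
  · calc ∫ y, ‖fderiv ℝ (fun y => ∏ i ∈ I, (1 - η i y)) y‖
        ≤ ∫ y, ∑ i ∈ I, ‖fderiv ℝ (η i) y‖ := integral_mono hint hisum h3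
      _ = ∑ i ∈ I, ∫ y, ‖fderiv ℝ (η i) y‖ :=
          integral_finsetSum _ fun i hi => (hη i hi).2.2.2.2.1
      _ ≤ ∑ i ∈ I, A * r i ^ (d - 1) := Finset.sum_le_sum fun i hi => (hη i hi).2.2.2.2.2
      _ = A * ∑ i ∈ I, r i ^ (d - 1) := by rw [Finset.mul_sum]
      _ ≤ A * (ε / (A + 1)) := by gcongr
      _ ≤ ε := by
          rw [mul_div_assoc', div_le_iff₀ (by positivity)]
          nlinarith

end Cutoffs

/-! ### The Gauss–Green formula -/

section GaussGreen

variable {d : ℕ} {W : Set (EuclideanSpace ℝ (Fin d))}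

/-- **Gauss–Green formula** on a bounded open set with boundary of finite surface measure, smooth up
to a set of zero surface measure, for fields with integrable divergence that are continuous up to
the boundary. -/
theorem integral_divergence_eq (hd : 1 ≤ d) (hb : Bornology.IsBounded W) (hW : IsOpen W)
    (hfin : (μHE[d - 1] : Measure (EuclideanSpace ℝ (Fin d))) (frontier W) < ⊤)
    (hnull : (μHE[d - 1] : Measure (EuclideanSpace ℝ (Fin d)))
      {x ∈ frontier W | ¬ IsSmoothBoundaryPoint W x} = 0)
    {F : EuclideanSpace ℝ (Fin d) → EuclideanSpace ℝ (Fin d)} (hF : IsAdmissible W F) :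
    ∫ x in W, divergence F x =
      ∫ x in frontier W, inner ℝ (F x) (outwardNormal W x) ∂μHE[d - 1] := by
  set N := {x ∈ frontier W | ¬ IsSmoothBoundaryPoint W x} with hN_def
  have hcl := isClosed_nonsmooth hW
  have hfrc : IsCompact (frontier W) :=
    hb.isCompact_closure.of_isClosed_subset isClosed_frontier frontier_subset_closure
  have hN : IsCompact N := hfrc.of_isClosed_subset hcl fun x hx => hx.1
  have hε : ∀ j : ℕ, (0 : ℝ) < 1 / (j + 1) := fun j => Nat.one_div_pos_of_nat
  choose ζ hζ hζI hζ0 hζ1 hζi hζs using fun j : ℕ => exists_cutoff_of_null hd hN hnull (hε j)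
  -- the cutoff functions tend to one off the singular part of the boundary
  have hζlim : ∀ x ∉ N, ∀ᶠ j in atTop, ζ j x = 1 := by
    intro x hx
    obtain ⟨δ, hδ, hball⟩ := Metric.isOpen_iff.1 hcl.isOpen_compl x hx
    have hj : ∀ᶠ j : ℕ in atTop, (1 : ℝ) / (j + 1) < δ :=
      (tendsto_one_div_add_atTop_nhds_zero_nat (𝕜 := ℝ)).eventually (gt_mem_nhds hδ)
    filter_upwards [hj] with j hj
    by_contra h
    obtain ⟨z, hz, hdist⟩ := hζ1 j x h
    exact hball (Metric.mem_ball'.2 (hdist.trans hj)) hz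
  have hcut : ∀ j, (∫ x in W, ζ j x * divergence F x) + ∫ x in W, fderiv ℝ (ζ j) x (F x) =
      ∫ x in frontier W, inner ℝ (ζ j x • F x) (outwardNormal W x) ∂μHE[d - 1] := by
    intro j
    obtain ⟨U, hU, hNU, hU0⟩ := hζ0 j
    rw [← integral_divergence_eq_of_eq_zero_nhds hb hW hfin hnull (hF.smul hb hW (hζ j)) hU hNU
      (fun x _ hx => by rw [hU0 x hx, zero_smul])]
    rw [← integral_add]
    · refine setIntegral_congr_fun hW.measurableSet fun x hx => ?_
      exact (divergence_smul ((hζ j).differentiable one_ne_zero x)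
        ((hF.contDiffOn.contDiffAt (hW.mem_nhds hx)).differentiableAt one_ne_zero)).symm
    · exact Integrable.bdd_mul (c := 1) hF.integrableOn (hζ j).continuous.aestronglyMeasurable
        (ae_of_all _ fun x => by rw [Real.norm_of_nonneg (hζI j x).1]; exact (hζI j x).2)
    · have hc : ContinuousOn (fun x => fderiv ℝ (ζ j) x (F x)) (closure W) :=
        ((hζ j).continuous_fderiv one_ne_zero).continuousOn.clm_apply hF.continuousOn
      exact (hc.integrableOn_compact hb.isCompact_closure).mono_set subset_closure
  have L₁ : Tendsto (fun j => ∫ x in W, ζ j x * divergence F x) atTop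
      (𝓝 (∫ x in W, divergence F x)) := by
    refine tendsto_integral_of_dominated_convergence (fun x => ‖divergence F x‖) (fun j => ?_)
      hF.integrableOn.norm (fun j => ?_) ?_
    · exact (hζ j).continuous.aestronglyMeasurable.mul hF.integrableOn.aestronglyMeasurable
    · refine ae_of_all _ fun x => ?_
      rw [norm_mul, Real.norm_of_nonneg (hζI j x).1]
      exact mul_le_of_le_one_left (norm_nonneg _) (hζI j x).2
    · filter_upwards [ae_restrict_mem hW.measurableSet] with x hx
      have hxN : x ∉ N := fun h => by
        have := h.1
        rw [hW.frontier_eq] at this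
        exact this.2 hx
      refine tendsto_const_nhds.congr' ?_
      filter_upwards [hζlim x hxN] with j hj
      rw [hj, one_mul]
  -- the field is bounded and the gradients of the cutoff functions tend to zero in `L¹`
  have L₂ : Tendsto (fun j => ∫ x in W, fderiv ℝ (ζ j) x (F x)) atTop (𝓝 0) := by
    obtain ⟨M, hM⟩ := hb.isCompact_closure.exists_bound_of_continuousOn hF.continuousOn
    have hM0 : 0 ≤ max M 0 := le_max_right _ _
    have hbd : ∀ j : ℕ, ‖∫ x in W, fderiv ℝ (ζ j) x (F x)‖ ≤ max M 0 * (1 / (j + 1)) := by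
      intro j
      have h1 : ‖∫ x in W, fderiv ℝ (ζ j) x (F x)‖ ≤ ∫ x in W, max M 0 * ‖fderiv ℝ (ζ j) x‖ := by
        refine norm_integral_le_of_norm_le ((hζi j).integrableOn.const_mul _) ?_
        filter_upwards [ae_restrict_mem hW.measurableSet] with x hx
        refine (ContinuousLinearMap.le_opNorm _ _).trans ?_
        rw [mul_comm]
        gcongr
        exact (hM x (subset_closure hx)).trans (le_max_left _ _)
      refine h1.trans ?_
      rw [integral_const_mul]
      gcongr
      exact (setIntegral_le_integral (hζi j) (ae_of_all _ fun _ => norm_nonneg _)).trans (hζs j)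
    refine squeeze_zero_norm hbd ?_
    simpa using (tendsto_one_div_add_atTop_nhds_zero_nat (𝕜 := ℝ)).const_mul (max M 0)
  have L₃ : Tendsto (fun j => ∫ x in frontier W,
      inner ℝ (ζ j x • F x) (outwardNormal W x) ∂μHE[d - 1]) atTop
      (𝓝 (∫ x in frontier W, inner ℝ (F x) (outwardNormal W x) ∂μHE[d - 1])) := by
    have hi := integrableOn_inner_outwardNormal hb hW hfin hnull hF.continuousOn
    simp_rw [inner_smul_left]
    refine tendsto_integral_of_dominated_convergence
      (fun x => ‖(inner ℝ (F x) (outwardNormal W x) : ℝ)‖) (fun j => ?_) hi.norm (fun j => ?_) ?_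
    · exact (hζ j).continuous.aestronglyMeasurable.mul hi.aestronglyMeasurable
    · refine ae_of_all _ fun x => ?_
      rw [norm_mul]
      refine mul_le_of_le_one_left (norm_nonneg _) ?_
      simpa [abs_of_nonneg (hζI j x).1] using (hζI j x).2
    · have hae : ∀ᵐ x ∂(μHE[d - 1] : Measure (EuclideanSpace ℝ (Fin d))).restrict (frontier W),
          x ∉ N := ae_restrict_of_ae (measure_eq_zero_iff_ae_notMem.1 hnull)
      filter_upwards [hae] with x hxN
      refine tendsto_const_nhds.congr' ?_
      filter_upwards [hζlim x hxN] with j hj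
      simp [hj]
  have := L₁.add L₂
  rw [add_zero] at this
  exact tendsto_nhds_unique (this.congr hcut) L₃

end GaussGreen

/-! ### Truncation of unbounded sets -/

section Truncation

variable {d : ℕ} {Ω : Set (EuclideanSpace ℝ (Fin d))}

lemma isOpen_truncated (hΩ : IsOpen Ω) (r : ℝ) : IsOpen (truncated Ω r) :=
  hΩ.inter Metric.isOpen_ball

lemma isBounded_truncated (Ω : Set (EuclideanSpace ℝ (Fin d))) (r : ℝ) :
    Bornology.IsBounded (truncated Ω r) :=
  Metric.isBounded_ball.subset inter_subset_right

lemma frontier_truncated_subset (Ω : Set (EuclideanSpace ℝ (Fin d))) (r : ℝ) :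
    frontier (truncated Ω r) ⊆
      frontier Ω ∩ Metric.closedBall 0 r ∪ closure Ω ∩ Metric.sphere 0 r :=
  (frontier_inter_subset _ _).trans (union_subset_union
    (inter_subset_inter_right _ Metric.closure_ball_subset_closedBall)
    (inter_subset_inter_right _ Metric.frontier_ball_subset_sphere))

lemma isSmoothBoundaryPoint_truncated_of_mem_ball {x : EuclideanSpace ℝ (Fin d)} {r : ℝ}
    (h : IsSmoothBoundaryPoint Ω x) (hx : x ∈ Metric.ball 0 r) :
    IsSmoothBoundaryPoint (truncated Ω r) x := by
  obtain ⟨ρ, h0, hg, U, hU, hxU, hρ, hΩU⟩ := h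
  refine ⟨ρ, h0, hg, U ∩ Metric.ball 0 r, hU.inter Metric.isOpen_ball, ⟨hxU, hx⟩,
    hρ.mono inter_subset_left, fun y hy => ?_⟩
  rw [truncated, mem_inter_iff, hΩU y hy.1]
  exact and_iff_left hy.2

lemma isSmoothBoundaryPoint_truncated_of_mem_sphere (hΩ : IsOpen Ω) {x : EuclideanSpace ℝ (Fin d)}
    {r : ℝ} (hr : 0 < r) (hx : x ∈ Ω) (hxr : x ∈ Metric.sphere 0 r) :
    IsSmoothBoundaryPoint (truncated Ω r) x := by
  have hn : ‖x‖ = r := by simpa using hxr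
  have hgrad : HasGradientAt (fun y : EuclideanSpace ℝ (Fin d) => ‖y‖ ^ 2 - r ^ 2)
      ((2 : ℝ) • x) x := by
    rw [hasGradientAt_iff_hasFDerivAt]
    have := (hasStrictFDerivAt_norm_sq x).hasFDerivAt.sub_const (r ^ 2)
    have e : InnerProductSpace.toDual ℝ (EuclideanSpace ℝ (Fin d)) ((2 : ℝ) • x)
        = 2 • innerSL ℝ x := by
      ext v; simp
    rwa [e]
  refine ⟨fun y => ‖y‖ ^ 2 - r ^ 2, by simp [hn], ?_, Ω, hΩ, hx, ?_, fun y hy => ?_⟩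
  · rw [hgrad.gradient]
    refine smul_ne_zero two_ne_zero ?_
    rw [← norm_pos_iff, hn]; exact hr
  · exact ((contDiff_norm_sq ℝ).sub contDiff_const).contDiffOn
  · rw [truncated, mem_inter_iff, and_iff_right hy, mem_ball_zero_iff, sub_neg,
      sq_lt_sq₀ (norm_nonneg y) hr.le]

lemma nonsmooth_truncated_subset (hΩ : IsOpen Ω) {r : ℝ} (hr : 0 < r) :
    {x ∈ frontier (truncated Ω r) | ¬ IsSmoothBoundaryPoint (truncated Ω r) x} ⊆
      {x ∈ frontier Ω | ¬ IsSmoothBoundaryPoint Ω x} ∪ frontier Ω ∩ Metric.sphere 0 r := by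
  rintro x ⟨hx, hns⟩
  rcases frontier_truncated_subset Ω r hx with ⟨hxΩ, hxr⟩ | ⟨hxΩ, hxr⟩
  · by_cases hxb : x ∈ Metric.ball 0 r
    · exact Or.inl ⟨hxΩ, fun h => hns (isSmoothBoundaryPoint_truncated_of_mem_ball h hxb)⟩
    · refine Or.inr ⟨hxΩ, ?_⟩
      rw [← Metric.closedBall_sdiff_ball]
      exact ⟨hxr, hxb⟩
  · rw [closure_eq_self_union_frontier] at hxΩ
    rcases hxΩ with h | h
    · exact absurd (isSmoothBoundaryPoint_truncated_of_mem_sphere hΩ hr h hxr) hns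
    · exact Or.inr ⟨h, hxr⟩

/-- Spheres have finite surface measure, since they are locally nearly flat graphs. -/
lemma euclideanHausdorffMeasure_sphere_lt_top {r : ℝ} (hr : 0 < r) :
    (μHE[d - 1] : Measure (EuclideanSpace ℝ (Fin d))) (Metric.sphere 0 r) < ⊤ := by
  refine (isCompact_sphere _ _).measure_lt_top_of_nhdsWithin fun x hx => ?_
  obtain ⟨ρ, h⟩ := isSmoothBoundaryPoint_truncated_of_mem_sphere isOpen_univ hr (mem_univ x) hx
  have hfr : frontier (truncated (univ : Set (EuclideanSpace ℝ (Fin d))) r) = Metric.sphere 0 r := by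
    rw [truncated, univ_inter, frontier_ball _ hr.ne']
  obtain ⟨h0, hg, U, hU, hxU, -, hWU⟩ := id h
  obtain ⟨V, hV, hxV, hfin, -⟩ := exists_nhds_abs_divergence_sub_le h.norm_unit (norm_pos_iff.2 hg)
    h.hasStrictFDerivAt h0 (isOpen_truncated isOpen_univ r) hWU (hU.mem_nhds hxU) one_pos
  rw [hfr] at hfin
  exact ⟨_, inter_mem_nhdsWithin _ (hV.mem_nhds hxV), hfin⟩

/-- All but countably many spheres meet the boundary in a set of zero surface measure. -/
lemma countable_sphere_pos (hbd : HasPiecewiseSmoothBoundary Ω) :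
    {r : ℝ | 0 < (μHE[d - 1] : Measure (EuclideanSpace ℝ (Fin d)))
      (frontier Ω ∩ Metric.sphere 0 r)}.Countable := by
  have hdisj : Pairwise (Function.onFun Disjoint fun r : ℝ =>
      Metric.sphere (0 : EuclideanSpace ℝ (Fin d)) r) := by
    intro r s hrs
    refine Set.disjoint_left.2 fun x hx hx' => hrs ?_
    rw [← mem_sphere_zero_iff_norm.1 hx, ← mem_sphere_zero_iff_norm.1 hx']
  have hcount : ∀ R : ℕ, {r : ℝ | 0 < ((μHE[d - 1] : Measure (EuclideanSpace ℝ (Fin d))).restrict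
      (frontier Ω ∩ Metric.closedBall 0 R)) (Metric.sphere 0 r)}.Countable := by
    intro R
    have : IsFiniteMeasure ((μHE[d - 1] : Measure (EuclideanSpace ℝ (Fin d))).restrict
      (frontier Ω ∩ Metric.closedBall 0 R)) := ⟨by
        rw [Measure.restrict_apply_univ]; exact hbd.1 R⟩
    exact Measure.countable_meas_pos_of_disjoint_iUnion
      (fun r => Metric.isClosed_sphere.measurableSet) hdisj
  refine (countable_iUnion hcount).mono fun r hr => ?_
  obtain ⟨R, hR⟩ := exists_nat_ge r
  refine mem_iUnion.2 ⟨R, ?_⟩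
  rw [mem_ofPred_eq, Measure.restrict_apply Metric.isClosed_sphere.measurableSet]
  refine lt_of_lt_of_le hr (measure_mono ?_)
  rintro x ⟨hx, hxr⟩
  exact ⟨hxr, hx, Metric.sphere_subset_closedBall.trans (Metric.closedBall_subset_closedBall hR) hxr⟩

/-- The Gauss–Green formula applies to a sequence of truncations that exhausts the set. -/
lemma exists_seq_truncated (hΩ : IsOpen Ω) (hbd : HasPiecewiseSmoothBoundary Ω) :
    ∃ r : ℕ → ℝ, Tendsto r atTop atTop ∧ ∀ j,
      (μHE[d - 1] : Measure (EuclideanSpace ℝ (Fin d))) (frontier (truncated Ω (r j))) < ⊤ ∧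
      (μHE[d - 1] : Measure (EuclideanSpace ℝ (Fin d)))
        {x ∈ frontier (truncated Ω (r j)) | ¬ IsSmoothBoundaryPoint (truncated Ω (r j)) x} = 0 := by
  have hdense := (countable_sphere_pos hbd).dense_compl ℝ
  have hex : ∀ j : ℕ, ∃ r : ℝ, r ∈ Ioo (j : ℝ) (j + 1) ∧
      (μHE[d - 1] : Measure (EuclideanSpace ℝ (Fin d))) (frontier Ω ∩ Metric.sphere 0 r) = 0 := by
    intro j
    obtain ⟨r, hr, hrj⟩ := hdense.exists_between (show (j : ℝ) < j + 1 by linarith)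
    exact ⟨r, hrj, by simpa using hr⟩
  choose r hr hr0 using hex
  have hpos : ∀ j, 0 < r j := fun j => (Nat.cast_nonneg j).trans_lt (hr j).1
  refine ⟨r, tendsto_atTop_mono (fun j => (hr j).1.le) tendsto_natCast_atTop_atTop,
    fun j => ⟨?_, ?_⟩⟩
  · refine (measure_mono (frontier_truncated_subset Ω (r j))).trans_lt
      (measure_union_lt_top (hbd.1 _) ?_)
    exact (measure_mono inter_subset_right).trans_lt
      (euclideanHausdorffMeasure_sphere_lt_top (hpos j))
  · refine measure_mono_null (nonsmooth_truncated_subset hΩ (hpos j)) ?_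
    exact measure_union_null hbd.2 (hr0 j)

/-- If the flux through the boundary vanishes, then so does the integral of the divergence. -/
theorem integral_divergence_eq_zero (hd : 1 ≤ d) (hΩ : IsOpen Ω)
    (hbd : HasPiecewiseSmoothBoundary Ω)
    {F : EuclideanSpace ℝ (Fin d) → EuclideanSpace ℝ (Fin d)} {g : EuclideanSpace ℝ (Fin d) → ℝ}
    (u : EuclideanSpace ℝ (Fin d)) (hF : ContDiffOn ℝ 1 F Ω) (hg : ContDiffOn ℝ 1 g Ω)
    (hFf : VectorFluxVanishes Ω F) (hgf : ScalarFluxVanishes Ω g)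
    (hint : IntegrableOn (divergence fun x => F x + g x • u) Ω) :
    ∫ x in Ω, divergence (fun x => F x + g x • u) x = 0 := by
  obtain ⟨A, hA, hAF, hAlim⟩ := hFf
  obtain ⟨B, hB, hBg, hBlim⟩ := hgf
  obtain ⟨r, hr, hgood⟩ := exists_seq_truncated hΩ hbd
  have hsub : ∀ j, truncated Ω (r j) ⊆ Ω := fun j => inter_subset_left
  have hcl : ∀ j, closure (truncated Ω (r j)) ⊆ closure Ω := fun j => closure_mono (hsub j)
  have heq : EqOn (fun x => A x + B x • u) (fun x => F x + g x • u) Ω := fun x hx => by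
    simp only [hAF hx, hBg hx]
  have hdiv : EqOn (divergence fun x => A x + B x • u) (divergence fun x => F x + g x • u) Ω :=
    fun x hx => divergence_congr (heq.eventuallyEq_of_mem (hΩ.mem_nhds hx))
  have hC1 : ContDiffOn ℝ 1 (fun x => A x + B x • u) Ω :=
    (hF.add (hg.smul contDiffOn_const)).congr heq
  have hcont : ContinuousOn (fun x => A x + B x • u) (closure Ω) :=
    hA.add (hB.smul continuousOn_const)
  have hadm : ∀ j, IsAdmissible (truncated Ω (r j)) fun x => A x + B x • u := fun j =>
    ⟨hcont.mono (hcl j), hC1.mono (hsub j),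
      ((integrableOn_congr_fun hdiv hΩ.measurableSet).2 hint).mono_set (hsub j)⟩
  have hflux : ∀ j, ∫ x in truncated Ω (r j), divergence (fun x => F x + g x • u) x =
      (∫ y in frontier (truncated Ω (r j)),
        inner ℝ (A y) (outwardNormal (truncated Ω (r j)) y) ∂μHE[d - 1]) +
      inner ℝ u (∫ y in frontier (truncated Ω (r j)),
        B y • outwardNormal (truncated Ω (r j)) y ∂μHE[d - 1]) := by
    intro j
    have hb := isBounded_truncated Ω (r j)
    have hW := isOpen_truncated hΩ (r j)
    obtain ⟨hfin, hnull⟩ := hgood j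
    rw [← setIntegral_congr_fun hW.measurableSet (hdiv.mono (hsub j)),
      integral_divergence_eq hd hb hW hfin hnull (hadm j),
      ← integral_inner (integrableOn_smul_outwardNormal hb hW hfin hnull (hB.mono (hcl j))),
      ← integral_add (integrableOn_inner_outwardNormal hb hW hfin hnull (hA.mono (hcl j)))
        ((integrableOn_smul_outwardNormal hb hW hfin hnull (hB.mono (hcl j))).const_inner u)]
    congr 1 with y
    rw [inner_add_left, inner_smul_left, inner_smul_right]
    rfl
  have L₁ : Tendsto (fun j => ∫ x in truncated Ω (r j), divergence (fun x => F x + g x • u) x) atTop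
      (𝓝 (∫ x in Ω, divergence (fun x => F x + g x • u) x)) := by
    have := (aecover_ball (μ := volume.restrict Ω) (x := 0) hr).integral_tendsto_of_countably_generated
      hint
    refine this.congr fun j => ?_
    rw [Measure.restrict_restrict Metric.isOpen_ball.measurableSet, inter_comm]
    rfl
  have L₂ := (hAlim.comp hr).add (Tendsto.inner (𝕜 := ℝ) (tendsto_const_nhds (x := u)) (hBlim.comp hr))
  rw [inner_zero_right, add_zero] at L₂
  refine tendsto_nhds_unique L₁ (L₂.congr fun j => ?_)
  rw [hflux j]
  rfl

end Truncation

/-! ### Differentiability of the feature map -/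

section FeatureMap

variable {E V : Type*} [NormedAddCommGroup E] [NormedSpace ℝ E]
  [NormedAddCommGroup V] [InnerProductSpace ℝ V]

/-- Mixed second differences of a twice continuously differentiable function of two variables are
approximated by its mixed second derivative. -/
lemma exists_mixed_difference_estimate {K : E × E → ℝ} {x : E} (hK : ContDiffAt ℝ 2 K (x, x))
    {ε : ℝ} (hε : 0 < ε) :
    ∃ δ > 0, ∀ v w : E, ‖v‖ < δ → ‖w‖ < δ →
      |K (x + v, x + w) - K (x + v, x) - K (x, x + w) + K (x, x)
        - fderiv ℝ (fderiv ℝ K) (x, x) (v, 0) (0, w)| ≤ ε * ‖v‖ * ‖w‖ := by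
  have h1 : ContDiffAt ℝ 1 (fderiv ℝ K) (x, x) := hK.fderiv_right (by norm_num)
  have hs := (hasStrictFDerivAt_iff_isLittleO.1
    (h1.hasStrictFDerivAt one_ne_zero)).def hε
  have hd : ∀ᶠ p in 𝓝 (x, x), DifferentiableAt ℝ K p := by
    filter_upwards [hK.eventually (by simp)] with p hp using hp.differentiableAt two_ne_zero
  rw [nhds_prod_eq] at hs
  obtain ⟨δ₁, hδ₁, hs'⟩ := (Metric.nhds_basis_ball.prod_self.eventually_iff).1 hs
  obtain ⟨δ₂, hδ₂, hd'⟩ := Metric.eventually_nhds_iff_ball.1 hd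
  refine ⟨min δ₁ δ₂, lt_min hδ₁ hδ₂, fun v w hv hw => ?_⟩
  have hmem : ∀ v w : E, ‖v‖ < min δ₁ δ₂ → ‖w‖ < min δ₁ δ₂ →
      (x + v, x + w) ∈ Metric.ball (x, x) δ₁ ∧ (x + v, x + w) ∈ Metric.ball (x, x) δ₂ := by
    intro v w hv hw
    have : dist (x + v, x + w) (x, x) < min δ₁ δ₂ := by
      simp [dist_eq_norm] at hv hw ⊢
      tauto
    exact ⟨this.trans_le (min_le_left _ _), this.trans_le (min_le_right _ _)⟩
  have h0 : ‖(0 : E)‖ < min δ₁ δ₂ := by rw [norm_zero]; exact lt_min hδ₁ hδ₂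
  set B := fderiv ℝ (fderiv ℝ K) (x, x)
  let g : E → ℝ := fun z => K (x + v, x + z) - K (x, x + z) - B (v, 0) (0, z)
  have hg : ∀ z ∈ Metric.ball (0 : E) (min δ₁ δ₂), HasFDerivWithinAt g
      ((fderiv ℝ K (x + v, x + z) - fderiv ℝ K (x, x + z) - B (v, 0)).comp
        (ContinuousLinearMap.inr ℝ E E)) (Metric.ball 0 (min δ₁ δ₂)) z := by
    intro z hz
    have hz' : ‖z‖ < min δ₁ δ₂ := by simpa using hz
    have hin : ∀ a : E, HasFDerivAt (fun z : E => (a, x + z)) (ContinuousLinearMap.inr ℝ E E) z := by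
      intro a
      have := (hasFDerivAt_const (𝕜 := ℝ) a z).prodMk ((hasFDerivAt_id (𝕜 := ℝ) z).const_add x)
      exact this
    have k1 := (hd' _ (hmem v z hv hz').2).hasFDerivAt.comp z (hin (x + v))
    have k2' := (hd' _ (hmem 0 z h0 hz').2).hasFDerivAt
    rw [add_zero] at k2'
    have k2 := k2'.comp z (hin x)
    have k3 : HasFDerivAt (fun z : E => B (v, 0) (0, z))
        ((B (v, 0)).comp (ContinuousLinearMap.inr ℝ E E)) z :=
      ((B (v, 0)).comp (ContinuousLinearMap.inr ℝ E E)).hasFDerivAt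
    rw [ContinuousLinearMap.sub_comp, ContinuousLinearMap.sub_comp]
    exact ((k1.sub k2).sub k3).hasFDerivWithinAt
  have hbound : ∀ z ∈ Metric.ball (0 : E) (min δ₁ δ₂),
      ‖(fderiv ℝ K (x + v, x + z) - fderiv ℝ K (x, x + z) - B (v, 0)).comp
        (ContinuousLinearMap.inr ℝ E E)‖ ≤ ε * ‖v‖ := by
    intro z hz
    have hz' : ‖z‖ < min δ₁ δ₂ := by simpa using hz
    have m2 := (hmem 0 z h0 hz').1
    rw [add_zero] at m2
    have h := hs' (show ((x + v, x + z), (x, x + z)) ∈ _ from ⟨(hmem v z hv hz').1, m2⟩)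
    have e : (x + v, x + z) - (x, x + z) = ((v, 0) : E × E) := by simp
    simp only [e] at h
    have e2 : ‖((v, 0) : E × E)‖ = ‖v‖ := by simp [Prod.norm_def]
    rw [e2] at h
    refine (ContinuousLinearMap.opNorm_comp_le _ _).trans ?_
    exact (mul_le_of_le_one_right (norm_nonneg _) (ContinuousLinearMap.norm_inr_le_one ℝ E E)).trans h
  have key := (convex_ball (0 : E) (min δ₁ δ₂)).norm_image_sub_le_of_norm_hasFDerivWithin_le hg
    hbound (Metric.mem_ball_self (lt_min hδ₁ hδ₂)) (by simpa using hw : w ∈ Metric.ball 0 (min δ₁ δ₂))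
  rw [sub_zero, Real.norm_eq_abs] at key
  refine (le_of_eq ?_).trans key
  congr 1
  simp only [g, add_zero]
  have : B (v, 0) ((0 : E), (0 : E)) = 0 := by
    rw [show ((0 : E), (0 : E)) = 0 from rfl, map_zero]
  rw [this]
  ring

variable [CompleteSpace V]

/-- The difference quotients of the feature map of a twice continuously differentiable kernel form
Cauchy sequences. -/
lemma exists_tendsto_difference_quotient {κ : E → V} {x : E}
    (hK : ContDiffAt ℝ 2 (fun p : E × E => inner ℝ (κ p.1) (κ p.2)) (x, x)) (e : E) :
    ∃ a : V, Tendsto (fun n : ℕ => ((n : ℝ) + 1) • (κ (x + ((n : ℝ) + 1)⁻¹ • e) - κ x)) atTop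
      (𝓝 a) := by
  refine cauchySeq_tendsto_of_complete (Metric.cauchySeq_iff.2 fun η hη => ?_)
  set B := fderiv ℝ (fderiv ℝ fun p : E × E => inner ℝ (κ p.1) (κ p.2)) (x, x) (e, 0) (0, e)
    with hB
  obtain ⟨ε, hε, hεη⟩ : ∃ ε > 0, 4 * (ε * ‖e‖ * ‖e‖) < η ^ 2 := by
    refine ⟨η ^ 2 / (8 * (1 + ‖e‖ * ‖e‖)), by positivity, ?_⟩
    have : 0 < 8 * (1 + ‖e‖ * ‖e‖) := by positivity
    rw [mul_assoc, div_mul_eq_mul_div, mul_div_assoc', div_lt_iff₀ this]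
    have : 0 < η ^ 2 := by positivity
    nlinarith [mul_nonneg (norm_nonneg e) (norm_nonneg e)]
  obtain ⟨δ, hδ, hest⟩ := exists_mixed_difference_estimate hK hε
  have hsmall : ∀ᶠ n : ℕ in atTop, ‖((n : ℝ) + 1)⁻¹ • e‖ < δ := by
    have : Tendsto (fun n : ℕ => ((n : ℝ) + 1)⁻¹ • e) atTop (𝓝 ((0 : ℝ) • e)) := by
      have h := tendsto_one_div_add_atTop_nhds_zero_nat (𝕜 := ℝ)
      simp only [one_div] at h
      exact h.smul_const e
    rw [zero_smul] at this
    simpa using this.norm.eventually (gt_mem_nhds (by simpa using hδ))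
  obtain ⟨N, hN⟩ := eventually_atTop.1 hsmall
  refine ⟨N, fun m hm n hn => ?_⟩
  have hq : ∀ p q : ℕ, N ≤ p → N ≤ q →
      |inner ℝ (((p : ℝ) + 1) • (κ (x + ((p : ℝ) + 1)⁻¹ • e) - κ x))
        (((q : ℝ) + 1) • (κ (x + ((q : ℝ) + 1)⁻¹ • e) - κ x)) - B| ≤ ε * ‖e‖ * ‖e‖ := by
    intro p q hp hq
    have h := hest _ _ (hN p hp) (hN q hq)
    have hp0 : (0 : ℝ) < (p : ℝ) + 1 := by positivity
    have hq0 : (0 : ℝ) < (q : ℝ) + 1 := by positivity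
    have e1 : ((((p : ℝ) + 1)⁻¹ • e, 0) : E × E) = ((p : ℝ) + 1)⁻¹ • (e, 0) := by simp
    have e2 : ((0, ((q : ℝ) + 1)⁻¹ • e) : E × E) = ((q : ℝ) + 1)⁻¹ • (0, e) := by simp
    rw [e1, e2, map_smul, map_smul, _root_.smul_apply, ← hB, norm_smul, norm_smul,
      Real.norm_of_nonneg (by positivity), Real.norm_of_nonneg (by positivity)] at h
    have hfac : inner ℝ (((p : ℝ) + 1) • (κ (x + ((p : ℝ) + 1)⁻¹ • e) - κ x))
        (((q : ℝ) + 1) • (κ (x + ((q : ℝ) + 1)⁻¹ • e) - κ x)) - B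
        = ((p : ℝ) + 1) * ((q : ℝ) + 1) *
          (inner ℝ (κ (x + ((p : ℝ) + 1)⁻¹ • e)) (κ (x + ((q : ℝ) + 1)⁻¹ • e))
            - inner ℝ (κ (x + ((p : ℝ) + 1)⁻¹ • e)) (κ x)
            - inner ℝ (κ x) (κ (x + ((q : ℝ) + 1)⁻¹ • e)) + inner ℝ (κ x) (κ x)
            - ((q : ℝ) + 1)⁻¹ • ((p : ℝ) + 1)⁻¹ • B) := by
      simp only [inner_smul_left, inner_smul_right, inner_sub_left, inner_sub_right, smul_eq_mul,
        conj_trivial]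
      field_simp
      ring
    rw [hfac, abs_mul, abs_of_pos (by positivity)]
    calc ((p : ℝ) + 1) * ((q : ℝ) + 1) * _
        ≤ ((p : ℝ) + 1) * ((q : ℝ) + 1) *
          (ε * (((p : ℝ) + 1)⁻¹ * ‖e‖) * (((q : ℝ) + 1)⁻¹ * ‖e‖)) := by gcongr
      _ = ε * ‖e‖ * ‖e‖ := by field_simp
  have h1 := abs_le.1 (hq m m hm hm)
  have h2 := abs_le.1 (hq m n hm hn)
  have h3 := abs_le.1 (hq n n hn hn)
  rw [dist_eq_norm]
  refine lt_of_pow_lt_pow_left₀ 2 hη.le ?_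
  rw [norm_sub_sq_real, ← real_inner_self_eq_norm_sq, ← real_inner_self_eq_norm_sq]
  linarith [h1.1, h1.2, h2.1, h2.2, h3.1, h3.2]

/-- The feature map of a twice continuously differentiable kernel is differentiable. -/
theorem differentiableAt_of_contDiffAt_inner [FiniteDimensional ℝ E] {κ : E → V} {x : E}
    (hK : ContDiffAt ℝ 2 (fun p : E × E => inner ℝ (κ p.1) (κ p.2)) (x, x)) :
    DifferentiableAt ℝ κ x := by
  set B := fderiv ℝ (fderiv ℝ fun p : E × E => inner ℝ (κ p.1) (κ p.2)) (x, x) with hB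
  choose a ha using exists_tendsto_difference_quotient hK
  have hto : ∀ e : E, Tendsto (fun n : ℕ => ((n : ℝ) + 1)⁻¹ • e) atTop (𝓝 0) := by
    intro e
    have h := tendsto_one_div_add_atTop_nhds_zero_nat (𝕜 := ℝ)
    simp only [one_div] at h
    simpa using h.smul_const e
  -- inner products of the candidate derivative with increments of the feature map
  have hincr : ∀ ε > 0, ∃ δ > 0, ∀ v w : E, ‖w‖ < δ →
      |inner ℝ (a v) (κ (x + w) - κ x) - B (v, 0) (0, w)| ≤ ε * ‖v‖ * ‖w‖ := by
    intro ε hε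
    obtain ⟨δ, hδ, hest⟩ := exists_mixed_difference_estimate hK hε
    refine ⟨δ, hδ, fun v w hw => ?_⟩
    have hlim : Tendsto (fun n : ℕ =>
        |inner ℝ (((n : ℝ) + 1) • (κ (x + ((n : ℝ) + 1)⁻¹ • v) - κ x)) (κ (x + w) - κ x)
          - B (v, 0) (0, w)|) atTop (𝓝 |inner ℝ (a v) (κ (x + w) - κ x) - B (v, 0) (0, w)|) :=
      (((ha v).inner tendsto_const_nhds).sub_const _).abs
    refine le_of_tendsto hlim ?_
    filter_upwards [(hto v).norm.eventually (gt_mem_nhds (by simpa using hδ))] with n hn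
    have h := hest _ w hn hw
    have hn0 : (0 : ℝ) < (n : ℝ) + 1 := by positivity
    have e1 : ((((n : ℝ) + 1)⁻¹ • v, 0) : E × E) = ((n : ℝ) + 1)⁻¹ • (v, 0) := by simp
    rw [e1, map_smul, _root_.smul_apply, norm_smul,
      Real.norm_of_nonneg (by positivity)] at h
    have hfac : inner ℝ (((n : ℝ) + 1) • (κ (x + ((n : ℝ) + 1)⁻¹ • v) - κ x)) (κ (x + w) - κ x)
          - B (v, 0) (0, w) = ((n : ℝ) + 1) *
          (inner ℝ (κ (x + ((n : ℝ) + 1)⁻¹ • v)) (κ (x + w))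
            - inner ℝ (κ (x + ((n : ℝ) + 1)⁻¹ • v)) (κ x)
            - inner ℝ (κ x) (κ (x + w)) + inner ℝ (κ x) (κ x)
            - ((n : ℝ) + 1)⁻¹ • B (v, 0) (0, w)) := by
      simp only [inner_smul_left, inner_sub_left, inner_sub_right, smul_eq_mul, conj_trivial]
      field_simp
      ring
    rw [hfac, abs_mul, abs_of_pos hn0]
    calc ((n : ℝ) + 1) * _ ≤ ((n : ℝ) + 1) * (ε * (((n : ℝ) + 1)⁻¹ * ‖v‖) * ‖w‖) := by gcongr
      _ = ε * ‖v‖ * ‖w‖ := by field_simp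
  have hinner : ∀ v w : E, inner ℝ (a v) (a w) = B (v, 0) (0, w) := by
    intro v w
    have hε : ∀ ε > 0, |inner ℝ (a v) (a w) - B (v, 0) (0, w)| ≤ ε * (‖v‖ * ‖w‖) := by
      intro ε hε
      obtain ⟨δ, hδ, hest⟩ := hincr ε hε
      have hlim : Tendsto (fun n : ℕ =>
          |inner ℝ (a v) (((n : ℝ) + 1) • (κ (x + ((n : ℝ) + 1)⁻¹ • w) - κ x))
            - B (v, 0) (0, w)|) atTop (𝓝 |inner ℝ (a v) (a w) - B (v, 0) (0, w)|) :=
        ((tendsto_const_nhds.inner (ha w)).sub_const _).abs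
      refine le_of_tendsto hlim ?_
      filter_upwards [(hto w).norm.eventually (gt_mem_nhds (by simpa using hδ))] with n hn
      have h := hest v _ hn
      have hn0 : (0 : ℝ) < (n : ℝ) + 1 := by positivity
      have e1 : ((0, ((n : ℝ) + 1)⁻¹ • w) : E × E) = ((n : ℝ) + 1)⁻¹ • (0, w) := by simp
      rw [e1, map_smul, norm_smul, Real.norm_of_nonneg (by positivity), smul_eq_mul] at h
      rw [inner_smul_right]
      have hfac : ((n : ℝ) + 1) * inner ℝ (a v) (κ (x + ((n : ℝ) + 1)⁻¹ • w) - κ x)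
          - B (v, 0) (0, w) = ((n : ℝ) + 1) *
          (inner ℝ (a v) (κ (x + ((n : ℝ) + 1)⁻¹ • w) - κ x)
            - ((n : ℝ) + 1)⁻¹ * B (v, 0) (0, w)) := by field_simp
      rw [hfac, abs_mul, abs_of_pos hn0]
      calc ((n : ℝ) + 1) * _ ≤ ((n : ℝ) + 1) * (ε * ‖v‖ * (((n : ℝ) + 1)⁻¹ * ‖w‖)) := by gcongr
        _ = ε * (‖v‖ * ‖w‖) := by field_simp
    have hlim : Tendsto (fun ε : ℝ => ε * (‖v‖ * ‖w‖)) (𝓝[>] 0) (𝓝 0) := by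
      have : Continuous fun ε : ℝ => ε * (‖v‖ * ‖w‖) := by fun_prop
      simpa using (this.tendsto 0).mono_left nhdsWithin_le_nhds
    have := ge_of_tendsto hlim (by filter_upwards [self_mem_nhdsWithin] with ε h using hε ε h)
    exact sub_eq_zero.1 (abs_nonpos_iff.1 this)
  -- linearity follows from the bilinearity of the inner products
  have hadd : ∀ v w, a (v + w) = a v + a w := by
    intro v w
    rw [← sub_eq_zero, ← inner_self_eq_zero (𝕜 := ℝ)]
    have b1 : ∀ v w : E, ((v + w, 0) : E × E) = (v, 0) + (w, 0) := fun v w => by simp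
    have b2 : ∀ v w : E, ((0, v + w) : E × E) = (0, v) + (0, w) := fun v w => by simp
    simp only [inner_sub_left, inner_sub_right, inner_add_left, inner_add_right, hinner, b1, b2,
      map_add, _root_.add_apply]
    ring
  have hsmul : ∀ (c : ℝ) v, a (c • v) = c • a v := by
    intro c v
    rw [← sub_eq_zero, ← inner_self_eq_zero (𝕜 := ℝ)]
    have b1 : ∀ (c : ℝ) (v : E), ((c • v, 0) : E × E) = c • (v, 0) := fun c v => by simp
    have b2 : ∀ (c : ℝ) (v : E), ((0, c • v) : E × E) = c • (0, v) := fun c v => by simp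
    simp only [inner_sub_left, inner_sub_right, inner_smul_left, inner_smul_right, hinner, b1, b2,
      map_smul, _root_.smul_apply, smul_eq_mul, conj_trivial]
    ring
  let A : E →L[ℝ] V := LinearMap.toContinuousLinearMap
    { toFun := a, map_add' := hadd, map_smul' := fun c v => by simpa using hsmul c v }
  have hA : ∀ v, A v = a v := fun v => rfl
  refine HasFDerivAt.differentiableAt (f' := A) (hasFDerivAt_iff_isLittleO_nhds_zero.2 ?_)
  refine Asymptotics.isLittleO_iff.2 fun c hc => ?_
  have hε : 0 < c ^ 2 / 3 := by positivity
  obtain ⟨δ₁, hδ₁, h₁⟩ := exists_mixed_difference_estimate hK hε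
  obtain ⟨δ₂, hδ₂, h₂⟩ := hincr _ hε
  filter_upwards [Metric.ball_mem_nhds (0 : E) (lt_min hδ₁ hδ₂)] with v hv
  have hv' : ‖v‖ < min δ₁ δ₂ := by simpa using hv
  have k₁ := abs_le.1 (h₁ v v (hv'.trans_le (min_le_left _ _)) (hv'.trans_le (min_le_left _ _)))
  have k₂ := abs_le.1 (h₂ v v (hv'.trans_le (min_le_right _ _)))
  refine (sq_le_sq₀ (norm_nonneg _) (by positivity)).1 ?_
  have e1 : ‖κ (x + v) - κ x - A v‖ ^ 2 = inner ℝ (κ (x + v)) (κ (x + v))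
      - inner ℝ (κ (x + v)) (κ x) - inner ℝ (κ x) (κ (x + v)) + inner ℝ (κ x) (κ x)
      - 2 * inner ℝ (a v) (κ (x + v) - κ x) + B (v, 0) (0, v) := by
    rw [norm_sub_sq_real, ← real_inner_self_eq_norm_sq, ← real_inner_self_eq_norm_sq, hA, hinner,
      real_inner_comm (a v)]
    simp only [inner_sub_left, inner_sub_right]
    ring
  rw [e1]
  nlinarith [k₁.1, k₁.2, k₂.1, k₂.2]

end FeatureMap

/-! ### Mean functionals with a null representer -/

section MeanZero

/-- If the functions `⟪ξ x, φ⟫` are integrable, their integral is a bounded functional of `φ` by the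
closed graph theorem. If its representer, tested against `ξ x`, vanishes for almost all `x`, then it
is a function of the family with integral zero, so that its norm is zero. -/
theorem integral_inner_eq_zero {α V : Type*} [MeasurableSpace α] {ν : Measure α}
    [NormedAddCommGroup V] [InnerProductSpace ℝ V] [CompleteSpace V] {ξ : α → V}
    (hint : ∀ φ, Integrable (fun x => inner ℝ (ξ x) φ) ν)
    (h0 : ∀ᵐ x ∂ν, ∫ y, inner ℝ (ξ y) (ξ x) ∂ν = 0) (φ : V) : ∫ x, inner ℝ (ξ x) φ ∂ν = 0 := by
  let T : V →ₗ[ℝ] (α →₁[ν] ℝ) :=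
    { toFun := fun φ => (hint φ).toL1 _
      map_add' := fun φ χ => by
        rw [← Integrable.toL1_add]
        congr 1
        ext x
        simp [inner_add_right]
      map_smul' := fun c φ => by
        rw [RingHom.id_apply, ← Integrable.toL1_smul]
        congr 1
        ext x
        simp [inner_smul_right] }
  -- limits in `L¹` and pointwise limits agree along a subsequence, so that the graph is closed
  have hT : Continuous T := by
    refine T.continuous_of_seq_closed_graph fun u φ g hu hg => ?_
    have hmeas : TendstoInMeasure ν (fun n => ⇑(T (u n))) atTop g :=
      tendstoInMeasure_of_tendsto_Lp hg
    obtain ⟨ns, hns, hlim⟩ := hmeas.exists_seq_tendsto_ae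
    have hae : ∀ᵐ x ∂ν, ∀ n, T (u n) x = inner ℝ (ξ x) (u n) :=
      ae_all_iff.2 fun n => (hint (u n)).coeFn_toL1
    refine Lp.ext ?_
    filter_upwards [hlim, hae, (hint φ).coeFn_toL1] with x h1 h2 h3
    have h4 : Tendsto (fun i => T (u (ns i)) x) atTop (𝓝 (inner ℝ (ξ x) φ)) := by
      simp_rw [h2]
      exact tendsto_const_nhds.inner (hu.comp hns.tendsto_atTop)
    rw [tendsto_nhds_unique h1 h4]
    exact h3.symm
  let ℓ : V →L[ℝ] ℝ := L1.integralCLM.comp ⟨T, hT⟩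
  have hℓ : ∀ φ, ℓ φ = ∫ x, inner ℝ (ξ x) φ ∂ν := by
    intro φ
    change L1.integralCLM ((hint φ).toL1 _) = _
    rw [← L1.integral_eq, ← integral_eq]
  set Λ := (InnerProductSpace.toDual ℝ V).symm ℓ
  have hΛ : ∀ φ, inner ℝ Λ φ = ∫ x, inner ℝ (ξ x) φ ∂ν := by
    intro φ
    rw [InnerProductSpace.toDual_symm_apply, hℓ]
  have hzero : Λ = 0 := by
    rw [← inner_self_eq_zero (𝕜 := ℝ), hΛ]
    refine integral_eq_zero_of_ae ?_
    filter_upwards [h0] with x hx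
    rw [Pi.zero_apply, real_inner_comm, hΛ, hx]
  rw [← hΛ, hzero, inner_zero_left]

end MeanZero

/-! ### The Stein kernel as a Gram matrix -/

section Gradient

variable {d : ℕ}

lemma gradient_apply (f : EuclideanSpace ℝ (Fin d) → ℝ) (x : EuclideanSpace ℝ (Fin d))
    (i : Fin d) : gradient f x i = fderiv ℝ f x (EuclideanSpace.single i 1) := by
  have h : inner ℝ (gradient f x) (EuclideanSpace.single i (1 : ℝ)) =
      fderiv ℝ f x (EuclideanSpace.single i 1) := by
    rw [gradient, InnerProductSpace.toDual_symm_apply]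
  rw [← h, EuclideanSpace.inner_single_right, one_mul]
  rfl

lemma score_apply_mul {π : EuclideanSpace ℝ (Fin d) → ℝ} {x : EuclideanSpace ℝ (Fin d)}
    (hd : DifferentiableAt ℝ π x) (hx : π x ≠ 0) (i : Fin d) :
    score π x i * π x = fderiv ℝ π x (EuclideanSpace.single i 1) := by
  rw [score, gradient_apply, fderiv.log hd hx, _root_.smul_apply, smul_eq_mul]
  field_simp

end Gradient

section Feature

variable {d : ℕ} {Ω : Set (EuclideanSpace ℝ (Fin d))}
  (H : Type*) [NormedAddCommGroup H] [InnerProductSpace ℝ H] [CompleteSpace H] [RKHS ℝ H Ω ℝ]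

open Classical in
/-- The canonical feature map `x ↦ k(x, ·)` into the reproducing kernel Hilbert space, extended by
zero outside `Ω`. -/
noncomputable def featureMap (x : EuclideanSpace ℝ (Fin d)) : H :=
  if h : x ∈ Ω then RKHS.kerFun H (⟨x, h⟩ : Ω) (1 : ℝ) else 0

lemma kernelFun_eq_inner (x x' : EuclideanSpace ℝ (Fin d)) :
    kernelFun H x x' = inner ℝ (featureMap H x) (featureMap H x') := by
  by_cases h : x ∈ Ω
  · by_cases h' : x' ∈ Ω
    · rw [kernelFun, dif_pos ⟨h, h'⟩, featureMap, featureMap, dif_pos h, dif_pos h',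
        RKHS.kerFun_inner, RKHS.kerFun_apply]
      simp
    · rw [kernelFun, dif_neg (fun h0 => h' h0.2), featureMap, featureMap, dif_neg h',
        inner_zero_right]
  · rw [kernelFun, dif_neg (fun h0 => h h0.1), featureMap, dif_neg h, inner_zero_left]

variable {H}

lemma inner_featureMap {x : EuclideanSpace ℝ (Fin d)} (hx : x ∈ Ω) (φ : H) :
    inner ℝ (featureMap H x) φ = (φ : Ω → ℝ) ⟨x, hx⟩ := by
  rw [featureMap, dif_pos hx, RKHS.kerFun_inner]
  simp

lemma extend_eq_inner (φ : H) :
    Function.extend Subtype.val (φ : Ω → ℝ) 0 = fun y => inner ℝ (featureMap H y) φ := by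
  ext y
  by_cases hy : y ∈ Ω
  · rw [inner_featureMap hy]
    exact Subtype.val_injective.extend_apply (φ : Ω → ℝ) 0 ⟨y, hy⟩
  · rw [Function.extend_apply', featureMap, dif_neg hy, inner_zero_left, Pi.zero_apply]
    rintro ⟨a, rfl⟩
    exact hy a.2

variable (H) in
/-- The representer of `φ ↦ ∇ · φ(x) + φ(x) · u(x)` in `H^d`: its components are the derivatives of
the feature map, shifted by the score. -/
noncomputable def steinFeature (π : EuclideanSpace ℝ (Fin d) → ℝ) (x : EuclideanSpace ℝ (Fin d)) :
    PiLp 2 fun _ : Fin d => H :=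
  WithLp.toLp 2 fun i =>
    fderiv ℝ (featureMap H) x (EuclideanSpace.single i 1) + score π x i • featureMap H x

lemma differentiableAt_featureMap (hΩ : IsOpen Ω)
    (hk : ContDiffOn ℝ 2 (fun q : EuclideanSpace ℝ (Fin d) × EuclideanSpace ℝ (Fin d) =>
      kernelFun H q.1 q.2) (Ω ×ˢ Ω)) {x : EuclideanSpace ℝ (Fin d)} (hx : x ∈ Ω) :
    DifferentiableAt ℝ (featureMap H) x := by
  simp only [kernelFun_eq_inner] at hk
  exact differentiableAt_of_contDiffAt_inner
    (hk.contDiffAt ((hΩ.prod hΩ).mem_nhds ⟨hx, hx⟩))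

lemma controlFunctional_eq_inner {π : EuclideanSpace ℝ (Fin d) → ℝ} (x : Ω)
    (hx : DifferentiableAt ℝ (featureMap H) x) (φ : PiLp 2 fun _ : Fin d => H) :
    controlFunctional π φ x = inner ℝ (steinFeature H π x) φ := by
  rw [controlFunctional, PiLp.inner_apply]
  refine Finset.sum_congr rfl fun i _ => ?_
  rw [extend_eq_inner, fderiv_inner_apply ℝ hx (differentiableAt_const _)]
  simp [steinFeature, inner_add_left, inner_smul_left, inner_featureMap x.2, mul_comm]

lemma gradSnd_apply {x' : EuclideanSpace ℝ (Fin d)}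
    (hx' : DifferentiableAt ℝ (featureMap H) x') (x : EuclideanSpace ℝ (Fin d)) (i : Fin d) :
    gradSnd (kernelFun H) x x' i =
      inner ℝ (featureMap H x) (fderiv ℝ (featureMap H) x' (EuclideanSpace.single i 1)) := by
  rw [gradSnd, gradient_apply]
  simp only [kernelFun_eq_inner]
  rw [fderiv_inner_apply ℝ (differentiableAt_const _) hx']
  simp

lemma gradFst_apply {x : EuclideanSpace ℝ (Fin d)}
    (hx : DifferentiableAt ℝ (featureMap H) x) (x' : EuclideanSpace ℝ (Fin d)) (i : Fin d) :
    gradFst (kernelFun H) x x' i =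
      inner ℝ (fderiv ℝ (featureMap H) x (EuclideanSpace.single i 1)) (featureMap H x') := by
  rw [gradFst, gradient_apply]
  simp only [kernelFun_eq_inner]
  rw [fderiv_inner_apply ℝ hx (differentiableAt_const _)]
  simp

lemma steinKernel_eq_inner {π : EuclideanSpace ℝ (Fin d) → ℝ} {x x' : EuclideanSpace ℝ (Fin d)}
    (hx : DifferentiableAt ℝ (featureMap H) x) (hx' : DifferentiableAt ℝ (featureMap H) x') :
    steinKernel π (kernelFun H) x x' = inner ℝ (steinFeature H π x) (steinFeature H π x') := by
  have h1 : divGrad (kernelFun H) x x' =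
      ∑ i, inner ℝ (fderiv ℝ (featureMap H) x (EuclideanSpace.single i 1))
        (fderiv ℝ (featureMap H) x' (EuclideanSpace.single i 1)) := by
    refine Finset.sum_congr rfl fun i _ => ?_
    simp only [gradSnd_apply hx']
    rw [fderiv_inner_apply ℝ hx (differentiableAt_const _)]
    simp
  rw [steinKernel, h1, PiLp.inner_apply, PiLp.inner_apply, PiLp.inner_apply, PiLp.inner_apply,
    Finset.sum_mul, ← Finset.sum_add_distrib, ← Finset.sum_add_distrib, ← Finset.sum_add_distrib]
  refine Finset.sum_congr rfl fun i _ => ?_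
  rw [gradSnd_apply hx', gradFst_apply hx, kernelFun_eq_inner]
  simp only [steinFeature, inner_add_left, inner_add_right, inner_smul_left, inner_smul_right,
    RCLike.inner_apply, conj_trivial]
  ring

/-- For fixed `x` the gradient of the kernel in its first variable is continuously differentiable in
the second. -/
lemma contDiffOn_gradFst (hΩ : IsOpen Ω)
    (hk : ContDiffOn ℝ 2 (fun q : EuclideanSpace ℝ (Fin d) × EuclideanSpace ℝ (Fin d) =>
      kernelFun H q.1 q.2) (Ω ×ˢ Ω)) {x : EuclideanSpace ℝ (Fin d)} (hx : x ∈ Ω) :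
    ContDiffOn ℝ 1 (fun y => gradFst (kernelFun H) x y) Ω := by
  refine contDiffOn_euclidean.2 fun i => ?_
  have h1 : ContDiffOn ℝ 1 (fun y => fderiv ℝ
      (fun q : EuclideanSpace ℝ (Fin d) × EuclideanSpace ℝ (Fin d) => kernelFun H q.1 q.2) (x, y)
      (EuclideanSpace.single i 1, 0)) Ω := by
    have h2 := (hk.fderiv_of_isOpen (hΩ.prod hΩ) (m := 1) (by norm_num)).comp
      (s := Ω) (f := fun y => (x, y)) (contDiff_prodMk_right x).contDiffOn
      (fun y hy => mk_mem_prod hx hy)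
    exact h2.clm_apply contDiffOn_const
  refine h1.congr fun y hy => ?_
  rw [gradFst, gradient_apply]
  have h3 := ((hk.contDiffAt ((hΩ.prod hΩ).mem_nhds (mk_mem_prod hx hy))).differentiableAt
    two_ne_zero).hasFDerivAt
  have h4 : HasFDerivAt (fun z : EuclideanSpace ℝ (Fin d) => (z, y))
      (ContinuousLinearMap.inl ℝ _ _) x :=
    (hasFDerivAt_id (𝕜 := ℝ) x).prodMk (hasFDerivAt_const (𝕜 := ℝ) y x)
  have h5 := HasFDerivAt.comp x h3 h4
  have h6 : (fun z => kernelFun H z y) = (fun q : EuclideanSpace ℝ (Fin d) ×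
    EuclideanSpace ℝ (Fin d) => kernelFun H q.1 q.2) ∘ fun z => (z, y) := rfl
  rw [h6, h5.fderiv]
  simp

lemma contDiffOn_kernelFun
    (hk : ContDiffOn ℝ 2 (fun q : EuclideanSpace ℝ (Fin d) × EuclideanSpace ℝ (Fin d) =>
      kernelFun H q.1 q.2) (Ω ×ˢ Ω)) {x : EuclideanSpace ℝ (Fin d)} (hx : x ∈ Ω) :
    ContDiffOn ℝ 1 (fun y => kernelFun H x y) Ω :=
  (hk.of_le (by norm_num)).comp (s := Ω) (f := fun y => (x, y))
    (contDiff_prodMk_right x).contDiffOn (fun y hy => mk_mem_prod hx hy)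

/-- The Stein identity in differential form: `k₀(x, ·) π` is a divergence. -/
lemma divergence_eq_steinKernel_mul {π : EuclideanSpace ℝ (Fin d) → ℝ}
    {x x' : EuclideanSpace ℝ (Fin d)}
    (hx : DifferentiableAt ℝ (featureMap H) x) (hx' : DifferentiableAt ℝ (featureMap H) x')
    (hπ : DifferentiableAt ℝ π x') (hπ0 : π x' ≠ 0) :
    divergence (fun y => π y • gradFst (kernelFun H) x y + (kernelFun H x y * π y) • score π x) x' =
      steinKernel π (kernelFun H) x x' * π x' := by
  have hcoord : ∀ (y : EuclideanSpace ℝ (Fin d)) (i : Fin d),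
      (π y • gradFst (kernelFun H) x y + (kernelFun H x y * π y) • score π x) i =
        π y * inner ℝ (steinFeature H π x i) (featureMap H y) := by
    intro y i
    rw [PiLp.add_apply, PiLp.smul_apply, PiLp.smul_apply, gradFst_apply hx, kernelFun_eq_inner]
    simp only [steinFeature, inner_add_left, inner_smul_left, smul_eq_mul, conj_trivial]
    ring
  have hdi : ∀ i, DifferentiableAt ℝ
      (fun y => inner ℝ (steinFeature H π x i) (featureMap H y)) x' := fun i =>
    (differentiableAt_const _).inner ℝ hx'
  have hdiff : DifferentiableAt ℝ
      (fun y => π y • gradFst (kernelFun H) x y + (kernelFun H x y * π y) • score π x) x' := by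
    refine differentiableAt_euclidean.2 fun i => ?_
    simp only [hcoord]
    exact hπ.mul (hdi i)
  rw [divergence_eq_sum_fderiv_apply hdiff, steinKernel_eq_inner hx hx', PiLp.inner_apply,
    Finset.sum_mul]
  refine Finset.sum_congr rfl fun i _ => ?_
  simp only [hcoord]
  rw [fderiv_fun_mul hπ (hdi i), _root_.add_apply, _root_.smul_apply, _root_.smul_apply,
    fderiv_inner_apply ℝ (differentiableAt_const _) hx', ← score_apply_mul hπ hπ0]
  have : steinFeature H π x' i = fderiv ℝ (featureMap H) x' (EuclideanSpace.single i 1)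
    + score π x' i • featureMap H x' := rfl
  rw [this, inner_add_right, inner_smul_right]
  simp
  ring

end Feature

/-! ### Control functionals have mean zero -/

section Mean

variable {d : ℕ} {Ω : Set (EuclideanSpace ℝ (Fin d))}

lemma mean_eq_setIntegral (hΩ : IsOpen Ω) (π : EuclideanSpace ℝ (Fin d) → ℝ)
    (g : EuclideanSpace ℝ (Fin d) → ℝ) :
    mean π (fun x : Ω => g x) = ∫ x in Ω, g x * π x :=
  integral_subtype_comap hΩ.measurableSet fun x => g x * π x

lemma hasMean_iff (hΩ : IsOpen Ω) (π : EuclideanSpace ℝ (Fin d) → ℝ)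
    (g : EuclideanSpace ℝ (Fin d) → ℝ) :
    HasMean π (fun x : Ω => g x) ↔ IntegrableOn (fun x => g x * π x) Ω :=
  (integrableOn_iff_comap_subtypeVal (f := fun x => g x * π x) hΩ.measurableSet).symm

lemma ae_restrict_of_ae_targetMeasure (hΩ : IsOpen Ω) {π : EuclideanSpace ℝ (Fin d) → ℝ}
    (hπ_pos : ∀ x ∈ Ω, 0 < π x) (hπ : ContDiffOn ℝ 1 π Ω) {P : EuclideanSpace ℝ (Fin d) → Prop}
    (h : ∀ᵐ x ∂targetMeasure Ω π, P x) : ∀ᵐ x ∂volume.restrict Ω, P x := by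
  have hm : AEMeasurable (fun x => ENNReal.ofReal (π x)) (volume.restrict Ω) :=
    (hπ.continuousOn.aemeasurable hΩ.measurableSet).ennreal_ofReal
  filter_upwards [(ae_withDensity_iff' hm).1 h, ae_restrict_mem hΩ.measurableSet] with x h1 h2
  exact h1 (by simpa using hπ_pos x h2)

variable {H : Type*} [NormedAddCommGroup H] [InnerProductSpace ℝ H] [CompleteSpace H]
  [RKHS ℝ H Ω ℝ]

/-- Every control functional has mean zero. -/
theorem mean_controlFunctional (hd : 1 ≤ d) (hΩ : IsOpen Ω) (hbd : HasPiecewiseSmoothBoundary Ω)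
    {π : EuclideanSpace ℝ (Fin d) → ℝ} (hπ_pos : ∀ x ∈ Ω, 0 < π x) (hπ : ContDiffOn ℝ 1 π Ω)
    (hk : ContDiffOn ℝ 2 (fun q : EuclideanSpace ℝ (Fin d) × EuclideanSpace ℝ (Fin d) =>
      kernelFun H q.1 q.2) (Ω ×ˢ Ω))
    (hflux : ∀ᵐ x ∂(targetMeasure Ω π),
      ScalarFluxVanishes Ω (fun x' => kernelFun H x x' * π x') ∧
      VectorFluxVanishes Ω (fun x' => π x' • gradFst (kernelFun H) x x'))
    (hint : ∀ ψ ∈ spaceZero H π, HasMean π ψ) (φ : PiLp 2 fun _ : Fin d => H) :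
    mean π (controlFunctional π φ) = 0 := by
  have hdf := fun x hx => differentiableAt_featureMap hΩ hk (x := x) hx
  have hrep : ∀ φ : PiLp 2 fun _ : Fin d => H, controlFunctional π φ =
      fun x : Ω => inner ℝ (steinFeature H π (x : EuclideanSpace ℝ (Fin d))) φ := fun φ =>
    funext fun x => controlFunctional_eq_inner x (hdf x x.2) φ
  have hmul : ∀ (φ : PiLp 2 fun _ : Fin d => H) x,
      inner ℝ (π x • steinFeature H π x) φ = inner ℝ (steinFeature H π x) φ * π x := by
    intro φ x
    rw [inner_smul_left, mul_comm]
    rfl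
  have hI : ∀ φ : PiLp 2 fun _ : Fin d => H,
      Integrable (fun x => inner ℝ (π x • steinFeature H π x) φ) (volume.restrict Ω) := by
    intro φ
    simp only [hmul]
    refine (hasMean_iff hΩ π _).1 ?_
    rw [← hrep φ]
    exact hint _ ⟨φ, rfl⟩
  rw [hrep, mean_eq_setIntegral hΩ π fun x => inner ℝ (steinFeature H π x) φ]
  have h0 := integral_inner_eq_zero (ν := volume.restrict Ω) hI ?_ φ
  · simpa only [hmul] using h0
  filter_upwards [ae_restrict_of_ae_targetMeasure hΩ hπ_pos hπ hflux,
    ae_restrict_mem hΩ.measurableSet] with x hx hxΩ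
  have hdiv : EqOn (divergence fun y => π y • gradFst (kernelFun H) x y +
      (kernelFun H x y * π y) • score π x)
      (fun y => inner ℝ (π y • steinFeature H π y) (steinFeature H π x)) Ω := by
    intro y hy
    rw [divergence_eq_steinKernel_mul (hdf x hxΩ) (hdf y hy)
      ((hπ.differentiableOn one_ne_zero).differentiableAt (hΩ.mem_nhds hy)) (hπ_pos y hy).ne',
      steinKernel_eq_inner (hdf x hxΩ) (hdf y hy), real_inner_comm]
    exact (hmul _ y).symm
  have hz : ∫ y in Ω, inner ℝ (π y • steinFeature H π y) (steinFeature H π x) = 0 := by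
    rw [← setIntegral_congr_fun hΩ.measurableSet hdiv]
    exact integral_divergence_eq_zero hd hΩ hbd (score π x)
      (hπ.smul (contDiffOn_gradFst hΩ hk hxΩ)) ((contDiffOn_kernelFun hk hxΩ).mul hπ) hx.2 hx.1
      ((integrableOn_congr_fun hdiv hΩ.measurableSet).2 (hI _))
  simp only [inner_smul_right _ _ (π x)]
  rw [integral_const_mul, hz, mul_zero]

/-- The mean of an element `c + ψ` of `H₊` is `c`. -/
theorem mean_const_add (hΩ : IsOpen Ω) {π : EuclideanSpace ℝ (Fin d) → ℝ}
    (hπ_one : ∫ x in Ω, π x = 1) {ψ : Ω → ℝ} (hψ : HasMean π ψ) (h0 : mean π ψ = 0) (c : ℝ) :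
    mean π (fun x => c + ψ x) = c := by
  have hi : IntegrableOn π Ω := by
    by_contra h
    rw [integral_undef h] at hπ_one
    exact zero_ne_one hπ_one
  have h1 : HasMean π fun _ : Ω => c := (hasMean_iff hΩ π fun _ => c).2 (hi.const_mul c)
  have h2 : mean π (fun _ : Ω => c) = c := by
    rw [mean_eq_setIntegral hΩ π fun _ => c, integral_const_mul, hπ_one, mul_one]
  simp only [mean, add_mul]
  rw [integral_add h1 hψ]
  exact (congrArg₂ (· + ·) h2 h0).trans (add_zero c)

end Mean

/-! ### Matrix identities for the weights and the discrepancy -/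

section MatrixIdentities

variable {m p : ℕ}

lemma mulVec_dotProduct_eq {ι κ : Type*} [Fintype ι] [Fintype κ] (A : Matrix ι κ ℝ) (v : κ → ℝ)
    (w : ι → ℝ) : (A *ᵥ v) ⬝ᵥ w = v ⬝ᵥ (Aᵀ *ᵥ w) := by
  rw [dotProduct_comm, dotProduct_mulVec, mulVec_transpose, dotProduct_comm]

/-- A nonnegative symmetric invertible matrix stays injective if the constant matrix of ones and a
nonnegative multiple of the identity are added. -/
lemma eq_zero_of_regularized_mulVec_eq_zero {K : Matrix (Fin m) (Fin m) ℝ} (hK : IsUnit K)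
    (hpos : ∀ v, 0 ≤ v ⬝ᵥ (K *ᵥ v)) {c : ℝ} (hc : 0 ≤ c) {v : Fin m → ℝ}
    (hv : K *ᵥ v + (1 ⬝ᵥ v) • (1 : Fin m → ℝ) + c • v = 0) : v = 0 := by
  have h0 : v ⬝ᵥ (K *ᵥ v) + (1 ⬝ᵥ v) ^ 2 + c * (v ⬝ᵥ v) = 0 := by
    have := congrArg (fun w => v ⬝ᵥ w) hv
    simp only [dotProduct_add, dotProduct_smul, dotProduct_zero, smul_eq_mul,
      dotProduct_comm v 1] at this
    rw [sq]
    exact this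
  have hvv : 0 ≤ v ⬝ᵥ v := Finset.sum_nonneg fun i _ => mul_self_nonneg _
  have h1 : (1 ⬝ᵥ v) ^ 2 = 0 := by
    nlinarith [hpos v, sq_nonneg (1 ⬝ᵥ v), mul_nonneg hc hvv]
  have h2 : c * (v ⬝ᵥ v) = 0 := by
    nlinarith [hpos v, sq_nonneg (1 ⬝ᵥ v), mul_nonneg hc hvv]
  have h3 : c • v = 0 := by
    rcases mul_eq_zero.1 h2 with h | h
    · rw [h, zero_smul]
    · rw [dotProduct_self_eq_zero.1 h, smul_zero]
  rw [pow_eq_zero_iff two_ne_zero] at h1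
  rw [h1, zero_smul, h3, add_zero, add_zero] at hv
  exact mulVec_injective_iff_isUnit.2 hK (by rw [hv, mulVec_zero])

/-- The coefficients of the regularised least-squares problem, as a function of the regularisation
parameter, have a limit as the parameter tends to zero. -/
lemma exists_tendsto_coefficients {K : Matrix (Fin m) (Fin m) ℝ} (hK : IsUnit K)
    (hpos : ∀ v, 0 ≤ v ⬝ᵥ (K *ᵥ v)) (y : Fin m → ℝ) :
    ∃ a : ℝ → Fin m → ℝ,
      (∀ c ≥ 0, K *ᵥ a c + (1 ⬝ᵥ a c) • (1 : Fin m → ℝ) + c • a c = y) ∧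
      Tendsto a (𝓝[>] 0) (𝓝 (a 0)) := by
  let A : ℝ → Matrix (Fin m) (Fin m) ℝ := fun c =>
    K + Matrix.of (fun _ _ => (1 : ℝ)) + c • (1 : Matrix (Fin m) (Fin m) ℝ)
  have hA : ∀ c v, A c *ᵥ v = K *ᵥ v + (1 ⬝ᵥ v) • (1 : Fin m → ℝ) + c • v := by
    intro c v
    have h1 : Matrix.of (fun _ _ : Fin m => (1 : ℝ)) *ᵥ v = (1 ⬝ᵥ v) • (1 : Fin m → ℝ) := by
      ext i
      simp [mulVec, dotProduct]
    simp only [A, add_mulVec, smul_mulVec, one_mulVec, h1]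
  have hunit : ∀ c ≥ 0, IsUnit (A c) := by
    intro c hc
    refine mulVec_injective_iff_isUnit.1 fun v w hvw => sub_eq_zero.1 ?_
    refine eq_zero_of_regularized_mulVec_eq_zero hK hpos hc ?_
    rw [← hA, mulVec_sub]
    exact sub_eq_zero.2 hvw
  refine ⟨fun c => (A c)⁻¹ *ᵥ y, fun c hc => ?_, ?_⟩
  · rw [← hA, mulVec_mulVec, mul_nonsing_inv _ ((isUnit_iff_isUnit_det _).1 (hunit c hc)),
      one_mulVec]
  · have hAc : Continuous A := by fun_prop
    have hdet : IsUnit (A 0).det := (isUnit_iff_isUnit_det _).1 (hunit 0 le_rfl)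
    have hinv : ContinuousAt (fun c => (A c)⁻¹) 0 :=
      ContinuousAt.comp (f := A) (g := fun B => B⁻¹)
        (continuousAt_matrix_inv _ (NormedRing.inverse_continuousAt hdet.unit)) hAc.continuousAt
    have hmv : Continuous fun B : Matrix (Fin m) (Fin m) ℝ => B *ᵥ y :=
      continuous_id.matrix_mulVec continuous_const
    exact (ContinuousAt.comp (g := fun B : Matrix (Fin m) (Fin m) ℝ => B *ᵥ y)
      hmv.continuousAt hinv).tendsto.mono_left nhdsWithin_le_nhds

lemma nonneg_dotProduct_inv_mulVec {K : Matrix (Fin m) (Fin m) ℝ} (hK : IsUnit K)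
    (hpos : ∀ v, 0 ≤ v ⬝ᵥ (K *ᵥ v)) (v : Fin m → ℝ) : 0 ≤ v ⬝ᵥ (K⁻¹ *ᵥ v) := by
  have h := hpos (K⁻¹ *ᵥ v)
  rwa [mulVec_mulVec, mul_nonsing_inv _ ((isUnit_iff_isUnit_det _).1 hK), one_mulVec,
    dotProduct_comm] at h

/-- The weights of the first sample solve the linear system of the unregularised problem, by the
Sherman–Morrison formula. -/
lemma mulVec_weights_inl {K₀ : Matrix (Fin m) (Fin m) ℝ} (hK : IsUnit K₀)
    (hpos : ∀ v, 0 ≤ v ⬝ᵥ (K₀ *ᵥ v)) (K₁₀ : Matrix (Fin p) (Fin m) ℝ) :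
    K₀ *ᵥ (weights K₀ K₁₀ ∘ Sum.inl) + (1 ⬝ᵥ (weights K₀ K₁₀ ∘ Sum.inl)) • (1 : Fin m → ℝ) =
      -(1 / p : ℝ) • (K₁₀ᵀ *ᵥ 1) := by
  have hdet := (isUnit_iff_isUnit_det _).1 hK
  have ht : (1 : ℝ) + 1 ⬝ᵥ (K₀⁻¹ *ᵥ 1) ≠ 0 := by
    linarith [nonneg_dotProduct_inv_mulVec hK hpos 1]
  have h1 : K₀ *ᵥ (K₀⁻¹ *ᵥ (1 : Fin m → ℝ)) = 1 := by
    rw [mulVec_mulVec, mul_nonsing_inv _ hdet, one_mulVec]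
  have h2 : K₀ *ᵥ ((K₀⁻¹ * K₁₀ᵀ) *ᵥ 1) = K₁₀ᵀ *ᵥ 1 := by
    rw [mulVec_mulVec, mul_nonsing_inv_cancel_left _ _ hdet]
  simp only [weights, Sum.elim_comp_inl, mulVec_add, mulVec_smul, dotProduct_add, dotProduct_smul,
    h1, h2, smul_eq_mul]
  ext i
  simp only [Pi.add_apply, Pi.smul_apply, Pi.one_apply, smul_eq_mul]
  field_simp
  ring

/-- If the coefficients `a` solve the unregularised problem for the data `y`, then the weighted sum
of the data is the average over the second sample of what the control functional with these
coefficients leaves of the data `z`. -/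
lemma weights_dotProduct {K₀ : Matrix (Fin m) (Fin m) ℝ} (hK : IsUnit K₀) (hsymm : K₀ᵀ = K₀)
    (hpos : ∀ v, 0 ≤ v ⬝ᵥ (K₀ *ᵥ v)) (K₁₀ : Matrix (Fin p) (Fin m) ℝ) {a y : Fin m → ℝ}
    (ha : K₀ *ᵥ a + (1 ⬝ᵥ a) • (1 : Fin m → ℝ) = y) (z : Fin p → ℝ) :
    weights K₀ K₁₀ ⬝ᵥ Sum.elim y z = (1 / p : ℝ) * ∑ i, (z i - (K₁₀ *ᵥ a) i) := by
  set w := weights K₀ K₁₀ ∘ Sum.inl with hw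
  have hsplit : weights K₀ K₁₀ = Sum.elim w ((1 / p : ℝ) • (1 : Fin p → ℝ)) := by
    ext i
    cases i <;> simp [hw, weights]
  have h1 := congrArg (fun v => v ⬝ᵥ a) (mulVec_weights_inl hK hpos K₁₀)
  simp only [← hw, add_dotProduct, smul_dotProduct, mulVec_dotProduct_eq, hsymm,
    transpose_transpose, smul_eq_mul] at h1
  have h2 : ∑ i, (z i - (K₁₀ *ᵥ a) i) = 1 ⬝ᵥ z - 1 ⬝ᵥ (K₁₀ *ᵥ a) := by
    simp [dotProduct, Finset.sum_sub_distrib]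
  rw [hsplit, sumElim_dotProduct_sumElim, ← ha, dotProduct_add, dotProduct_smul, smul_dotProduct,
    h2, smul_eq_mul, smul_eq_mul, dotProduct_comm w 1]
  linarith

/-- The discrepancy is the squared worst-case error of the weights. -/
lemma discrepancy_eq {K₀ : Matrix (Fin m) (Fin m) ℝ} (hK : IsUnit K₀) (hsymm : K₀ᵀ = K₀)
    (hpos : ∀ v, 0 ≤ v ⬝ᵥ (K₀ *ᵥ v)) (hp : 1 ≤ p) (K₁₀ : Matrix (Fin p) (Fin m) ℝ)
    (K₁ : Matrix (Fin p) (Fin p) ℝ) :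
    discrepancy K₀ K₁₀ K₁ = weights K₀ K₁₀ ⬝ᵥ (fullMatrix K₀ K₁₀ K₁ *ᵥ weights K₀ K₁₀)
      + (1 - ∑ i, weights K₀ K₁₀ i) ^ 2 := by
  have hp0 : (p : ℝ) ≠ 0 := by positivity
  have ht : (1 : ℝ) + 1 ⬝ᵥ (K₀⁻¹ *ᵥ 1) ≠ 0 := by
    linarith [nonneg_dotProduct_inv_mulVec hK hpos 1]
  have hinv : (K₀⁻¹)ᵀ = K₀⁻¹ := by rw [transpose_nonsing_inv, hsymm]
  set w := weights K₀ K₁₀ ∘ Sum.inl with hw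
  have hw1 : weights K₀ K₁₀ ∘ Sum.inr = (1 / p : ℝ) • (1 : Fin p → ℝ) := by
    ext i
    simp [weights]
  have hsplit : weights K₀ K₁₀ = Sum.elim w ((1 / p : ℝ) • (1 : Fin p → ℝ)) := by
    rw [← hw1, hw, Sum.elim_comp_inl_inr]
  have hsys := mulVec_weights_inl hK hpos K₁₀
  rw [← hw] at hsys
  have hsum : ∑ i, weights K₀ K₁₀ i = 1 ⬝ᵥ w + 1 := by
    rw [Fintype.sum_sum_type]
    congr 1
    · simp [dotProduct, hw]
    · simp [weights, hp0]
  have hK₁₀ : K₁₀ *ᵥ w ⬝ᵥ 1 = w ⬝ᵥ (K₁₀ᵀ *ᵥ 1) := mulVec_dotProduct_eq K₁₀ w 1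
  have hwK : w ⬝ᵥ (K₀ *ᵥ w) + (1 ⬝ᵥ w) ^ 2 = -(1 / p : ℝ) * (w ⬝ᵥ (K₁₀ᵀ *ᵥ 1)) := by
    have := congrArg (fun v => w ⬝ᵥ v) hsys
    simp only [dotProduct_add, dotProduct_smul, smul_eq_mul, dotProduct_comm w 1] at this
    rw [sq, this]
  have hs : (K₀⁻¹ *ᵥ 1) ⬝ᵥ (K₁₀ᵀ *ᵥ 1) = 1 ⬝ᵥ ((K₀⁻¹ * K₁₀ᵀ) *ᵥ 1) := by
    rw [mulVec_dotProduct_eq, hinv, mulVec_mulVec]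
  have hs' : (1 : Fin p → ℝ) ⬝ᵥ ((K₁₀ * K₀⁻¹) *ᵥ 1) = 1 ⬝ᵥ ((K₀⁻¹ * K₁₀ᵀ) *ᵥ 1) := by
    rw [dotProduct_comm, mulVec_dotProduct_eq, transpose_mul, hinv]
  have ha : ((K₀⁻¹ * K₁₀ᵀ) *ᵥ 1) ⬝ᵥ (K₁₀ᵀ *ᵥ 1) = 1 ⬝ᵥ ((K₁₀ * K₀⁻¹ * K₁₀ᵀ) *ᵥ 1) := by
    rw [mulVec_dotProduct_eq, transpose_mul, hinv, transpose_transpose, mulVec_mulVec]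
  have hwc : w ⬝ᵥ (K₁₀ᵀ *ᵥ 1) = -(1 / p : ℝ) * (1 ⬝ᵥ ((K₁₀ * K₀⁻¹ * K₁₀ᵀ) *ᵥ 1))
      + (1 / p : ℝ) * (1 ⬝ᵥ ((K₀⁻¹ * K₁₀ᵀ) *ᵥ 1)) ^ 2 / (1 + 1 ⬝ᵥ (K₀⁻¹ *ᵥ 1)) := by
    rw [hw, weights, Sum.elim_comp_inl, add_dotProduct, smul_dotProduct, smul_dotProduct, ha, hs,
      smul_eq_mul, smul_eq_mul]
    ring
  have hquad : weights K₀ K₁₀ ⬝ᵥ (fullMatrix K₀ K₁₀ K₁ *ᵥ weights K₀ K₁₀) =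
      w ⬝ᵥ (K₀ *ᵥ w) + 2 * (1 / p : ℝ) * (w ⬝ᵥ (K₁₀ᵀ *ᵥ 1))
        + (1 / p : ℝ) ^ 2 * (1 ⬝ᵥ (K₁ *ᵥ 1)) := by
    rw [hsplit, fullMatrix, fromBlocks_mulVec, Sum.elim_comp_inl, Sum.elim_comp_inr,
      sumElim_dotProduct_sumElim]
    simp only [mulVec_smul, dotProduct_add, dotProduct_smul, smul_dotProduct, smul_eq_mul,
      dotProduct_comm 1 (K₁₀ *ᵥ w), hK₁₀]
    ring
  rw [hquad, hsum, discrepancy, hs']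
  have h3 : w ⬝ᵥ (K₀ *ᵥ w) = -(1 / p : ℝ) * (w ⬝ᵥ (K₁₀ᵀ *ᵥ 1)) - (1 ⬝ᵥ w) ^ 2 := by
    linarith
  rw [h3, hwc]
  ring

end MatrixIdentities

/-! ### Regularised least squares in a Hilbert space -/

section LeastSquares

variable {α V : Type*} [NormedAddCommGroup V] [InnerProductSpace ℝ V]

/-- Among the vectors that represent a given function through a feature map there is one of least
norm, the orthogonal projection onto the closed span of the features. -/
lemma exists_least_norm_representer [CompleteSpace V] (ζ : α → V) (e₀ : V) :
    ∃ e, (∀ x, inner ℝ (ζ x) e = inner ℝ (ζ x) e₀) ∧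
      ∀ e', (∀ x, inner ℝ (ζ x) e' = inner ℝ (ζ x) e₀) → ‖e‖ ≤ ‖e'‖ := by
  set S := (Submodule.span ℝ (range ζ)).topologicalClosure with hS
  have hζ : ∀ x, ζ x ∈ S := fun x =>
    Submodule.le_topologicalClosure _ (Submodule.subset_span (mem_range_self x))
  have : CompleteSpace S := (Submodule.isClosed_topologicalClosure _).completeSpace_coe
  have hproj : ∀ e' : V, (∀ x, inner ℝ (ζ x) e' = inner ℝ (ζ x) e₀) →
      S.starProjection e₀ = S.starProjection e' := by
    intro e' he'
    rw [← sub_eq_zero, ← map_sub, Submodule.starProjection_apply_eq_zero_iff, hS,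
      Submodule.orthogonal_closure]
    refine (Submodule.mem_orthogonal _ _).2 fun u hu => ?_
    induction hu using Submodule.span_induction with
    | mem u hu =>
      obtain ⟨x, rfl⟩ := hu
      rw [inner_sub_right, he' x, sub_self]
    | zero => exact inner_zero_left _
    | add u v _ _ hu hv => rw [inner_add_left, hu, hv, add_zero]
    | smul c u _ hu => rw [inner_smul_left, hu, mul_zero]
  refine ⟨S.starProjection e₀, fun x => ?_, fun e' he' => ?_⟩
  · have h : e₀ - S.starProjection e₀ ∈ Sᗮ := Submodule.sub_starProjection_mem_orthogonal e₀
    have := (Submodule.mem_orthogonal _ _).1 h _ (hζ x)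
    rw [inner_sub_right, sub_eq_zero] at this
    exact this.symm
  · rw [hproj e' he']
    exact S.norm_starProjection_apply_le e'

/-- Completing the square in the regularised least-squares objective about the solution
`∑ j, a j • ζ j` of the normal equations. -/
lemma leastSquares_eq_add {m : ℕ} (hm : 1 ≤ m) (ζ : Fin m → V) {y a : Fin m → ℝ} {l : ℝ}
    (ha : ∀ i, inner ℝ (ζ i) (∑ j, a j • ζ j) + l * m * a i = y i) (e : V) :
    (1 / m : ℝ) * ∑ j, (y j - inner ℝ (ζ j) e) ^ 2 + l * ‖e‖ ^ 2 =
      ((1 / m : ℝ) * ∑ j, (y j - inner ℝ (ζ j) (∑ j, a j • ζ j)) ^ 2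
        + l * ‖∑ j, a j • ζ j‖ ^ 2)
      + ((1 / m : ℝ) * ∑ j, inner ℝ (ζ j) (e - ∑ j, a j • ζ j) ^ 2
        + l * ‖e - ∑ j, a j • ζ j‖ ^ 2) := by
  have hm0 : (m : ℝ) ≠ 0 := by positivity
  set s := ∑ j, a j • ζ j with hs
  obtain ⟨v, rfl⟩ : ∃ v, e = s + v := ⟨e - s, by abel⟩
  have hcross : inner ℝ s v = ∑ j, a j * inner ℝ (ζ j) v := by
    rw [hs, sum_inner]
    simp [inner_smul_left]
  have hterm : ∀ j, (y j - inner ℝ (ζ j) (s + v)) ^ 2 = (y j - inner ℝ (ζ j) s) ^ 2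
      + inner ℝ (ζ j) v ^ 2 - 2 * l * m * (a j * inner ℝ (ζ j) v) := by
    intro j
    rw [inner_add_right, ← ha j]
    ring
  simp only [hterm]
  rw [Finset.sum_sub_distrib, Finset.sum_add_distrib, ← Finset.mul_sum, ← hcross,
    norm_add_sq_real, add_sub_cancel_left]
  field_simp
  ring

end LeastSquares

/-! ### The space of constants plus control functionals -/

section Plus

variable {d : ℕ} {Ω : Set (EuclideanSpace ℝ (Fin d))}
  {H : Type*} [NormedAddCommGroup H] [InnerProductSpace ℝ H] [CompleteSpace H] [RKHS ℝ H Ω ℝ]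
  {π : EuclideanSpace ℝ (Fin d) → ℝ}

variable (H π) in
/-- The feature map of `H₊`: the function `c + ∇ · φ + φ · u` is represented by the pair `(c, φ)` of
`ℝ × H^d`. -/
noncomputable def plusFeature (x : Ω) : WithLp 2 (ℝ × PiLp 2 fun _ : Fin d => H) :=
  WithLp.toLp 2 (1, steinFeature H π x)

lemma inner_plusFeature (hdf : ∀ x ∈ Ω, DifferentiableAt ℝ (featureMap H) x) (x : Ω) (c : ℝ)
    (φ : PiLp 2 fun _ : Fin d => H) :
    inner ℝ (plusFeature H π x) (WithLp.toLp 2 (c, φ)) = c + controlFunctional π φ x := by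
  rw [plusFeature, WithLp.prod_inner_apply, controlFunctional_eq_inner x (hdf x x.2)]
  simp

lemma inner_plusFeature_plusFeature (hdf : ∀ x ∈ Ω, DifferentiableAt ℝ (featureMap H) x)
    (x x' : Ω) : inner ℝ (plusFeature H π x) (plusFeature H π x') =
      1 + steinKernel π (kernelFun H) x x' := by
  rw [plusFeature, plusFeature, WithLp.prod_inner_apply,
    steinKernel_eq_inner (hdf x x.2) (hdf x' x'.2)]
  simp

lemma norm_sq_toLp_prod (c : ℝ) (φ : PiLp 2 fun _ : Fin d => H) :
    ‖(WithLp.toLp 2 (c, φ) : WithLp 2 (ℝ × PiLp 2 fun _ : Fin d => H))‖ ^ 2 = c ^ 2 + ‖φ‖ ^ 2 := by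
  rw [WithLp.prod_norm_sq_eq_of_L2]
  simp

lemma inner_plusFeature_mem_spacePlus (hdf : ∀ x ∈ Ω, DifferentiableAt ℝ (featureMap H) x)
    (e : WithLp 2 (ℝ × PiLp 2 fun _ : Fin d => H)) :
    (fun x => inner ℝ (plusFeature H π x) e) ∈ spacePlus H π :=
  ⟨e.fst, controlFunctional π e.snd, ⟨e.snd, rfl⟩, funext fun x =>
    inner_plusFeature hdf x e.fst e.snd⟩

lemma normZero_le (φ : PiLp 2 fun _ : Fin d => H) :
    normZero H π (controlFunctional π φ) ≤ ‖φ‖ :=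
  csInf_le ⟨0, by rintro r ⟨φ, -, rfl⟩; exact norm_nonneg _⟩ ⟨φ, rfl, rfl⟩

lemma normZero_nonneg (ψ : Ω → ℝ) : 0 ≤ normZero H π ψ :=
  Real.sInf_nonneg (by rintro r ⟨φ, -, rfl⟩; exact norm_nonneg _)

lemma exists_norm_eq_normZero (hdf : ∀ x ∈ Ω, DifferentiableAt ℝ (featureMap H) x) {ψ : Ω → ℝ}
    (hψ : ψ ∈ spaceZero H π) :
    ∃ φ : PiLp 2 fun _ : Fin d => H, controlFunctional π φ = ψ ∧ normZero H π ψ = ‖φ‖ := by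
  obtain ⟨φ₀, rfl⟩ := hψ
  obtain ⟨φ, h1, h2⟩ := exists_least_norm_representer
    (fun x : Ω => steinFeature H π (x : EuclideanSpace ℝ (Fin d))) φ₀
  simp only [← controlFunctional_eq_inner _ (hdf _ (Subtype.coe_prop _))] at h1 h2
  refine ⟨φ, funext h1, ?_⟩
  rw [← funext h1]
  refine le_antisymm (normZero_le φ) (le_csInf ⟨_, φ, rfl, rfl⟩ ?_)
  rintro r ⟨φ', h, rfl⟩
  exact h2 φ' fun x => by rw [h, h1 x]

lemma normPlus_nonneg (f : Ω → ℝ) : 0 ≤ normPlus H π f :=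
  Real.sInf_nonneg (by rintro r ⟨c, ψ, -, -, rfl⟩; exact Real.sqrt_nonneg _)

lemma normPlus_le (hdf : ∀ x ∈ Ω, DifferentiableAt ℝ (featureMap H) x)
    (e : WithLp 2 (ℝ × PiLp 2 fun _ : Fin d => H)) :
    normPlus H π (fun x => inner ℝ (plusFeature H π x) e) ≤ ‖e‖ := by
  have h : normPlus H π (fun x => inner ℝ (plusFeature H π x) e) ≤
      √(e.fst ^ 2 + normZero H π (controlFunctional π e.snd) ^ 2) :=
    csInf_le ⟨0, by rintro r ⟨c, ψ, -, -, rfl⟩; exact Real.sqrt_nonneg _⟩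
      ⟨e.fst, controlFunctional π e.snd, ⟨e.snd, rfl⟩, funext fun x =>
        inner_plusFeature hdf x e.fst e.snd, rfl⟩
  refine h.trans ?_
  refine Real.sqrt_le_iff.2 ⟨norm_nonneg _, ?_⟩
  have h1 := norm_sq_toLp_prod e.fst e.snd
  change ‖e‖ ^ 2 = _ at h1
  rw [h1]
  gcongr
  · exact normZero_nonneg _
  · exact normZero_le _

/-- The infimum in the norm of `H₊` is attained. -/
lemma exists_norm_eq_normPlus (hdf : ∀ x ∈ Ω, DifferentiableAt ℝ (featureMap H) x) {f : Ω → ℝ}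
    (hf : f ∈ spacePlus H π) : ∃ e : WithLp 2 (ℝ × PiLp 2 fun _ : Fin d => H),
      (f = fun x => inner ℝ (plusFeature H π x) e) ∧ normPlus H π f = ‖e‖ := by
  obtain ⟨c, ψ, ⟨φ, rfl⟩, rfl⟩ := hf
  obtain ⟨e, h1, h2⟩ := exists_least_norm_representer (plusFeature H π) (WithLp.toLp 2 (c, φ))
  simp only [inner_plusFeature hdf _ c φ] at h1 h2
  refine ⟨e, funext fun x => (h1 x).symm, ?_⟩
  rw [← funext h1]
  refine le_antisymm (normPlus_le hdf e) (le_csInf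
    ⟨_, e.fst, controlFunctional π e.snd, ⟨e.snd, rfl⟩, funext fun x =>
      inner_plusFeature hdf x e.fst e.snd, rfl⟩ ?_)
  rintro r ⟨c', ψ', hψ', h, rfl⟩
  obtain ⟨φ', rfl, hφ'⟩ := exists_norm_eq_normZero hdf hψ'
  rw [hφ', ← norm_sq_toLp_prod, Real.sqrt_sq (norm_nonneg _)]
  refine h2 _ fun x => ?_
  rw [inner_plusFeature hdf, ← h1 x]
  exact (congrFun h x).symm

/-- The regularised least-squares approximation is the combination of the features of the sample
with the coefficients that solve the normal equations. -/
lemma isRLS_iff (hdf : ∀ x ∈ Ω, DifferentiableAt ℝ (featureMap H) x) {m : ℕ} (hm : 1 ≤ m)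
    (x₀ : Fin m → Ω) (f : Ω → ℝ) {l : ℝ} (hl : 0 < l) {a : Fin m → ℝ}
    (ha : ∀ i, inner ℝ (plusFeature H π (x₀ i)) (∑ j, a j • plusFeature H π (x₀ j)) + l * m * a i =
      f (x₀ i)) (s : Ω → ℝ) :
    IsRLS H π x₀ f l s ↔
      s = fun x => inner ℝ (plusFeature H π x) (∑ j, a j • plusFeature H π (x₀ j)) := by
  have hsq := leastSquares_eq_add hm (fun j => plusFeature H π (x₀ j)) ha
  set e₀ := ∑ j, a j • plusFeature H π (x₀ j) with he₀
  have hval : rlsObjective H π x₀ f l (fun x => inner ℝ (plusFeature H π x) e₀) ≤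
      (1 / m : ℝ) * ∑ j, (f (x₀ j) - inner ℝ (plusFeature H π (x₀ j)) e₀) ^ 2 + l * ‖e₀‖ ^ 2 := by
    rw [rlsObjective]
    gcongr
    · exact normPlus_nonneg _
    · exact normPlus_le hdf e₀
  have hnonneg : ∀ e : WithLp 2 (ℝ × PiLp 2 fun _ : Fin d => H),
      0 ≤ (1 / m : ℝ) * ∑ j, inner ℝ (plusFeature H π (x₀ j)) (e - e₀) ^ 2 := fun e =>
    mul_nonneg (by positivity) (Finset.sum_nonneg fun j _ => sq_nonneg _)
  constructor
  · rintro ⟨hs, hmin⟩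
    obtain ⟨e, rfl, he⟩ := exists_norm_eq_normPlus hdf hs
    have h1 := (hmin (inner_plusFeature_mem_spacePlus hdf e₀)).trans hval
    simp only [rlsObjective, he] at h1
    have h2 : l * ‖e - e₀‖ ^ 2 ≤ 0 := by linarith [hsq e, hnonneg e]
    have h3 : ‖e - e₀‖ ^ 2 ≤ 0 := nonpos_of_mul_nonpos_right h2 hl
    have h4 : e = e₀ := by
      rw [← sub_eq_zero, ← norm_eq_zero]
      exact pow_eq_zero_iff two_ne_zero |>.1 (le_antisymm h3 (sq_nonneg _))
    rw [h4]
  · rintro rfl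
    refine ⟨inner_plusFeature_mem_spacePlus hdf e₀, fun g hg => hval.trans ?_⟩
    obtain ⟨e, rfl, he⟩ := exists_norm_eq_normPlus hdf hg
    simp only [rlsObjective, he]
    have : 0 ≤ l * ‖e - e₀‖ ^ 2 := by positivity
    linarith [hsq e, hnonneg e]

end Plus

/-! ### Gram matrices and worst-case errors -/

section Gram

variable {d : ℕ} {Ω : Set (EuclideanSpace ℝ (Fin d))}
  {H : Type*} [NormedAddCommGroup H] [InnerProductSpace ℝ H] [CompleteSpace H] [RKHS ℝ H Ω ℝ]
  {π : EuclideanSpace ℝ (Fin d) → ℝ} {m p : ℕ}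

lemma kernelMatrix_transpose (hdf : ∀ x ∈ Ω, DifferentiableAt ℝ (featureMap H) x)
    (x : Fin m → Ω) (y : Fin p → Ω) :
    (kernelMatrix (steinKernel π (kernelFun H)) x y)ᵀ =
      kernelMatrix (steinKernel π (kernelFun H)) y x := by
  ext i j
  simp only [kernelMatrix, transpose_apply, of_apply]
  rw [steinKernel_eq_inner (hdf _ (x j).2) (hdf _ (y i).2), real_inner_comm,
    steinKernel_eq_inner (hdf _ (y i).2) (hdf _ (x j).2)]

lemma kernelMatrix_mulVec (hdf : ∀ x ∈ Ω, DifferentiableAt ℝ (featureMap H) x)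
    (x : Fin m → Ω) (y : Fin p → Ω) (v : Fin p → ℝ) (i : Fin m) :
    (kernelMatrix (steinKernel π (kernelFun H)) x y *ᵥ v) i =
      inner ℝ (steinFeature H π (x i)) (∑ j, v j • steinFeature H π (y j)) := by
  rw [inner_sum, mulVec, dotProduct]
  refine Finset.sum_congr rfl fun j _ => ?_
  simp only [kernelMatrix, of_apply]
  rw [inner_smul_right, steinKernel_eq_inner (hdf _ (x i).2) (hdf _ (y j).2), mul_comm]

lemma dotProduct_kernelMatrix_mulVec (hdf : ∀ x ∈ Ω, DifferentiableAt ℝ (featureMap H) x)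
    (x : Fin m → Ω) (y : Fin p → Ω) (v : Fin m → ℝ) (w : Fin p → ℝ) :
    v ⬝ᵥ (kernelMatrix (steinKernel π (kernelFun H)) x y *ᵥ w) =
      inner ℝ (∑ i, v i • steinFeature H π (x i)) (∑ j, w j • steinFeature H π (y j)) := by
  rw [sum_inner]
  refine Finset.sum_congr rfl fun i _ => ?_
  rw [kernelMatrix_mulVec hdf, inner_smul_left]
  rfl

/-- The quadratic form of the whole sample is the squared norm of the combination of features. -/
lemma dotProduct_fullMatrix_mulVec (hdf : ∀ x ∈ Ω, DifferentiableAt ℝ (featureMap H) x)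
    (x₀ : Fin m → Ω) (x₁ : Fin p → Ω) (w : Fin m ⊕ Fin p → ℝ) :
    w ⬝ᵥ (fullMatrix (kernelMatrix (steinKernel π (kernelFun H)) x₀ x₀)
      (kernelMatrix (steinKernel π (kernelFun H)) x₁ x₀)
      (kernelMatrix (steinKernel π (kernelFun H)) x₁ x₁) *ᵥ w) =
    ‖∑ i, w i • steinFeature H π (Sum.elim x₀ x₁ i : Ω)‖ ^ 2 := by
  obtain ⟨u, v, rfl⟩ : ∃ u v, w = Sum.elim u v :=
    ⟨w ∘ Sum.inl, w ∘ Sum.inr, (Sum.elim_comp_inl_inr w).symm⟩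
  rw [fullMatrix, fromBlocks_mulVec, Sum.elim_comp_inl, Sum.elim_comp_inr,
    sumElim_dotProduct_sumElim, dotProduct_add, dotProduct_add, kernelMatrix_transpose hdf,
    dotProduct_kernelMatrix_mulVec hdf, dotProduct_kernelMatrix_mulVec hdf,
    dotProduct_kernelMatrix_mulVec hdf, dotProduct_kernelMatrix_mulVec hdf,
    Fintype.sum_sum_type, ← real_inner_self_eq_norm_sq]
  simp only [Sum.elim_inl, Sum.elim_inr, inner_add_left, inner_add_right]
  ring

/-- Worst-case error bound of a linear cubature rule for functions of `H₊`. -/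
lemma abs_weights_dotProduct_sub_le (hdf : ∀ x ∈ Ω, DifferentiableAt ℝ (featureMap H) x)
    (x₀ : Fin m → Ω) (x₁ : Fin p → Ω) (w : Fin m ⊕ Fin p → ℝ)
    (e : WithLp 2 (ℝ × PiLp 2 fun _ : Fin d => H)) {f : Ω → ℝ}
    (hf : f = fun x => inner ℝ (plusFeature H π x) e) :
    |w ⬝ᵥ Sum.elim (fun j => f (x₀ j)) (fun i => f (x₁ i)) - e.fst| ≤
      √(w ⬝ᵥ (fullMatrix (kernelMatrix (steinKernel π (kernelFun H)) x₀ x₀)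
        (kernelMatrix (steinKernel π (kernelFun H)) x₁ x₀)
        (kernelMatrix (steinKernel π (kernelFun H)) x₁ x₁) *ᵥ w) + (1 - ∑ i, w i) ^ 2) * ‖e‖ := by
  set E : WithLp 2 (ℝ × PiLp 2 fun _ : Fin d => H) :=
    WithLp.toLp 2 (∑ i, w i - 1, ∑ i, w i • steinFeature H π (Sum.elim x₀ x₁ i : Ω)) with hE
  have h1 : w ⬝ᵥ Sum.elim (fun j => f (x₀ j)) (fun i => f (x₁ i)) - e.fst = inner ℝ E e := by
    have h2 : Sum.elim (fun j => f (x₀ j)) (fun i => f (x₁ i)) = fun i => f (Sum.elim x₀ x₁ i) := by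
      ext i
      cases i <;> rfl
    have h3 : ∀ x : Ω, inner ℝ (plusFeature H π x) e = e.fst + inner ℝ (steinFeature H π x) e.snd := by
      intro x
      rw [plusFeature, WithLp.prod_inner_apply]
      simp
    rw [h2, hf, hE, WithLp.prod_inner_apply]
    simp only [h3, dotProduct, mul_add, Finset.sum_add_distrib, sum_inner, inner_smul_left,
      ← Finset.sum_mul]
    simp
    ring
  have h4 : ‖E‖ = √(w ⬝ᵥ (fullMatrix (kernelMatrix (steinKernel π (kernelFun H)) x₀ x₀)
        (kernelMatrix (steinKernel π (kernelFun H)) x₁ x₀)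
        (kernelMatrix (steinKernel π (kernelFun H)) x₁ x₁) *ᵥ w) + (1 - ∑ i, w i) ^ 2) := by
    rw [dotProduct_fullMatrix_mulVec hdf, ← Real.sqrt_sq (norm_nonneg E), hE, norm_sq_toLp_prod]
    congr 1
    ring
  rw [h1, ← h4]
  exact abs_real_inner_le_norm E e

end Gram

end ControlFunctional

/-! ### The estimator -/

open ControlFunctional in
theorem theorem3 {d : ℕ} (hd : 1 ≤ d)
    -- the open state space and the positive probability density, of class C¹
    (Ω : Set (EuclideanSpace ℝ (Fin d))) (hΩ : IsOpen Ω)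
    (hbd : ControlFunctional.HasPiecewiseSmoothBoundary Ω)
    (π : EuclideanSpace ℝ (Fin d) → ℝ) (hπ_pos : ∀ x ∈ Ω, 0 < π x)
    (hπ_one : ∫ x in Ω, π x = 1) (hπ : ContDiffOn ℝ 1 π Ω)
    -- the reproducing kernel Hilbert space, with kernel of class C²
    {H : Type*} [NormedAddCommGroup H] [InnerProductSpace ℝ H] [CompleteSpace H] [RKHS ℝ H Ω ℝ]
    (hk : ContDiffOn ℝ 2 (fun q : EuclideanSpace ℝ (Fin d) × EuclideanSpace ℝ (Fin d) =>
      ControlFunctional.kernelFun H q.1 q.2) (Ω ×ˢ Ω))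
    -- the two boundary conditions
    (hflux : ∀ᵐ x ∂(ControlFunctional.targetMeasure Ω π),
      ControlFunctional.ScalarFluxVanishes Ω
        (fun x' => ControlFunctional.kernelFun H x x' * π x') ∧
      ControlFunctional.VectorFluxVanishes Ω
        (fun x' => π x' • ControlFunctional.gradFst (ControlFunctional.kernelFun H) x x'))
    -- `μ(ψ)` is meaningful for all `ψ ∈ H₀`
    (hint : ∀ ψ ∈ ControlFunctional.spaceZero H π, ControlFunctional.HasMean π ψ)
    (f : Ω → ℝ) (hf : f ∈ ControlFunctional.spacePlus H π)
    -- the two samples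
    {m p : ℕ} (hm : 1 ≤ m) (hp : 1 ≤ p) (x₀ : Fin m → Ω) (x₁ : Fin p → Ω)
    (K₀ : Matrix (Fin m) (Fin m) ℝ) (K₁₀ : Matrix (Fin p) (Fin m) ℝ)
    (K₁ : Matrix (Fin p) (Fin p) ℝ)
    (hK₀ : K₀ = ControlFunctional.kernelMatrix
      (ControlFunctional.steinKernel π (ControlFunctional.kernelFun H)) x₀ x₀)
    (hK₁₀ : K₁₀ = ControlFunctional.kernelMatrix
      (ControlFunctional.steinKernel π (ControlFunctional.kernelFun H)) x₁ x₀)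
    (hK₁ : K₁ = ControlFunctional.kernelMatrix
      (ControlFunctional.steinKernel π (ControlFunctional.kernelFun H)) x₁ x₁)
    (hK₀_inv : IsUnit K₀) :
    (∀ l > 0, ∃! s : Ω → ℝ, ControlFunctional.IsRLS H π x₀ f l s) ∧
    (∀ s : ℝ → Ω → ℝ, (∀ l > 0, ControlFunctional.IsRLS H π x₀ f l (s l)) →
      ∃ μhat : ℝ,
        Tendsto (fun l => ControlFunctional.estimator π x₁ f (s l)) (𝓝[>] 0) (𝓝 μhat) ∧
        μhat = ControlFunctional.weights K₀ K₁₀ ⬝ᵥ Sum.elim (fun j => f (x₀ j)) (fun i => f (x₁ i)) ∧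
        |μhat - ControlFunctional.mean π f| ≤
          √(ControlFunctional.discrepancy K₀ K₁₀ K₁) * ControlFunctional.normPlus H π f) ∧
    0 ≤ ControlFunctional.discrepancy K₀ K₁₀ K₁ ∧
    ControlFunctional.discrepancy K₀ K₁₀ K₁ =
      ControlFunctional.weights K₀ K₁₀ ⬝ᵥ
        (ControlFunctional.fullMatrix K₀ K₁₀ K₁ *ᵥ ControlFunctional.weights K₀ K₁₀)
      + (1 - ∑ i, ControlFunctional.weights K₀ K₁₀ i) ^ 2 := by
  subst hK₀ hK₁₀ hK₁
  have hdf : ∀ x ∈ Ω, DifferentiableAt ℝ (featureMap H) x := fun x hx =>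
    differentiableAt_featureMap hΩ hk hx
  have hmean : ∀ c (φ : PiLp 2 fun _ : Fin d => H),
      mean π (fun x => c + controlFunctional π φ x) = c := fun c φ =>
    mean_const_add hΩ hπ_one (hint _ ⟨φ, rfl⟩)
      (mean_controlFunctional hd hΩ hbd hπ_pos hπ hk hflux hint φ) c
  have hsymm := kernelMatrix_transpose (π := π) hdf x₀ x₀
  have hpos : ∀ v, 0 ≤ v ⬝ᵥ (kernelMatrix (steinKernel π (kernelFun H)) x₀ x₀ *ᵥ v) := fun v => by
    rw [dotProduct_kernelMatrix_mulVec hdf]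
    exact real_inner_self_nonneg
  have hD := discrepancy_eq hK₀_inv hsymm hpos hp
    (kernelMatrix (steinKernel π (kernelFun H)) x₁ x₀)
    (kernelMatrix (steinKernel π (kernelFun H)) x₁ x₁)
  obtain ⟨a, ha, hlim⟩ := exists_tendsto_coefficients hK₀_inv hpos fun j => f (x₀ j)
  -- the approximation for the coefficients `v` is a constant plus a control functional
  have hrep : ∀ (v : Fin m → ℝ) (x : Ω),
      inner ℝ (plusFeature H π x) (∑ j, v j • plusFeature H π (x₀ j)) =
        1 ⬝ᵥ v + controlFunctional π (∑ j, v j • steinFeature H π (x₀ j)) x := by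
    intro v x
    rw [controlFunctional_eq_inner x (hdf x x.2), inner_sum, inner_sum, dotProduct,
      ← Finset.sum_add_distrib]
    refine Finset.sum_congr rfl fun j _ => ?_
    rw [inner_smul_right, inner_smul_right, inner_plusFeature_plusFeature hdf,
      steinKernel_eq_inner (hdf _ x.2) (hdf _ (x₀ j).2), Pi.one_apply]
    ring
  have hiff : ∀ l > 0, ∀ s, IsRLS H π x₀ f l s ↔ s = fun x => 1 ⬝ᵥ a (l * m) +
      controlFunctional π (∑ j, a (l * m) j • steinFeature H π (x₀ j)) x := by
    intro l hl s
    simp only [← hrep]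
    refine isRLS_iff hdf hm x₀ f hl (fun i => ?_) s
    rw [hrep, controlFunctional_eq_inner _ (hdf _ (x₀ i).2), ← kernelMatrix_mulVec hdf]
    have := congrFun (ha (l * m) (by positivity)) i
    simp only [Pi.add_apply, Pi.smul_apply, Pi.one_apply, smul_eq_mul, mul_one] at this
    linarith
  refine ⟨fun l hl => ⟨_, (hiff l hl _).2 rfl, fun s hs => (hiff l hl s).1 hs⟩, fun s hs => ?_, ?_,
    hD⟩
  · refine ⟨_, ?_, rfl, ?_⟩
    · -- the estimator is a continuous function of the coefficients
      let g : (Fin m → ℝ) → ℝ := fun v => (1 / p : ℝ) * ∑ i, (f (x₁ i) -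
        (kernelMatrix (steinKernel π (kernelFun H)) x₁ x₀ *ᵥ v) i)
      have hg : Continuous g := by
        have : Continuous fun v => kernelMatrix (steinKernel π (kernelFun H)) x₁ x₀ *ᵥ v :=
          continuous_const.matrix_mulVec continuous_id
        fun_prop
      have hest : ∀ l > 0, estimator π x₁ f (s l) = g (a (l * m)) := by
        intro l hl
        rw [(hiff l hl _).1 (hs l hl), estimator, hmean]
        congr 1
        refine Finset.sum_congr rfl fun i _ => ?_
        rw [controlFunctional_eq_inner _ (hdf _ (x₁ i).2), ← kernelMatrix_mulVec hdf]
        ring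
      have hlm : Tendsto (fun l : ℝ => l * m) (𝓝[>] 0) (𝓝[>] 0) := by
        refine tendsto_nhdsWithin_iff.2 ⟨?_, ?_⟩
        · have : Continuous fun l : ℝ => l * m := by fun_prop
          simpa using (this.tendsto 0).mono_left nhdsWithin_le_nhds
        · filter_upwards [self_mem_nhdsWithin] with l hl
          exact mul_pos (mem_Ioi.1 hl) (by positivity)
      have hval : g (a 0) = weights (kernelMatrix (steinKernel π (kernelFun H)) x₀ x₀)
          (kernelMatrix (steinKernel π (kernelFun H)) x₁ x₀) ⬝ᵥ
            Sum.elim (fun j => f (x₀ j)) (fun i => f (x₁ i)) := by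
        have h0 := ha 0 le_rfl
        rw [zero_smul, add_zero] at h0
        exact (weights_dotProduct hK₀_inv hsymm hpos _ h0 _).symm
      rw [← hval]
      refine ((hg.tendsto _).comp (hlim.comp hlm)).congr' ?_
      filter_upwards [self_mem_nhdsWithin] with l hl using (hest l hl).symm
    · obtain ⟨e, he, hnorm⟩ := exists_norm_eq_normPlus hdf hf
      have hmf : mean π f = e.fst := by
        rw [he]
        have : (fun x => inner ℝ (plusFeature H π x) e) =
            fun x => e.fst + controlFunctional π e.snd x :=
          funext fun x => inner_plusFeature hdf x e.fst e.snd
        rw [this, hmean]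
      rw [hmf, hnorm, hD]
      exact abs_weights_dotProduct_sub_le hdf x₀ x₁ _ e he
  · rw [hD, dotProduct_fullMatrix_mulVec hdf]
    positivity
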